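/- **Theorem (Maximum principle).** Let $I=[0,T]$ with $T>0$, let $E$ be a finite-dimensional normed space with dual $E'$, let $U\subset E$, and let $f:I\times E\to E$, $g:I\times E\to L(E,E)$, $\varphi:I\times E\times E\to\mathbb R$, $\psi:I\times E\to L(\mathbb R^d,\mathbb R)$. Let $r>1$ and $\xi\in E$. Write $\|u\|_r=(\int_I|u|^r\,dt)^{1/r}$. *Notions.* The $p$-variation of a path $y$ on $[a,b]$ is $(\sup\sum_i|y(t_{i+1})-y(t_i)|^p)^{1/p}$, the supremum being over finite dissections of $[a,b]$. The Young integral $\int_a^b x\,dy$ is the limit of the sums $\sum_i x(\tau_i)(y(t_{i+1})-y(t_i))$, $\tau_i\in[t_i,t_{i+1}]$, as the mesh of the dissection tends to $0$ (independently of the dissections and of the $\tau_i$). A solution over $[0,S]$, $S\le T$, of the state equation with control $u$ is an absolutely continuous $x:[0,S]\to E$ with $x(0)=\xi$ and $\dot x(t)=f(t,x(t))+g(t,x(t))u(t)$ for almost all $t\in[0,S]$. A pair $(x,u)$ is *admissible* if $u:I\to E$ is measurable, $u(t)\in U$ for almost all $t$, $x$ is a solution over $I$ of the state equation with control $u$,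 and the costs are finite, i.e. $t\mapsto\varphi(t,x(t),u(t))$ is integrable over $I$ and $t\mapsto\psi(t,x(t))$ has finite $p$-variation for some $p\in[1,2)$. An *observation path* is a continuous $\eta:I\to\mathbb R^d$ with finite $p$-variation for every $p>2$. Problem VAR is to minimise $$A(x,u)=\int_I\varphi(t,x(t),u(t))\,dt+\int_I\psi(t,x(t))\,d\eta(t)$$ (the second integral being a Young integral) over all admissible pairs. *Hypotheses.* (1) $f,g$ are continuous. (2) There are $\kappa>\frac12$ and $C_\psi,\alpha\ge0$ such that for every $R\ge0$ the function $\psi$ is Hölder on $I\times\{|x|\le R\}$ with exponent $\kappa$ and a constant $K_R\le C_\psi(1+R^\alpha)$. (3) $U$ is closed and convex. (4) $\varphi$ is continuous on $I\times E\times U$, convex in $u\in U$, and $\varphi(t,x,u)\ge C_\varphi(|u|^r-|x|^\delta)$ on $I\times E\times U$ for some $C_\varphi,\delta>0$. (5) There are $C_s,C_e,\beta,\gamma\ge0$ such that for every measurable $u:I\to E$ with $u\in U$ a.e. and $\|u\|_r<\infty$, every $S\in(0,T]$ and every solution $x$ over $[0,S]$ of the state equation with control $u$, $$\Big(\int_0^S|\dot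 x|^r\,dt\Big)^{1/r}\le C_s(1+\|u\|_r^\beta),\qquad \sup_{[0,S]}|x|\le C_e(1+\|u\|_r^\gamma);$$ moreover $\gamma(\alpha+\kappa-\frac12)+\frac\beta2<r$ and $\gamma\delta<r$. (6) $f,g$ have partial derivatives $\mathrm D_2f,\mathrm D_2g$ with respect to $x$ that are continuous on $I\times E$, and $\varphi$ has a partial derivative $\mathrm D_2\varphi$ with respect to $x$ that is continuous on $I\times E\times U$. (7) There are $R>0$, $c\ge0$ and an integrable $b:I\to[0,\infty)$ such that for every admissible pair $(x,u)$ and almost every $t\in I$: $|\mathrm D_2\varphi(t,y,u(t))|\le c\,|\varphi(t,y,u(t))|+b(t)$ for all $y$ with $|y-x(t)|\le R$. (8) $\psi$ has a partial derivative $\mathrm D_2\psi$ with respect to $x$ which is locally Hölder in $(t,x)$ with exponent larger than $\frac12$. *Conclusion.* Let $\eta$ be an observation path and let $(x,u)$ be a global minimiser of Problem VAR. Then the integral equation $$\lambda(t)=\int_t^T\lambda(s)\{\mathrm D_2f(s,x(s))+\mathrm D_2g(s,x(s))u(s)\}\,ds+\int_t^T\mathrm D_2\varphi(s,x(s),u(s))\,ds+\int_t^T\mathrm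 D_2\psi(s,x(s))\,d\eta(s),\quad t\in I,$$ has a unique solution $\lambda:I\to E'$ (among the functions for which $s\mapsto\lambda(s)\{\mathrm D_2f(s,x(s))+\mathrm D_2g(s,x(s))u(s)\}$ is integrable; the last term is the functional $z\mapsto\int_t^T\mathrm D_2\psi(s,x(s))z\,d\eta(s)$ given by a Young integral, and all integrals in the equation exist), and for almost all $t\in I$ $$H(t,x(t),\lambda(t),u(t))=\min_{v\in U}H(t,x(t),\lambda(t),v),\qquad H(t,x,\lambda,v)=\varphi(t,x,v)+\lambda\big(f(t,x)+g(t,x)v\big).$$ -/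

import Mathlib

open Set MeasureTheory Filter Topology
open scoped NNReal ENNReal

noncomputable section

namespace VarDA

/-! ### Dissections, `p`-variation and Young integrals -/

/-- A finite dissection `a = t₀ ≤ t₁ ≤ … ≤ tₙ = b`. Repeated points are allowed; they contribute
nothing to any of the sums below. Only the values `pt 0, …, pt n` matter. -/
structure Dissection (a b : ℝ) where
  n : ℕ
  pt : ℕ → ℝ
  pt_zero : pt 0 = a
  pt_last : pt n = b
  mono : ∀ i < n, pt i ≤ pt (i + 1)

/-- The `p`-variation of `y` on `[a, b]`, as an element of `[0, ∞]`. -/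
def pVariation {V : Type*} [NormedAddCommGroup V] (p a b : ℝ) (y : ℝ → V) : ℝ≥0∞ :=
  (⨆ D : Dissection a b, ∑ i ∈ Finset.range D.n, ‖y (D.pt (i + 1)) - y (D.pt i)‖ₑ ^ p) ^ (1 / p)

/-- `J` is the Young integral `∫_a^b x dy`: the Riemann sums `∑ x(τᵢ) (y(tᵢ₊₁) - y(tᵢ))` converge
to `J` as the mesh of the dissection tends to zero, whatever the dissections and whatever the
intermediate points `τᵢ ∈ [tᵢ, tᵢ₊₁]`. -/
def IsYoungIntegral {V W : Type*} [NormedAddCommGroup V] [NormedSpace ℝ V]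
    [NormedAddCommGroup W] [NormedSpace ℝ W]
    (a b : ℝ) (x : ℝ → V →L[ℝ] W) (y : ℝ → V) (J : W) : Prop :=
  ∀ ε > 0, ∃ δ > 0, ∀ (D : Dissection a b) (τ : ℕ → ℝ),
    (∀ i < D.n, D.pt (i + 1) - D.pt i < δ) →
    (∀ i < D.n, τ i ∈ Icc (D.pt i) (D.pt (i + 1))) →
    ‖∑ i ∈ Finset.range D.n, x (τ i) (y (D.pt (i + 1)) - y (D.pt i)) - J‖ < ε

/-- The Young integral is unique, so that `youngIntegral` below is well defined. -/
theorem IsYoungIntegral.unique {V W : Type*} [NormedAddCommGroup V] [NormedSpace ℝ V]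
    [NormedAddCommGroup W] [NormedSpace ℝ W]
    {a b : ℝ} (hab : a ≤ b) {x : ℝ → V →L[ℝ] W} {y : ℝ → V} {J J' : W}
    (h : IsYoungIntegral a b x y J) (h' : IsYoungIntegral a b x y J') : J = J' := by
  by_contra hne
  have hpos : 0 < ‖J - J'‖ := norm_pos_iff.mpr (sub_ne_zero.mpr hne)
  obtain ⟨δ, hδ, H⟩ := h (‖J - J'‖ / 2) (by positivity)
  obtain ⟨δ', hδ', H'⟩ := h' (‖J - J'‖ / 2) (by positivity)
  obtain ⟨N, hN⟩ := exists_nat_gt ((b - a) / min δ δ')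
  have hm : 0 < min δ δ' := lt_min hδ hδ'
  have hN0 : (0 : ℝ) < N := lt_of_le_of_lt (div_nonneg (sub_nonneg.mpr hab) hm.le) hN
  have hstep : (b - a) / N < min δ δ' := by
    rw [div_lt_iff₀ hm] at hN
    rw [div_lt_iff₀ hN0]
    linarith
  have hnn : 0 ≤ (b - a) / N := div_nonneg (sub_nonneg.mpr hab) hN0.le
  let D : Dissection a b :=
    { n := N
      pt := fun i => a + i * ((b - a) / N)
      pt_zero := by simp
      pt_last := by field_simp; ring
      mono := fun i _ => by push_cast; nlinarith }
  have hdiff : ∀ i, D.pt (i + 1) - D.pt i = (b - a) / N := fun i => by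
    simp only [D]; push_cast; ring
  have htag : ∀ i < D.n, D.pt i ∈ Icc (D.pt i) (D.pt (i + 1)) := fun i hi =>
    ⟨le_rfl, D.mono i hi⟩
  have h1 := H D D.pt (fun i _ => by
    rw [hdiff]; exact hstep.trans_le (min_le_left _ _)) htag
  have h2 := H' D D.pt (fun i _ => by
    rw [hdiff]; exact hstep.trans_le (min_le_right _ _)) htag
  have h3 := norm_sub_le
    (∑ i ∈ Finset.range D.n, x (D.pt i) (y (D.pt (i + 1)) - y (D.pt i)) - J')
    (∑ i ∈ Finset.range D.n, x (D.pt i) (y (D.pt (i + 1)) - y (D.pt i)) - J)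
  rw [sub_sub_sub_cancel_left] at h3
  linarith

open Classical in
/-- The value of the Young integral `∫_a^b x dy` (and `0` if it does not exist). -/
def youngIntegral {V W : Type*} [NormedAddCommGroup V] [NormedSpace ℝ V]
    [NormedAddCommGroup W] [NormedSpace ℝ W]
    (a b : ℝ) (x : ℝ → V →L[ℝ] W) (y : ℝ → V) : W :=
  if h : ∃ J, IsYoungIntegral a b x y J then h.choose else 0

/-- An observation path on `[0, T]`: continuous, with finite `p`-variation for every `p > 2`. -/
def IsObservationPath {d : ℕ} (T : ℝ) (η : ℝ → EuclideanSpace ℝ (Fin d)) : Prop :=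
  ContinuousOn η (Icc 0 T) ∧ ∀ p : ℝ, 2 < p → pVariation p 0 T η < ∞

/-! ### The control problem -/

/-- The data of the control problem on `I = [0, T]`. Only the values of the functions at times
`t ∈ [0, T]` (and, for the third argument of `φ`, at points of `U`) are relevant. -/
structure ControlProblem (E : Type*) [NormedAddCommGroup E] [NormedSpace ℝ E] (d : ℕ) where
  T : ℝ
  T_pos : 0 < T
  /-- drift of the state equation -/
  f : ℝ → E → E
  /-- control coefficient of the state equation -/
  g : ℝ → E → E →L[ℝ] E
  /-- deterministic running costs -/
  φ : ℝ → E → E → ℝ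
  /-- stochastic running costs -/
  ψ : ℝ → E → EuclideanSpace ℝ (Fin d) →L[ℝ] ℝ
  /-- control set -/
  U : Set E

namespace ControlProblem

variable {E : Type*} [NormedAddCommGroup E] [NormedSpace ℝ E] {d : ℕ}

/-- The time interval `I = [0, T]`. -/
def I (P : ControlProblem E d) : Set ℝ := Icc 0 P.T

/-- `x` is a solution over `[0, S]` of the state equation `ẋ = f(t, x) + g(t, x) u` with
`x(0) = ξ`: it is absolutely continuous and satisfies the equation almost everywhere. -/
def IsSolutionOn (P : ControlProblem E d) (S : ℝ) (ξ : E) (x u : ℝ → E) : Prop :=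
  AbsolutelyContinuousOnInterval x 0 S ∧ x 0 = ξ ∧
    ∀ᵐ t ∂(volume.restrict (Icc 0 S)), HasDerivAt x (P.f t (x t) + P.g t (x t) (u t)) t

/-- A process with respect to `ξ`. -/
def IsStateControlPair (P : ControlProblem E d) (ξ : E) (x u : ℝ → E) : Prop :=
  AEStronglyMeasurable u (volume.restrict P.I) ∧ P.IsSolutionOn P.T ξ x u

/-- A feasible process with respect to `ξ`. -/
def IsFeasible (P : ControlProblem E d) (ξ : E) (x u : ℝ → E) : Prop :=
  P.IsStateControlPair ξ x u ∧ ∀ᵐ t ∂(volume.restrict P.I), u t ∈ P.U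

/-- An admissible process with respect to `ξ`: a feasible process for which the deterministic and
the stochastic costs are defined and finite. -/
def IsAdmissible (P : ControlProblem E d) (ξ : E) (x u : ℝ → E) : Prop :=
  P.IsFeasible ξ x u ∧
    IntegrableOn (fun t => P.φ t (x t) (u t)) P.I ∧
    ∃ p : ℝ, 1 ≤ p ∧ p < 2 ∧ pVariation p 0 P.T (fun t => P.ψ t (x t)) < ∞

/-- The cost functional `A(x, u)`, for the observation path `η`. -/
def cost (P : ControlProblem E d) (η : ℝ → EuclideanSpace ℝ (Fin d)) (x u : ℝ → E) : ℝ :=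
  (∫ t in (0 : ℝ)..P.T, P.φ t (x t) (u t)) + youngIntegral 0 P.T (fun t => P.ψ t (x t)) η

/-- `(x, u)` is a global minimiser of the cost functional over all admissible processes with
respect to `ξ`. -/
def IsGlobalMinimiser (P : ControlProblem E d) (η : ℝ → EuclideanSpace ℝ (Fin d)) (ξ : E)
    (x u : ℝ → E) : Prop :=
  P.IsAdmissible ξ x u ∧ ∀ x' u' : ℝ → E, P.IsAdmissible ξ x' u' → P.cost η x u ≤ P.cost η x' u'

/-- The class `𝒰_r` of measurable `U`-valued controls with finite `L^r` norm over `I`. -/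
def ControlClass (P : ControlProblem E d) (r : ℝ) : Set (ℝ → E) :=
  {u | MemLp u (ENNReal.ofReal r) (volume.restrict P.I) ∧
    ∀ᵐ t ∂(volume.restrict P.I), u t ∈ P.U}

/-- The norm `‖u‖_r` over `I`, for `u` in `𝒰_r`. -/
def controlNorm (P : ControlProblem E d) (r : ℝ) (u : ℝ → E) : ℝ :=
  (eLpNorm u (ENNReal.ofReal r) (volume.restrict P.I)).toReal

/-- The hypotheses under which the problem is well posed, for an exponent `r` and an initial
condition `ξ`. -/
structure BasicHypothesis (P : ControlProblem E d) (r : ℝ) (ξ : E) : Prop where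
  one_lt_r : 1 < r
  continuousOn_f : ContinuousOn (fun p : ℝ × E => P.f p.1 p.2) (P.I ×ˢ univ)
  continuousOn_g : ContinuousOn (fun p : ℝ × E => P.g p.1 p.2) (P.I ×ˢ univ)
  isClosed_U : IsClosed P.U
  convex_U : Convex ℝ P.U
  continuousOn_φ :
    ContinuousOn (fun p : ℝ × E × E => P.φ p.1 p.2.1 p.2.2) (P.I ×ˢ (univ ×ˢ P.U))
  convexOn_φ : ∀ t ∈ P.I, ∀ x : E, ConvexOn ℝ P.U (P.φ t x)
  /-- Growth conditions, with the constants they have in common. -/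
  growth : ∃ (κ : ℝ≥0) (α δ β γ : ℝ), 1 / 2 < (κ : ℝ) ∧ 0 ≤ α ∧ 0 < δ ∧ 0 ≤ β ∧ 0 ≤ γ ∧
    -- local Hölder continuity of `ψ`, with polynomially growing constants
    (∃ (K : ℝ → ℝ≥0) (Cψ : ℝ), 0 ≤ Cψ ∧ ∀ R : ℝ, 0 ≤ R →
      HolderOnWith (K R) κ (fun p : ℝ × E => P.ψ p.1 p.2) (P.I ×ˢ Metric.closedBall 0 R) ∧
      (K R : ℝ) ≤ Cψ * (1 + R ^ α)) ∧
    -- coercivity of `φ`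
    (∃ Cφ : ℝ, 0 < Cφ ∧ ∀ t ∈ P.I, ∀ x : E, ∀ u ∈ P.U,
      Cφ * (‖u‖ ^ r - ‖x‖ ^ δ) ≤ P.φ t x u) ∧
    -- a priori estimates for local solutions, that is, solutions over `[0, S]` with `S ≤ T`
    (∃ Cs Ce : ℝ, 0 ≤ Cs ∧ 0 ≤ Ce ∧ ∀ u ∈ P.ControlClass r, ∀ S : ℝ, 0 < S → S ≤ P.T →
      ∀ x : ℝ → E, P.IsSolutionOn S ξ x u →
        eLpNorm (deriv x) (ENNReal.ofReal r) (volume.restrict (Icc 0 S)) ≤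
          ENNReal.ofReal (Cs * (1 + P.controlNorm r u ^ β)) ∧
        ∀ t ∈ Icc 0 S, ‖x t‖ ≤ Ce * (1 + P.controlNorm r u ^ γ)) ∧
    γ * (α + κ - 1 / 2) + β / 2 < r ∧ γ * δ < r

/-- The strengthened hypotheses for the maximum principle. `fderiv ℝ (P.f t) x` is the partial
derivative `D₂ f(t, x)`, and similarly for `g`, `φ` and `ψ`. -/
structure SmoothHypothesis (P : ControlProblem E d) (r : ℝ) (ξ : E) : Prop
    extends P.BasicHypothesis r ξ where
  differentiable_f : ∀ t ∈ P.I, Differentiable ℝ (P.f t)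
  continuousOn_D₂f : ContinuousOn (fun p : ℝ × E => fderiv ℝ (P.f p.1) p.2) (P.I ×ˢ univ)
  differentiable_g : ∀ t ∈ P.I, Differentiable ℝ (P.g t)
  continuousOn_D₂g : ContinuousOn (fun p : ℝ × E => fderiv ℝ (P.g p.1) p.2) (P.I ×ˢ univ)
  differentiable_φ : ∀ t ∈ P.I, ∀ u ∈ P.U, Differentiable ℝ (fun z => P.φ t z u)
  continuousOn_D₂φ : ContinuousOn
    (fun p : ℝ × E × E => fderiv ℝ (fun z => P.φ p.1 z p.2.2) p.2.1) (P.I ×ˢ (univ ×ˢ P.U))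
  bound_D₂φ : ∃ (R c : ℝ) (b : ℝ → ℝ), 0 < R ∧ 0 ≤ c ∧ (∀ t ∈ P.I, 0 ≤ b t) ∧
    IntegrableOn b P.I ∧
    ∀ x u : ℝ → E, P.IsAdmissible ξ x u → ∀ᵐ t ∂(volume.restrict P.I),
      ∀ y : E, ‖y - x t‖ ≤ R → ‖fderiv ℝ (fun z => P.φ t z (u t)) y‖ ≤ c * |P.φ t y (u t)| + b t
  differentiable_ψ : ∀ t ∈ P.I, Differentiable ℝ (P.ψ t)
  holder_D₂ψ : ∀ q ∈ P.I ×ˢ (univ : Set E), ∃ (κ' K : ℝ≥0), 1 / 2 < (κ' : ℝ) ∧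
    ∃ N ∈ 𝓝[P.I ×ˢ univ] q,
      HolderOnWith K κ' (fun p : ℝ × E => fderiv ℝ (P.ψ p.1) p.2) N

/-! ### Costate and Hamiltonian -/

/-- The linear map `D₂ f(s, x(s)) + D₂ g(s, x(s)) u(s)`, that is,
`z ↦ (D₂ f(s, x(s))) z + ((D₂ g(s, x(s))) z) u(s)`. -/
def linearisation (P : ControlProblem E d) (x u : ℝ → E) (s : ℝ) : E →L[ℝ] E :=
  fderiv ℝ (P.f s) (x s) + (fderiv ℝ (P.g s) (x s)).flip (u s)

/-- `lam : I → E'` solves the costate equation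
`λ(t) = ∫_t^T λ(s) {D₂ f + D₂ g u} ds + ∫_t^T D₂ φ ds + ∫_t^T D₂ ψ dη_s` for all `t ∈ I`, all the
integrals being defined. The third one is the functional `z ↦ ∫_t^T D₂ψ(s, x(s)) z dη_s`. -/
def IsCostate (P : ControlProblem E d) (η : ℝ → EuclideanSpace ℝ (Fin d)) (x u : ℝ → E)
    (lam : ℝ → E →L[ℝ] ℝ) : Prop :=
  IntegrableOn (fun s => (lam s).comp (P.linearisation x u s)) P.I ∧
  IntegrableOn (fun s => fderiv ℝ (fun z => P.φ s z (u s)) (x s)) P.I ∧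
  ∀ t ∈ P.I, ∃ J : E →L[ℝ] ℝ,
    (∀ z : E, IsYoungIntegral t P.T (fun s => fderiv ℝ (P.ψ s) (x s) z) η (J z)) ∧
    lam t = (∫ s in t..P.T, (lam s).comp (P.linearisation x u s))
      + (∫ s in t..P.T, fderiv ℝ (fun z => P.φ s z (u s)) (x s)) + J

/-- The Hamiltonian `H(t, x, λ, v) = φ(t, x, v) + λ (f(t, x) + g(t, x) v)`. -/
def hamiltonian (P : ControlProblem E d) (t : ℝ) (x : E) (l : E →L[ℝ] ℝ) (v : E) : ℝ :=
  P.φ t x v + l (P.f t x + P.g t x v)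

end ControlProblem

end VarDA

end

noncomputable section

set_option linter.unusedSectionVars false

namespace VarDA

/-! ### Young integration -/

section Young

variable {F G : Type*} [NormedAddCommGroup F] [NormedSpace ℝ F]
  [NormedAddCommGroup G] [NormedSpace ℝ G]

/-! The minimiser is compared with processes driven by `u + ε k`, where `k` equals `w - u` on a
measurable set `S` of times and zero elsewhere, for a fixed `w ∈ U`. Such controls are `U`-valued by
convexity. The perturbed state is `x + ε z` with `z` bounded independently of `ε`
(`exists_perturbation`). Convexity of `φ` in the control bounds the cost of the change of control by
`ε` times the switching gain `φ(t, y, w) - φ(t, y, u)` on `S`, so no derivative of `φ` in the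
control occurs.

The cost difference is nonnegative; it is divided by `ε` and `ε` tends to zero. The directions `z`
need not converge. One shows only that difference quotients minus their linear parts in `z` tend to
zero, and removes the linear parts exactly, before the limit, by pairing with the costate: the
product rule for `λ z` (`isYoungIntegral_of_duality`) expresses `∫ D₂ψ z dη` by Lebesgue integrals.
What survives is that the integral over `S` of `H(w) - H(u)` is nonnegative
(`integral_hamiltonian_nonneg`). Since `S` is arbitrary, `H(u) ≤ H(w)` almost everywhere for each
`w`; a countable dense set of `w` and continuity give the minimum.

The velocity of a state is merely integrable, so states need not be Hölder in time. They are
Lipschitz with respect to a clock `V(t) = t + ∫₀ᵗ m`, and the integrands `ψ(t, x)`, `D₂ψ(t, x)` are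
then Hölder in `V` with an exponent `κ > 1/2`, while `η` is Hölder in a monotone `Z` with an
exponent `q`, where `κ + q > 1`. A discrete sewing estimate yields Young primitives and the
convergence of Young integrals of uniformly controlled integrands (`YoungControl.tendsto_zero`),
which is applied to the difference quotients of `ψ` minus its derivative.

The deterministic costs near `x` are dominated by an integrable function, because the bound on `D₂φ`
by `φ` itself can be integrated by Gronwall's lemma (`exists_dominating`). State and costate are
both found by a contraction in an exponentially weighted norm (`exists_eq_integral`); uniqueness of
the costate is Gronwall's lemma backwards in time. -/

/-- The constant in the discrete Young–Loeve estimate with exponent `θ`. -/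
def sewingConst (θ : ℝ) : ℝ := 2 / (1 - 2 ^ (1 - θ))

theorem sewingConst_denom_pos {θ : ℝ} (hθ : 1 < θ) : 0 < 1 - (2 : ℝ) ^ (1 - θ) := by
  have : (2 : ℝ) ^ (1 - θ) < 1 := Real.rpow_lt_one_of_one_lt_of_neg (by norm_num) (by linarith)
  linarith

theorem sewingConst_nonneg {θ : ℝ} (hθ : 1 < θ) : 0 ≤ sewingConst θ :=
  div_nonneg (by norm_num) (sewingConst_denom_pos hθ).le

/-- Discrete sewing lemma: if `A` is additive up to `C (Zₖ - Zᵢ) ^ θ`, then the sum of `A` over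
consecutive indices differs from `A i k` by at most a constant times `C (Zₖ - Zᵢ) ^ θ`. -/
theorem norm_sum_Ico_sub_le {A : ℕ → ℕ → G} {Z : ℕ → ℝ} {θ C : ℝ} {n : ℕ} (hθ : 1 < θ)
    (hC : 0 ≤ C) (hZ : ∀ i j, i ≤ j → j ≤ n → Z i ≤ Z j) (hA0 : ∀ i, A i i = 0)
    (hA : ∀ i j k, i ≤ j → j ≤ k → k ≤ n → ‖A i k - A i j - A j k‖ ≤ C * (Z k - Z i) ^ θ) :
    ∀ m i k, k - i = m → i ≤ k → k ≤ n →
      ‖∑ l ∈ Finset.Ico i k, A l (l + 1) - A i k‖ ≤ sewingConst θ * C * (Z k - Z i) ^ θ := by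
  intro m
  induction m using Nat.strong_induction_on with
  | _ m ih =>
  intro i k hm hik hkn
  have hw : 0 ≤ Z k - Z i := sub_nonneg.2 (hZ i k hik hkn)
  have hK := sewingConst_nonneg hθ
  rcases hik.eq_or_lt with rfl | hlt
  · simp only [Finset.Ico_self, Finset.sum_empty, hA0, sub_zero, norm_zero]
    positivity
  set w := Z k - Z i with hw_def
  -- `Z` passes the middle of its range in the cell from `j` to `j + 1`. Dropping this cell leaves
  -- two blocks over each of which `Z` grows by at most `w / 2`. Searching only up to `k - 1` keeps
  -- the cell inside the block.
  obtain ⟨j, hij, hjk, hj1, hj2⟩ : ∃ j, i ≤ j ∧ j < k ∧ Z j - Z i ≤ w / 2 ∧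
      Z k - Z (j + 1) ≤ w / 2 := by
    set j := Nat.findGreatest (fun j => i ≤ j ∧ Z j - Z i ≤ w / 2) (k - 1) with hj
    have h0 : i ≤ i ∧ Z i - Z i ≤ w / 2 := ⟨le_rfl, by simp only [sub_self]; positivity⟩
    have hspec : i ≤ j ∧ Z j - Z i ≤ w / 2 :=
      Nat.findGreatest_spec (P := fun j => i ≤ j ∧ Z j - Z i ≤ w / 2) (by omega : i ≤ k - 1) h0
    have hjle : j ≤ k - 1 := Nat.findGreatest_le _
    refine ⟨j, hspec.1, by omega, hspec.2, ?_⟩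
    rcases (show j + 1 ≤ k by omega).eq_or_lt with h | h
    · rw [h, sub_self]; positivity
    · have hn := Nat.findGreatest_is_greatest (P := fun j => i ≤ j ∧ Z j - Z i ≤ w / 2)
        (n := k - 1) (k := j + 1) (by rw [← hj]; omega) (by omega)
      have h3 : w / 2 < Z (j + 1) - Z i := by
        by_contra hcon
        exact hn ⟨by omega, not_lt.1 hcon⟩
      linarith
  have e1 := ih (j - i) (by omega) i j rfl hij (by omega)
  have e2 := ih (k - (j + 1)) (by omega) (j + 1) k rfl hjk hkn
  have d1 := hA i j k hij hjk.le hkn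
  have d2 := hA j (j + 1) k (by omega) hjk hkn
  have hsum : ∑ l ∈ Finset.Ico i k, A l (l + 1) = ∑ l ∈ Finset.Ico i j, A l (l + 1) +
      A j (j + 1) + ∑ l ∈ Finset.Ico (j + 1) k, A l (l + 1) := by
    rw [← Finset.sum_Ico_consecutive _ hij hjk.le, Finset.sum_eq_sum_Ico_succ_bot hjk, add_assoc]
  have hθ0 : 0 ≤ θ := by linarith
  have m1 : (Z j - Z i) ^ θ ≤ (w / 2) ^ θ :=
    Real.rpow_le_rpow (sub_nonneg.2 (hZ i j hij (by omega))) hj1 hθ0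
  have m2 : (Z k - Z (j + 1)) ^ θ ≤ (w / 2) ^ θ :=
    Real.rpow_le_rpow (sub_nonneg.2 (hZ _ _ hjk hkn)) hj2 hθ0
  have m3 : (Z k - Z j) ^ θ ≤ w ^ θ :=
    Real.rpow_le_rpow (sub_nonneg.2 (hZ _ _ hjk.le hkn))
      (by have := hZ i j hij (by omega); linarith) hθ0
  -- The constant solves `K = 2 ^ (1 - θ) * K + 2`: the two blocks reproduce the bound with the
  -- factor `2 * (1 / 2) ^ θ`, and cutting at `j` and at `j + 1` costs one defect each.
  have key : sewingConst θ * C * (w / 2) ^ θ + sewingConst θ * C * (w / 2) ^ θ + C * w ^ θ +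
      C * w ^ θ = sewingConst θ * C * w ^ θ := by
    have hd := sewingConst_denom_pos hθ
    have h2 : (2 : ℝ) ^ (1 - θ) = 2 / 2 ^ θ := by
      rw [Real.rpow_sub (by norm_num), Real.rpow_one]
    have h2p : (0 : ℝ) < 2 ^ θ := by positivity
    rw [Real.div_rpow hw (by norm_num), sewingConst]
    rw [h2] at hd ⊢
    field_simp
    have : (2 : ℝ) ^ θ - 2 ≠ 0 := by
      intro h
      have : (2 : ℝ) / 2 ^ θ = 1 := by rw [div_eq_one_iff_eq h2p.ne']; linarith
      linarith
    field_simp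
    ring
  calc ‖∑ l ∈ Finset.Ico i k, A l (l + 1) - A i k‖
      = ‖(∑ l ∈ Finset.Ico i j, A l (l + 1) - A i j) +
          (∑ l ∈ Finset.Ico (j + 1) k, A l (l + 1) - A (j + 1) k) -
          (A i k - A i j - A j k) - (A j k - A j (j + 1) - A (j + 1) k)‖ := by
        rw [hsum]; congr 1; abel
    _ ≤ ‖∑ l ∈ Finset.Ico i j, A l (l + 1) - A i j‖ +
          ‖∑ l ∈ Finset.Ico (j + 1) k, A l (l + 1) - A (j + 1) k‖ +
          ‖A i k - A i j - A j k‖ + ‖A j k - A j (j + 1) - A (j + 1) k‖ :=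
        (norm_sub_le _ _).trans (by
          gcongr
          exact (norm_sub_le _ _).trans (by gcongr; exact norm_add_le _ _))
    _ ≤ sewingConst θ * C * (w / 2) ^ θ + sewingConst θ * C * (w / 2) ^ θ + C * w ^ θ +
          C * w ^ θ := by
        have hKC : 0 ≤ sewingConst θ * C := by positivity
        gcongr
        · exact e1.trans (by gcongr)
        · exact e2.trans (by gcongr)
        · exact d2.trans (by gcongr)
    _ = sewingConst θ * C * w ^ θ := key

/-- `V` and `Z` control the increments of an integrand (by `(ΔV) ^ κ`) and of the integrator `η`
(by `(ΔZ) ^ q`) on `[a, b]`, with complementary exponents. -/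
structure YoungControl (a b κ q : ℝ) (V Z : ℝ → ℝ) (η : ℝ → F) : Prop where
  le : a ≤ b
  mono : MonotoneOn V (Icc a b)
  cont : ContinuousOn V (Icc a b)
  sub_le : ∀ s ∈ Icc a b, ∀ t ∈ Icc a b, s ≤ t → V t - V s ≤ Z t - Z s
  norm_le : ∀ s ∈ Icc a b, ∀ t ∈ Icc a b, s ≤ t → ‖η t - η s‖ ≤ (Z t - Z s) ^ q
  one_lt : 1 < κ + q
  q_pos : 0 < q
  q_le : q ≤ 1

/-- `x` is Hölder continuous with respect to the increments of `V`. -/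
def ControlledBy (a b κ M : ℝ) (V : ℝ → ℝ) (x : ℝ → G) : Prop :=
  ∀ s ∈ Icc a b, ∀ t ∈ Icc a b, s ≤ t → ‖x t - x s‖ ≤ M * (V t - V s) ^ κ

namespace YoungControl

variable {a b κ q : ℝ} {V Z : ℝ → ℝ} {η : ℝ → F}

/-- The error term of the Young–Loeve estimate. -/
def err (κ q : ℝ) (V Z : ℝ → ℝ) (s t : ℝ) : ℝ :=
  (V t - V s) ^ ((κ + q - 1) / 2) * (Z t - Z s) ^ ((κ + q + 1) / 2)

theorem V_nonneg (h : YoungControl a b κ q V Z η) {s t : ℝ} (hs : s ∈ Icc a b) (ht : t ∈ Icc a b)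
    (hst : s ≤ t) : 0 ≤ V t - V s :=
  sub_nonneg.2 (h.mono hs ht hst)

theorem Z_nonneg (h : YoungControl a b κ q V Z η) {s t : ℝ} (hs : s ∈ Icc a b) (ht : t ∈ Icc a b)
    (hst : s ≤ t) : 0 ≤ Z t - Z s :=
  (h.V_nonneg hs ht hst).trans (h.sub_le s hs t ht hst)

theorem mono_Z (h : YoungControl a b κ q V Z η) : MonotoneOn Z (Icc a b) :=
  fun _ hs _ ht hst => sub_nonneg.1 (h.Z_nonneg hs ht hst)

/-- Half of the surplus `κ + q - 1` stays as an exponent on `V`, whose continuity supplies smallness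
on short intervals. The rest of the power of `v` is moved to `z` by `v ≤ z` and lifts its exponent
above `1`, as sewing requires. In this way no continuity of `Z` is needed. -/
theorem mul_le (h : YoungControl a b κ q V Z η) {v v' z : ℝ} (hv : 0 ≤ v) (hvv : v ≤ v')
    (hvz : v ≤ z) :
    v ^ κ * z ^ q ≤ v' ^ ((κ + q - 1) / 2) * z ^ ((κ + q + 1) / 2) := by
  have h1 := h.one_lt; have h2 := h.q_le; have h3 := h.q_pos
  have hz := hv.trans hvz
  have e1 : v ^ κ = v ^ ((κ + q - 1) / 2) * v ^ ((κ - q + 1) / 2) := by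
    rw [← Real.rpow_add_of_nonneg hv (by linarith) (by linarith)]; congr 1; ring
  have e2 : z ^ ((κ + q + 1) / 2) = z ^ ((κ - q + 1) / 2) * z ^ q := by
    rw [← Real.rpow_add_of_nonneg hz (by linarith) (by linarith)]; congr 1; ring
  rw [e1, e2, mul_assoc]
  have : 0 ≤ (κ + q - 1) / 2 := by linarith
  have : 0 ≤ (κ - q + 1) / 2 := by linarith
  have := Real.rpow_nonneg (hv.trans hvv) ((κ + q - 1) / 2)
  gcongr

theorem err_nonneg (h : YoungControl a b κ q V Z η) {s t : ℝ} (hs : s ∈ Icc a b)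
    (ht : t ∈ Icc a b) (hst : s ≤ t) : 0 ≤ err κ q V Z s t :=
  mul_nonneg (Real.rpow_nonneg (h.V_nonneg hs ht hst) _)
    (Real.rpow_nonneg (h.Z_nonneg hs ht hst) _)

theorem mul_le_err (h : YoungControl a b κ q V Z η) {s t : ℝ} (hs : s ∈ Icc a b)
    (ht : t ∈ Icc a b) (hst : s ≤ t) : (V t - V s) ^ κ * (Z t - Z s) ^ q ≤ err κ q V Z s t :=
  h.mul_le (h.V_nonneg hs ht hst) le_rfl (h.sub_le s hs t ht hst)

/-- The error term is small compared with the increments of `Z` on short intervals. -/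
theorem err_le (h : YoungControl a b κ q V Z η) {ε : ℝ} (hε : 0 < ε) :
    ∃ δ > 0, ∀ s ∈ Icc a b, ∀ t ∈ Icc a b, s ≤ t → t - s < δ →
      err κ q V Z s t ≤ ε * (Z t - Z s) := by
  have h1 := h.one_lt
  set ρ := (κ + q - 1) / 2 with hρ
  have hρ0 : 0 < ρ := by rw [hρ]; linarith
  set B := (Z b - Z a) ^ ρ + 1 with hB
  have hab : a ∈ Icc a b := ⟨le_rfl, h.le⟩
  have hbb : b ∈ Icc a b := ⟨h.le, le_rfl⟩
  have hB0 : 0 < B := by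
    have := Real.rpow_nonneg (h.Z_nonneg hab hbb h.le) ρ
    linarith
  -- Smallness comes from `V` alone: `(ΔV) ^ ρ ≤ ε / B` on short intervals. The other factor is
  -- `(ΔZ) ^ (ρ + 1)`, of which one `ΔZ` is kept and the rest is bounded by `B`.
  have huc := isCompact_Icc.uniformContinuousOn_of_continuous h.cont
  rw [Metric.uniformContinuousOn_iff] at huc
  obtain ⟨δ, hδ, H⟩ := huc ((ε / B) ^ (1 / ρ)) (by positivity)
  refine ⟨δ, hδ, fun s hs t ht hst hlt => ?_⟩
  have hV := h.V_nonneg hs ht hst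
  have hZ := h.Z_nonneg hs ht hst
  have h2 : V t - V s ≤ (ε / B) ^ (1 / ρ) := by
    have := H t ht s hs (by rw [Real.dist_eq, abs_of_nonneg (by linarith)]; exact hlt)
    rw [Real.dist_eq, abs_of_nonneg hV] at this
    exact this.le
  have h3 : (V t - V s) ^ ρ ≤ ε / B := by
    calc (V t - V s) ^ ρ ≤ ((ε / B) ^ (1 / ρ)) ^ ρ := Real.rpow_le_rpow hV h2 hρ0.le
      _ = ε / B := by
        rw [← Real.rpow_mul (by positivity), one_div_mul_cancel hρ0.ne', Real.rpow_one]
  have h4 : (Z t - Z s) ^ ((κ + q + 1) / 2) = (Z t - Z s) ^ ρ * (Z t - Z s) := by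
    rw [← Real.rpow_add_one' hZ (by positivity)]; congr 1; rw [hρ]; ring
  have h5 : (Z t - Z s) ^ ρ ≤ B := by
    have e1 := h.mono_Z hab hs hs.1
    have e2 := h.mono_Z ht hbb ht.2
    have : (Z t - Z s) ^ ρ ≤ (Z b - Z a) ^ ρ := Real.rpow_le_rpow hZ (by linarith) hρ0.le
    linarith
  rw [err, ← hρ, h4]
  calc (V t - V s) ^ ρ * ((Z t - Z s) ^ ρ * (Z t - Z s)) ≤ ε / B * (B * (Z t - Z s)) := by gcongr
    _ = ε * (Z t - Z s) := by field_simp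

/-- Discrete Young–Loeve estimate. -/
theorem norm_sum_sub_le (h : YoungControl a b κ q V Z η) {M : ℝ} (hM : 0 ≤ M)
    {x : ℝ → F →L[ℝ] G} (hx : ControlledBy a b κ M V x) {s t : ℝ} (hs : s ∈ Icc a b)
    (ht : t ∈ Icc a b) {c : ℕ → ℝ} {n : ℕ} (hc : Monotone c) (hc0 : c 0 = s) (hcn : c n = t) :
    ‖∑ i ∈ Finset.range n, x (c i) (η (c (i + 1)) - η (c i)) - x s (η t - η s)‖ ≤
      sewingConst ((κ + q + 1) / 2) * M * err κ q V Z s t := by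
  have hmem : ∀ i ≤ n, c i ∈ Icc a b := fun i hi =>
    ⟨hs.1.trans (hc0 ▸ hc (Nat.zero_le i)), (hcn ▸ hc hi).trans ht.2⟩
  have hst : s ≤ t := by rw [← hc0, ← hcn]; exact hc (Nat.zero_le n)
  have h1 := h.one_lt
  have hV := h.V_nonneg hs ht hst
  -- Sewing takes place in `Z` only; the power of the increment of `V` over all of `[s, t]` is
  -- frozen into the constant.
  have key := norm_sum_Ico_sub_le (A := fun i j => x (c i) (η (c j) - η (c i)))
    (Z := fun i => Z (c i)) (θ := (κ + q + 1) / 2)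
    (C := M * (V t - V s) ^ ((κ + q - 1) / 2)) (n := n) (by linarith) (by positivity)
    (fun i j hij hj => h.mono_Z (hmem i (hij.trans hj)) (hmem j hj) (hc hij))
    (fun i => by simp) ?_ n 0 n (by simp) (Nat.zero_le n) le_rfl
  · rw [Finset.range_eq_Ico]
    simp only [hc0, hcn] at key
    refine key.trans (le_of_eq ?_)
    rw [err]; ring
  · intro i j k hij hjk hk
    have hi := hmem i (hij.trans (hjk.trans hk))
    have hj := hmem j (hjk.trans hk)
    have hk' := hmem k hk
    have e : x (c i) (η (c k) - η (c i)) - x (c i) (η (c j) - η (c i)) -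
        x (c j) (η (c k) - η (c j)) = (x (c i) - x (c j)) (η (c k) - η (c j)) := by
      simp only [sub_apply, map_sub]; abel
    rw [e]
    have hVi : V s ≤ V (c i) := h.mono hs hi (hc0 ▸ hc (Nat.zero_le i))
    have hVk : V (c k) ≤ V t := h.mono hk' ht (hcn ▸ hc hk)
    have hVjk := h.V_nonneg hj hk' (hc hjk)
    have hVij := h.V_nonneg hi hj (hc hij)
    have hZij := h.Z_nonneg hi hj (hc hij)
    calc ‖(x (c i) - x (c j)) (η (c k) - η (c j))‖
        ≤ ‖x (c i) - x (c j)‖ * ‖η (c k) - η (c j)‖ := ContinuousLinearMap.le_opNorm _ _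
      _ ≤ (M * (V (c j) - V (c i)) ^ κ) * (Z (c k) - Z (c j)) ^ q := by
          gcongr
          · rw [norm_sub_rev]; exact hx _ hi _ hj (hc hij)
          · exact h.norm_le _ hj _ hk' (hc hjk)
      _ ≤ (M * (V (c j) - V (c i)) ^ κ) * (Z (c k) - Z (c i)) ^ q := by
          have := h.Z_nonneg hj hk' (hc hjk)
          have := h.q_pos.le
          gcongr
          linarith
      _ = M * ((V (c j) - V (c i)) ^ κ * (Z (c k) - Z (c i)) ^ q) := by ring
      _ ≤ M * ((V t - V s) ^ ((κ + q - 1) / 2) * (Z (c k) - Z (c i)) ^ ((κ + q + 1) / 2)) := by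
          have := h.sub_le _ hi _ hk' (hc (hij.trans hjk))
          exact mul_le_mul_of_nonneg_left (h.mul_le hVij (by linarith) (by linarith)) hM
      _ = _ := by ring

end YoungControl

/-- `J` is a primitive of `x dη` on `[a, b]`: its increments agree with those of the Riemann sums
up to small multiples of the increments of `Z`. -/
def IsYoungPrimitive (a b : ℝ) (Z : ℝ → ℝ) (x : ℝ → F →L[ℝ] G) (η : ℝ → F) (J : ℝ → G) : Prop :=
  ∀ ε > 0, ∃ δ > 0, ∀ s ∈ Icc a b, ∀ t ∈ Icc a b, s ≤ t → t - s < δ → ∀ τ ∈ Icc s t,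
    ‖J t - J s - x τ (η t - η s)‖ ≤ ε * (Z t - Z s)

theorem Dissection.le_of_le {a b : ℝ} (D : Dissection a b) {i j : ℕ} (hij : i ≤ j) (hj : j ≤ D.n) :
    D.pt i ≤ D.pt j := by
  induction j, hij using Nat.le_induction with
  | base => exact le_rfl
  | succ k hk ih => exact (ih (by omega)).trans (D.mono k (by omega))

theorem Dissection.pt_mem {a b : ℝ} (D : Dissection a b) {i : ℕ} (hi : i ≤ D.n) :
    D.pt i ∈ Icc a b :=
  ⟨D.pt_zero.symm.le.trans (D.le_of_le (Nat.zero_le i) hi), (D.le_of_le hi le_rfl).trans D.pt_last.le⟩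

theorem Dissection.sum_sub {W : Type*} [AddCommGroup W] {a b : ℝ} (D : Dissection a b)
    (J : ℝ → W) : ∑ i ∈ Finset.range D.n, (J (D.pt (i + 1)) - J (D.pt i)) = J b - J a := by
  rw [Finset.sum_range_sub (fun i => J (D.pt i)), D.pt_zero, D.pt_last]

/-- Each cell is off by at most `ε` times its increment of `Z`, and the increments of `J` and `Z`
telescope. -/
theorem IsYoungPrimitive.norm_sum_le {a b s t ε δ : ℝ} {Z : ℝ → ℝ} {x : ℝ → F →L[ℝ] G}
    {η : ℝ → F} {J : ℝ → G} (hs : a ≤ s) (ht : t ≤ b)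
    (H : ∀ s ∈ Icc a b, ∀ t ∈ Icc a b, s ≤ t → t - s < δ → ∀ τ ∈ Icc s t,
      ‖J t - J s - x τ (η t - η s)‖ ≤ ε * (Z t - Z s))
    (D : Dissection s t) (τ : ℕ → ℝ) (hD : ∀ i < D.n, D.pt (i + 1) - D.pt i < δ)
    (hτ : ∀ i < D.n, τ i ∈ Icc (D.pt i) (D.pt (i + 1))) :
    ‖∑ i ∈ Finset.range D.n, x (τ i) (η (D.pt (i + 1)) - η (D.pt i)) - (J t - J s)‖ ≤
      ε * (Z t - Z s) := by
  rw [← D.sum_sub J, ← D.sum_sub Z, ← Finset.sum_sub_distrib, Finset.mul_sum]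
  refine (_root_.norm_sum_le _ _).trans (Finset.sum_le_sum fun i hi => ?_)
  have hi' := Finset.mem_range.1 hi
  have m1 := D.pt_mem hi'.le
  have m2 := D.pt_mem (show i + 1 ≤ D.n by omega)
  rw [norm_sub_rev]
  exact H _ ⟨hs.trans m1.1, m1.2.trans ht⟩ _ ⟨hs.trans m2.1, m2.2.trans ht⟩ (D.mono i hi')
    (hD i hi') _ (hτ i hi')

theorem IsYoungPrimitive.isYoungIntegral {a b : ℝ} {Z : ℝ → ℝ} {x : ℝ → F →L[ℝ] G} {η : ℝ → F}
    {J : ℝ → G} (h : IsYoungPrimitive a b Z x η J) (hZ : MonotoneOn Z (Icc a b)) {s t : ℝ}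
    (hs : a ≤ s) (hst : s ≤ t) (ht : t ≤ b) : IsYoungIntegral s t x η (J t - J s) := by
  intro ε hε
  have hZ0 : 0 ≤ Z t - Z s := sub_nonneg.2 (hZ ⟨hs, hst.trans ht⟩ ⟨hs.trans hst, ht⟩ hst)
  obtain ⟨δ, hδ, H⟩ := h (ε / (Z t - Z s + 1)) (by positivity)
  refine ⟨δ, hδ, fun D τ hD hτ => (norm_sum_le hs ht H D τ hD hτ).trans_lt ?_⟩
  rw [div_mul_eq_mul_div, div_lt_iff₀ (by positivity)]
  nlinarith

/-- The dissection of `[a, b]` into `n + 1` intervals of the same length. -/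
def uniformDissection {a b : ℝ} (hab : a ≤ b) (n : ℕ) : Dissection a b where
  n := n + 1
  pt i := a + i * ((b - a) / (n + 1))
  pt_zero := by simp
  pt_last := by push_cast; field_simp; ring
  mono i _ := by
    have : 0 ≤ (b - a) / (n + 1) := div_nonneg (sub_nonneg.2 hab) (by positivity)
    push_cast; nlinarith

theorem uniformDissection_sub {a b : ℝ} (hab : a ≤ b) (n i : ℕ) :
    (uniformDissection hab n).pt (i + 1) - (uniformDissection hab n).pt i = (b - a) / (n + 1) := by
  simp only [uniformDissection]; push_cast; ring

theorem uniformDissection_monotone {a b : ℝ} (hab : a ≤ b) (n : ℕ) :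
    Monotone (uniformDissection hab n).pt := by
  refine monotone_nat_of_le_succ fun i => sub_nonneg.1 ?_
  rw [uniformDissection_sub]
  exact div_nonneg (sub_nonneg.2 hab) (by positivity)

theorem tendsto_mesh (l : ℝ) : Tendsto (fun n : ℕ => l / ((n : ℝ) + 1)) atTop (𝓝 0) := by
  simpa [div_eq_mul_inv] using (tendsto_one_div_add_atTop_nhds_zero_nat (𝕜 := ℝ)).const_mul l

namespace YoungControl

variable {a b κ q : ℝ} {V Z : ℝ → ℝ} {η : ℝ → F}

/-- Riemann sums for the integrator `η` stopped at time `t`. -/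
def stoppedSum (hab : a ≤ b) (x : ℝ → F →L[ℝ] G) (η : ℝ → F) (n : ℕ) (t : ℝ) : G :=
  ∑ i ∈ Finset.range (n + 1), x ((uniformDissection hab n).pt i)
    (η (min ((uniformDissection hab n).pt (i + 1)) t) - η (min ((uniformDissection hab n).pt i) t))

/-- The increment of the stopped sums between `s` and `t` is a Riemann sum over the grid clamped to
`[s, t]`, except that the tag of a cell cut by `s` remains at the grid point to the left of `s`. The
discrete estimate applies once the tags are moved, and moving them costs at most `ε`, for all `s`
and `t` at once, when the mesh is small. -/
theorem norm_stoppedSum_le (h : YoungControl a b κ q V Z η) {M : ℝ} (hM : 0 ≤ M)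
    {x : ℝ → F →L[ℝ] G} (hx : ControlledBy a b κ M V x) {ε : ℝ} (hε : 0 < ε) :
    ∀ᶠ n in atTop, ∀ s ∈ Icc a b, ∀ t ∈ Icc a b, s ≤ t →
      ‖stoppedSum h.le x η n t - stoppedSum h.le x η n s - x s (η t - η s)‖ ≤
        sewingConst ((κ + q + 1) / 2) * M * err κ q V Z s t + ε := by
  have hab : a ∈ Icc a b := ⟨le_rfl, h.le⟩
  have hbb : b ∈ Icc a b := ⟨h.le, le_rfl⟩
  have hZab := h.Z_nonneg hab hbb h.le
  obtain ⟨δ, hδ, hsmall⟩ := h.err_le (ε := ε / (M * (Z b - Z a) + 1)) (by positivity)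
  filter_upwards [(tendsto_mesh (b - a)).eventually (gt_mem_nhds hδ)] with n hn s hs t ht hst
  set D := uniformDissection h.le n with hD
  set d := D.pt with hd
  have hdm : Monotone d := uniformDissection_monotone h.le n
  have hDn : D.n = n + 1 := rfl
  have hdmem : ∀ i ≤ n + 1, d i ∈ Icc a b := fun i hi => D.pt_mem (hDn ▸ hi)
  set c : ℕ → ℝ := fun i => max s (min (d i) t) with hc
  have hcm : Monotone c := fun i j hij => max_le_max le_rfl (min_le_min (hdm hij) le_rfl)
  have hcmem : ∀ i, c i ∈ Icc a b := fun i =>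
    ⟨hs.1.trans (le_max_left _ _), max_le hs.2 ((min_le_right _ _).trans ht.2)⟩
  have hc0 : c 0 = s := by
    have : d 0 = a := D.pt_zero
    simp only [hc, this]
    exact max_eq_left ((min_le_left _ _).trans hs.1)
  have hcn : c (n + 1) = t := by
    have : d (n + 1) = b := hDn ▸ D.pt_last
    simp only [hc, this, min_eq_right ht.2, max_eq_right hst]
  have hη : ∀ r, η (min r t) - η (min r s) = η (max s (min r t)) - η s := by
    intro r
    rcases le_total r s with hrs | hrs
    · rw [min_eq_left hrs, min_eq_left (hrs.trans hst), max_eq_left hrs, sub_self, sub_self]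
    · rw [min_eq_right hrs, max_eq_right (le_min hrs hst)]
  have hdiff : stoppedSum h.le x η n t - stoppedSum h.le x η n s =
      ∑ i ∈ Finset.range (n + 1), x (d i) (η (c (i + 1)) - η (c i)) := by
    rw [stoppedSum, stoppedSum, ← Finset.sum_sub_distrib]
    refine Finset.sum_congr rfl fun i _ => ?_
    rw [← map_sub]
    congr 1
    have e1 := hη (d (i + 1))
    have e2 := hη (d i)
    rw [sub_sub_sub_comm, e1, e2]
    simp only [hc]; abel
  have hYL := h.norm_sum_sub_le hM hx hs ht hcm hc0 hcn
  have hterm : ∀ i ∈ Finset.range (n + 1), ‖(x (d i) - x (c i)) (η (c (i + 1)) - η (c i))‖ ≤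
      M * (ε / (M * (Z b - Z a) + 1) * (Z (d (i + 1)) - Z (d i))) := by
    intro i hi
    have hi' := Finset.mem_range.1 hi
    have m1 := hdmem i hi'.le
    have m2 := hdmem (i + 1) (by omega)
    have hdd := hdm (Nat.le_succ i)
    have hZd := h.Z_nonneg m1 m2 hdd
    -- A cell collapsed by clamping contributes nothing; any other lies inside its grid cell, so its
    -- tag moves within that cell.
    rcases (hcm (Nat.le_succ i)).eq_or_lt with heq | hlt
    · rw [show c (i + 1) = c i from heq.symm, sub_self, map_zero, norm_zero]
      positivity
    · have hlt1 : c i < c (i + 1) := hlt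
      have hdt : d i < t := by
        by_contra hcon
        have h1 : t ≤ d i := not_lt.1 hcon
        have h2 : t ≤ d (i + 1) := h1.trans hdd
        simp only [hc, min_eq_right h1, min_eq_right h2, lt_irrefl] at hlt1
      have hci : d i ≤ c i := by simp only [hc, min_eq_left hdt.le]; exact le_max_right _ _
      have hci1 : c (i + 1) ≤ d (i + 1) := by
        have hsi : s < c (i + 1) := (le_max_left _ _ : s ≤ c i).trans_lt hlt1
        have : c (i + 1) = min (d (i + 1)) t := by
          rcases le_total s (min (d (i + 1)) t) with h1 | h1
          · exact max_eq_right h1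
          · exact absurd (max_eq_left h1 : c (i + 1) = s) hsi.ne'
        rw [this]; exact min_le_left _ _
      have hV1 := h.V_nonneg m1 (hcmem i) hci
      have hV2 := h.mono (hcmem i) m2 (hlt1.le.trans hci1)
      have hZ1 := h.Z_nonneg (hcmem i) (hcmem (i + 1)) hlt1.le
      have hZ2 := h.mono_Z m1 (hcmem i) hci
      have hZ3 := h.mono_Z (hcmem (i + 1)) m2 hci1
      have hκ0 : 0 ≤ κ := by linarith [h.one_lt, h.q_le]
      have hq0 := h.q_pos.le
      calc ‖(x (d i) - x (c i)) (η (c (i + 1)) - η (c i))‖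
          ≤ ‖x (d i) - x (c i)‖ * ‖η (c (i + 1)) - η (c i)‖ := ContinuousLinearMap.le_opNorm _ _
        _ ≤ (M * (V (c i) - V (d i)) ^ κ) * (Z (c (i + 1)) - Z (c i)) ^ q := by
            gcongr
            · rw [norm_sub_rev]; exact hx _ m1 _ (hcmem i) hci
            · exact h.norm_le _ (hcmem i) _ (hcmem (i + 1)) hlt1.le
        _ ≤ (M * (V (d (i + 1)) - V (d i)) ^ κ) * (Z (d (i + 1)) - Z (d i)) ^ q := by
            have hV3 := h.V_nonneg m1 m2 hdd
            have := mul_nonneg hM (Real.rpow_nonneg hV3 κ)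
            gcongr
        _ = M * ((V (d (i + 1)) - V (d i)) ^ κ * (Z (d (i + 1)) - Z (d i)) ^ q) := by ring
        _ ≤ M * (ε / (M * (Z b - Z a) + 1) * (Z (d (i + 1)) - Z (d i))) := by
            refine mul_le_mul_of_nonneg_left ?_ hM
            exact (h.mul_le_err m1 m2 hdd).trans (hsmall _ m1 _ m2 hdd
              (by rw [hd, hD, uniformDissection_sub]; exact hn))
  calc ‖stoppedSum h.le x η n t - stoppedSum h.le x η n s - x s (η t - η s)‖
      = ‖(∑ i ∈ Finset.range (n + 1), x (c i) (η (c (i + 1)) - η (c i)) - x s (η t - η s)) +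
          ∑ i ∈ Finset.range (n + 1), (x (d i) - x (c i)) (η (c (i + 1)) - η (c i))‖ := by
        rw [hdiff]
        simp only [sub_apply, Finset.sum_sub_distrib]
        congr 1; abel
    _ ≤ sewingConst ((κ + q + 1) / 2) * M * err κ q V Z s t +
        ∑ i ∈ Finset.range (n + 1), M * (ε / (M * (Z b - Z a) + 1) * (Z (d (i + 1)) - Z (d i))) :=
        (norm_add_le _ _).trans (add_le_add hYL
          ((norm_sum_le _ _).trans (Finset.sum_le_sum hterm)))
    _ ≤ sewingConst ((κ + q + 1) / 2) * M * err κ q V Z s t + ε := by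
        gcongr
        rw [← Finset.mul_sum, ← Finset.mul_sum, show n + 1 = D.n from rfl, D.sum_sub Z]
        calc M * (ε / (M * (Z b - Z a) + 1) * (Z b - Z a))
            = ε * (M * (Z b - Z a) / (M * (Z b - Z a) + 1)) := by ring
          _ ≤ ε * 1 := by
            gcongr
            rw [div_le_one (by positivity)]; linarith
          _ = ε := mul_one ε

/-- Existence of Young primitives, with the Young–Loeve estimate. -/
theorem exists_primitive [ProperSpace G] (h : YoungControl a b κ q V Z η) {M : ℝ} (hM : 0 ≤ M)
    {x : ℝ → F →L[ℝ] G} (hx : ControlledBy a b κ M V x) :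
    ∃ J : ℝ → G, ∀ s ∈ Icc a b, ∀ t ∈ Icc a b, s ≤ t →
      ‖J t - J s - x s (η t - η s)‖ ≤
        sewingConst ((κ + q + 1) / 2) * M * err κ q V Z s t := by
  have hab : a ∈ Icc a b := ⟨le_rfl, h.le⟩
  -- Compactness replaces a Cauchy argument: the stopped sums at each `t` are eventually bounded and
  -- closed balls of `G` are compact, so one free ultrafilter gives limits for all `t`. The estimate
  -- for the increments survives the limit and is all that is wanted.
  set U : Ultrafilter ℕ := Filter.hyperfilter ℕ with hU
  have hUle : (U : Filter ℕ) ≤ atTop := Nat.hyperfilter_le_atTop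
  have hlim : ∀ t ∈ Icc a b, ∃ y, Tendsto (fun n => stoppedSum h.le x η n t) U (𝓝 y) := by
    intro t ht
    set B := sewingConst ((κ + q + 1) / 2) * M * err κ q V Z a t + 1 + ‖x a (η t - η a)‖ with hB
    have h0 : ∀ n, stoppedSum h.le x η n a = 0 := by
      intro n
      refine Finset.sum_eq_zero fun i hi => ?_
      have m1 := (uniformDissection h.le n).pt_mem (i := i) (Finset.mem_range.1 hi).le
      have m2 := (uniformDissection h.le n).pt_mem (i := i + 1) (Finset.mem_range.1 hi)
      rw [min_eq_right m1.1, min_eq_right m2.1, sub_self, map_zero]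
    have hev : ∀ᶠ n in (U : Filter ℕ), stoppedSum h.le x η n t ∈ Metric.closedBall (0 : G) B := by
      filter_upwards [hUle (h.norm_stoppedSum_le hM hx one_pos)] with n hn
      have := hn a hab t ht ht.1
      rw [h0, sub_zero] at this
      rw [mem_closedBall_zero_iff, hB]
      have h2 := norm_sub_norm_le (stoppedSum h.le x η n t) (x a (η t - η a))
      linarith
    obtain ⟨y, -, hy⟩ := (isCompact_closedBall (0 : G) B).ultrafilter_le_nhds
      (U.map fun n => stoppedSum h.le x η n t) (le_principal_iff.2 hev)
    exact ⟨y, hy⟩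
  choose! J hJ using hlim
  refine ⟨J, fun s hs t ht hst => le_of_forall_pos_le_add fun ε hε => ?_⟩
  exact le_of_tendsto (((hJ t ht).sub (hJ s hs)).sub_const _).norm
    (Eventually.mono (hUle (h.norm_stoppedSum_le hM hx hε)) fun n hn => hn s hs t ht hst)

/-- A function which satisfies a Young–Loeve estimate is a primitive, with a modulus that depends
on the constants only. -/
theorem exists_modulus (h : YoungControl a b κ q V Z η) {M K : ℝ} (hM : 0 ≤ M) (hK : 0 ≤ K)
    {ε : ℝ} (hε : 0 < ε) :
    ∃ δ > 0, ∀ (x : ℝ → F →L[ℝ] G) (J : ℝ → G), ControlledBy a b κ M V x →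
      (∀ s ∈ Icc a b, ∀ t ∈ Icc a b, s ≤ t →
        ‖J t - J s - x s (η t - η s)‖ ≤ K * err κ q V Z s t) →
      ∀ s ∈ Icc a b, ∀ t ∈ Icc a b, s ≤ t → t - s < δ → ∀ τ ∈ Icc s t,
        ‖J t - J s - x τ (η t - η s)‖ ≤ ε * (Z t - Z s) := by
  obtain ⟨δ, hδ, H⟩ := h.err_le (ε := ε / (K + M + 1)) (by positivity)
  refine ⟨δ, hδ, fun x J hx hJ s hs t ht hst hlt τ hτ => ?_⟩
  have hτ' : τ ∈ Icc a b := ⟨hs.1.trans hτ.1, hτ.2.trans ht.2⟩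
  have hV := h.V_nonneg hs hτ' hτ.1
  have hV2 := h.mono hτ' ht hτ.2
  have hZ := h.Z_nonneg hs ht hst
  have hκ0 : 0 ≤ κ := by linarith [h.one_lt, h.q_le]
  have e : J t - J s - x τ (η t - η s) =
      (J t - J s - x s (η t - η s)) - (x τ - x s) (η t - η s) := by
    simp only [sub_apply]; abel
  have herr := h.err_nonneg hs ht hst
  calc ‖J t - J s - x τ (η t - η s)‖
      ≤ ‖J t - J s - x s (η t - η s)‖ + ‖x τ - x s‖ * ‖η t - η s‖ := by
        rw [e]
        exact (norm_sub_le _ _).trans (by gcongr; exact ContinuousLinearMap.le_opNorm _ _)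
    _ ≤ K * err κ q V Z s t + (M * (V t - V s) ^ κ) * (Z t - Z s) ^ q := by
        have h1 : ‖x τ - x s‖ ≤ M * (V t - V s) ^ κ :=
          (hx s hs τ hτ' hτ.1).trans (by gcongr)
        exact add_le_add (hJ s hs t ht hst) (mul_le_mul h1 (h.norm_le s hs t ht hst)
          (norm_nonneg _) ((norm_nonneg _).trans h1))
    _ ≤ K * err κ q V Z s t + M * err κ q V Z s t := by
        rw [mul_assoc]; gcongr; exact h.mul_le_err hs ht hst
    _ ≤ (K + M + 1) * err κ q V Z s t := by nlinarith
    _ ≤ (K + M + 1) * (ε / (K + M + 1) * (Z t - Z s)) := by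
        gcongr; exact H s hs t ht hst hlt
    _ = ε * (Z t - Z s) := by field_simp

theorem exists_isYoungPrimitive [ProperSpace G] (h : YoungControl a b κ q V Z η) {M : ℝ}
    (hM : 0 ≤ M) {x : ℝ → F →L[ℝ] G} (hx : ControlledBy a b κ M V x) :
    ∃ J : ℝ → G, IsYoungPrimitive a b Z x η J := by
  obtain ⟨J, hJ⟩ := h.exists_primitive hM hx
  refine ⟨J, fun ε hε => ?_⟩
  have hθ : 1 < (κ + q + 1) / 2 := by linarith [h.one_lt]
  have := sewingConst_nonneg hθ
  obtain ⟨δ, hδ, H⟩ := h.exists_modulus (G := G) hM (mul_nonneg this hM) hε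
  exact ⟨δ, hδ, H x J hx hJ⟩

theorem exists_isYoungIntegral [ProperSpace G] (h : YoungControl a b κ q V Z η) {M : ℝ}
    (hM : 0 ≤ M) {x : ℝ → F →L[ℝ] G} (hx : ControlledBy a b κ M V x) :
    ∃ J : G, IsYoungIntegral a b x η J := by
  obtain ⟨J, hJ⟩ := h.exists_isYoungPrimitive hM hx
  exact ⟨_, hJ.isYoungIntegral h.mono_Z le_rfl h.le le_rfl⟩

/-- Young integrals of a uniformly controlled sequence which tends to zero pointwise tend to
zero. -/
theorem tendsto_zero [ProperSpace G] (h : YoungControl a b κ q V Z η) {M : ℝ} (hM : 0 ≤ M)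
    {x : ℕ → ℝ → F →L[ℝ] G} (hx : ∀ n, ControlledBy a b κ M V (x n))
    (hx0 : ∀ t ∈ Icc a b, Tendsto (fun n => x n t) atTop (𝓝 0)) {J : ℕ → G}
    (hJ : ∀ n, IsYoungIntegral a b (x n) η (J n)) : Tendsto J atTop (𝓝 0) := by
  have hab : a ∈ Icc a b := ⟨le_rfl, h.le⟩
  have hbb : b ∈ Icc a b := ⟨h.le, le_rfl⟩
  have hZab := h.Z_nonneg hab hbb h.le
  have hθ : 1 < (κ + q + 1) / 2 := by linarith [h.one_lt]
  have hS := sewingConst_nonneg hθ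
  choose P hP using fun n => h.exists_primitive hM (hx n)
  have hJP : ∀ n, J n = P n b - P n a := fun n => by
    refine (hJ n).unique h.le (IsYoungPrimitive.isYoungIntegral (Z := Z) (fun ε hε => ?_) h.mono_Z
      le_rfl h.le le_rfl)
    obtain ⟨δ, hδ, H⟩ := h.exists_modulus (G := G) hM (mul_nonneg hS hM) hε
    exact ⟨δ, hδ, H (x n) (P n) (hx n) (hP n)⟩
  rw [Metric.tendsto_nhds]
  intro ε hε
  -- The modulus depends on the constants only, so a single dissection approximates every `J n`
  -- within `ε / 2`; on this fixed dissection the Riemann sums are finite sums of null sequences.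
  obtain ⟨δ, hδ, H⟩ := h.exists_modulus (G := G) hM (mul_nonneg hS hM)
    (ε := ε / 2 / (Z b - Z a + 1)) (by positivity)
  obtain ⟨N, hN⟩ := ((tendsto_mesh (b - a)).eventually (gt_mem_nhds hδ)).exists
  set D := uniformDissection h.le N with hD
  have hsum : Tendsto (fun n => ∑ i ∈ Finset.range D.n,
      x n (D.pt i) (η (D.pt (i + 1)) - η (D.pt i))) atTop (𝓝 0) := by
    rw [show (0 : G) = ∑ i ∈ Finset.range D.n,
      (0 : F →L[ℝ] G) (η (D.pt (i + 1)) - η (D.pt i)) by simp]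
    refine tendsto_finsetSum _ fun i hi => ?_
    exact ((ContinuousLinearMap.apply ℝ G (η (D.pt (i + 1)) - η (D.pt i))).continuous.tendsto
      _).comp (hx0 _ (D.pt_mem (Finset.mem_range.1 hi).le))
  filter_upwards [(Metric.tendsto_nhds.1 hsum) (ε / 2) (by positivity)] with n hn
  have h1 := IsYoungPrimitive.norm_sum_le le_rfl le_rfl (H (x n) (P n) (hx n) (hP n)) D D.pt
    (fun i _ => by rw [hD, uniformDissection_sub]; exact hN)
    (fun i hi => ⟨le_rfl, D.mono i hi⟩)
  rw [dist_zero_right] at hn ⊢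
  rw [hJP]
  have h2 := norm_sub_norm_le (P n b - P n a)
    (∑ i ∈ Finset.range D.n, x n (D.pt i) (η (D.pt (i + 1)) - η (D.pt i)))
  rw [norm_sub_rev (P n b - P n a)] at h2
  have h3 : ε / 2 / (Z b - Z a + 1) * (Z b - Z a) ≤ ε / 2 := by
    rw [div_mul_eq_mul_div, div_le_iff₀ (by positivity)]
    nlinarith
  linarith

end YoungControl

namespace IsYoungIntegral

variable {a b : ℝ} {x y : ℝ → F →L[ℝ] G} {η : ℝ → F} {J K : G}

theorem sub (hx : IsYoungIntegral a b x η J) (hy : IsYoungIntegral a b y η K) :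
    IsYoungIntegral a b (fun t => x t - y t) η (J - K) := by
  intro ε hε
  obtain ⟨δ, hδ, H⟩ := hx (ε / 2) (by positivity)
  obtain ⟨δ', hδ', H'⟩ := hy (ε / 2) (by positivity)
  refine ⟨min δ δ', lt_min hδ hδ', fun D τ hD hτ => ?_⟩
  have h1 := H D τ (fun i hi => (hD i hi).trans_le (min_le_left _ _)) hτ
  have h2 := H' D τ (fun i hi => (hD i hi).trans_le (min_le_right _ _)) hτ
  simp only [sub_apply, Finset.sum_sub_distrib]
  rw [sub_sub_sub_comm]
  exact (norm_sub_le _ _).trans_lt (by linarith)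

theorem clm_comp {H : Type*} [NormedAddCommGroup H] [NormedSpace ℝ H]
    (hx : IsYoungIntegral a b x η J) (L : G →L[ℝ] H) :
    IsYoungIntegral a b (fun t => L.comp (x t)) η (L J) := by
  intro ε hε
  obtain ⟨δ, hδ, H⟩ := hx (ε / (‖L‖ + 1)) (by positivity)
  refine ⟨δ, hδ, fun D τ hD hτ => ?_⟩
  have h1 := H D τ hD hτ
  simp only [ContinuousLinearMap.comp_apply]
  rw [← map_sum, ← map_sub]
  rw [lt_div_iff₀ (by positivity)] at h1
  refine (L.le_opNorm _).trans_lt ?_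
  nlinarith [norm_nonneg (∑ i ∈ Finset.range D.n, x (τ i) (η (D.pt (i + 1)) - η (D.pt i)) - J),
    norm_nonneg L]

theorem const_smul (hx : IsYoungIntegral a b x η J) (c : ℝ) :
    IsYoungIntegral a b (fun t => c • x t) η (c • J) := by
  have := hx.clm_comp (c • ContinuousLinearMap.id ℝ G)
  simpa [ContinuousLinearMap.smul_comp] using this

theorem youngIntegral_eq (hab : a ≤ b) (hx : IsYoungIntegral a b x η J) :
    youngIntegral a b x η = J := by
  have h : ∃ J, IsYoungIntegral a b x η J := ⟨J, hx⟩
  rw [youngIntegral, dif_pos h]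
  exact h.choose_spec.unique hab hx

end IsYoungIntegral

/-! ### Paths of finite `p`-variation -/

/-- The sum whose supremum defines the `p`-variation. -/
def Dissection.powSum {a b : ℝ} (D : Dissection a b) (p : ℝ) (y : ℝ → F) : ℝ≥0∞ :=
  ∑ i ∈ Finset.range D.n, ‖y (D.pt (i + 1)) - y (D.pt i)‖ₑ ^ p

/-- The dissection extended by a further point. -/
def Dissection.snoc {a b c : ℝ} (D : Dissection a b) (hbc : b ≤ c) : Dissection a c where
  n := D.n + 1
  pt i := if i ≤ D.n then D.pt i else c
  pt_zero := by simp [D.pt_zero]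
  pt_last := by simp
  mono i hi := by
    rcases (Nat.lt_succ_iff.1 hi).eq_or_lt with rfl | h
    · simp [D.pt_last, hbc]
    · rw [if_pos h.le, if_pos (Nat.succ_le_of_lt h)]; exact D.mono i h

theorem Dissection.powSum_snoc {a b c : ℝ} (D : Dissection a b) (hbc : b ≤ c) (p : ℝ)
    (y : ℝ → F) : (D.snoc hbc).powSum p y = D.powSum p y + ‖y c - y b‖ₑ ^ p := by
  rw [powSum, powSum, show (D.snoc hbc).n = D.n + 1 from rfl, Finset.sum_range_succ]
  congr 1
  · refine Finset.sum_congr rfl fun i hi => ?_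
    have := Finset.mem_range.1 hi
    simp [snoc, this.le, Nat.succ_le_of_lt this]
  · simp [snoc, D.pt_last]

/-- A path of finite `p`-variation is `1 / p`-Hölder with respect to a monotone function. -/
theorem exists_monotoneOn_of_pVariation_lt_top {a b p : ℝ} (hp : 0 < p) {y : ℝ → F}
    (hy : pVariation p a b y < ∞) :
    ∃ W : ℝ → ℝ, MonotoneOn W (Icc a b) ∧ ∀ s ∈ Icc a b, ∀ t ∈ Icc a b, s ≤ t →
      ‖y t - y s‖ ≤ (W t - W s) ^ (1 / p) := by
  -- This is the `p`-th power of the variation over `[a, t]`. A dissection of `[a, s]` can be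
  -- extended by the point `t`, and this makes the increments of `S` dominate those of `y`.
  set S : ℝ → ℝ≥0∞ := fun t => ⨆ D : Dissection a t, D.powSum p y with hS
  have hstep : ∀ s t, a ≤ s → s ≤ t → S s + ‖y t - y s‖ₑ ^ p ≤ S t := by
    intro s t has hst
    have : Nonempty (Dissection a s) := ⟨uniformDissection has 0⟩
    simp only [hS, ENNReal.iSup_add]
    refine iSup_le fun D => ?_
    rw [← D.powSum_snoc hst]
    exact le_iSup (fun D : Dissection a t => D.powSum p y) _
  have hmono : ∀ s t, a ≤ s → s ≤ t → S s ≤ S t := fun s t has hst =>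
    le_self_add.trans (hstep s t has hst)
  have hSb : S b < ∞ := by
    rw [pVariation, one_div] at hy
    by_contra hcon
    have htop : (⨆ D : Dissection a b, ∑ i ∈ Finset.range D.n,
        ‖y (D.pt (i + 1)) - y (D.pt i)‖ₑ ^ p) = ∞ := not_lt_top_iff.1 hcon
    rw [htop, ENNReal.top_rpow_of_pos (inv_pos.2 hp)] at hy
    exact lt_irrefl _ hy
  have hfin : ∀ t ∈ Icc a b, S t ≠ ∞ := fun t ht => ((hmono t b ht.1 ht.2).trans_lt hSb).ne
  refine ⟨fun t => (S t).toReal, fun s hs t ht hst => ?_, fun s hs t ht hst => ?_⟩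
  · exact ENNReal.toReal_mono (hfin t ht) (hmono s t hs.1 hst)
  · have h1 := ENNReal.toReal_mono (hfin t ht) (hstep s t hs.1 hst)
    have hne : ‖y t - y s‖ₑ ^ p ≠ ∞ := by
      refine ENNReal.rpow_ne_top_of_nonneg hp.le ?_
      simp
    rw [ENNReal.toReal_add (hfin s hs) hne, ← ENNReal.toReal_rpow, toReal_enorm] at h1
    have h2 : ‖y t - y s‖ ^ p ≤ (S t).toReal - (S s).toReal := by linarith
    calc ‖y t - y s‖ = (‖y t - y s‖ ^ p) ^ (1 / p) := by
          rw [← Real.rpow_mul (norm_nonneg _), mul_one_div_cancel hp.ne', Real.rpow_one]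
      _ ≤ _ := Real.rpow_le_rpow (by positivity) h2 (by positivity)

/-- Functions which are Hölder continuous with exponent `κ > 1 / 2` with respect to a monotone
function have finite `p`-variation for some `p < 2`. -/
theorem ControlledBy.exists_pVariation_lt_top {a b κ M : ℝ} {V : ℝ → ℝ} {x : ℝ → F} (hab : a ≤ b)
    (hκ : 1 / 2 < κ) (hM : 0 ≤ M) (hV : MonotoneOn V (Icc a b)) (hx : ControlledBy a b κ M V x) :
    ∃ p : ℝ, 1 ≤ p ∧ p < 2 ∧ pVariation p a b x < ∞ := by
  have hκ0 : 0 < κ := by linarith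
  -- Since `κ * p ≥ 1`, each `(ΔV) ^ (κ * p)` is at most `v ^ (κ * p - 1) * ΔV`, and these bounds
  -- telescope; `κ > 1 / 2` gives `p < 2`.
  set p := max 1 (1 / κ) with hp
  have hp1 : 1 ≤ p := le_max_left _ _
  have hκp : 1 ≤ κ * p := by
    calc (1 : ℝ) = κ * (1 / κ) := by field_simp
      _ ≤ κ * p := by gcongr; exact le_max_right _ _
  refine ⟨p, hp1, max_lt (by norm_num) (by rw [div_lt_iff₀ hκ0]; linarith), ?_⟩
  set v := V b - V a with hv
  have hv0 : 0 ≤ v := sub_nonneg.2 (hV ⟨le_rfl, hab⟩ ⟨hab, le_rfl⟩ hab)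
  rw [pVariation]
  refine ENNReal.rpow_lt_top_of_nonneg (by positivity) (ne_top_of_le_ne_top
    (b := ENNReal.ofReal (M ^ p * (v ^ (κ * p - 1) * v))) ENNReal.ofReal_ne_top ?_)
  refine iSup_le fun D => ?_
  have hsum : M ^ p * (v ^ (κ * p - 1) * v) = ∑ i ∈ Finset.range D.n,
      M ^ p * (v ^ (κ * p - 1) * (V (D.pt (i + 1)) - V (D.pt i))) := by
    rw [← Finset.mul_sum, ← Finset.mul_sum, D.sum_sub V]
  rw [hsum, ENNReal.ofReal_sum_of_nonneg]
  · refine Finset.sum_le_sum fun i hi => ?_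
    have hi' := Finset.mem_range.1 hi
    have m1 := D.pt_mem hi'.le
    have m2 := D.pt_mem (show i + 1 ≤ D.n from hi')
    have hst := D.mono i hi'
    have h0 : 0 ≤ V (D.pt (i + 1)) - V (D.pt i) := sub_nonneg.2 (hV m1 m2 hst)
    have hle : V (D.pt (i + 1)) - V (D.pt i) ≤ v := by
      have e1 := hV ⟨le_rfl, hab⟩ m1 m1.1
      have e2 := hV m2 ⟨hab, le_rfl⟩ m2.2
      linarith
    rw [← ofReal_norm, ENNReal.ofReal_rpow_of_nonneg (norm_nonneg _) (by positivity)]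
    refine ENNReal.ofReal_le_ofReal ?_
    have hκp' : 0 ≤ κ * p - 1 := by linarith
    calc ‖x (D.pt (i + 1)) - x (D.pt i)‖ ^ p
        ≤ (M * (V (D.pt (i + 1)) - V (D.pt i)) ^ κ) ^ p :=
          Real.rpow_le_rpow (norm_nonneg _) (hx _ m1 _ m2 hst) (by positivity)
      _ = M ^ p * (V (D.pt (i + 1)) - V (D.pt i)) ^ (κ * p - 1 + 1) := by
          rw [Real.mul_rpow hM (by positivity), ← Real.rpow_mul h0]; congr 2; ring
      _ = M ^ p * ((V (D.pt (i + 1)) - V (D.pt i)) ^ (κ * p - 1) *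
            (V (D.pt (i + 1)) - V (D.pt i))) := by
          rw [Real.rpow_add_one' h0 (by linarith)]
      _ ≤ _ := by gcongr
  · intro i hi
    have hi' := Finset.mem_range.1 hi
    have h0 : 0 ≤ V (D.pt (i + 1)) - V (D.pt i) :=
      sub_nonneg.2 (hV (D.pt_mem hi'.le) (D.pt_mem (show i + 1 ≤ D.n from hi')) (D.mono i hi'))
    positivity

/-- For an observation path, there are Young controls for every exponent `κ > 1 / 2` of the
integrands. -/
theorem IsObservationPath.exists_youngControl {d : ℕ} {T : ℝ} (hT : 0 ≤ T)
    {η : ℝ → EuclideanSpace ℝ (Fin d)} (hη : IsObservationPath T η) {κ : ℝ} (hκ : 1 / 2 < κ)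
    {V : ℝ → ℝ} (hVm : MonotoneOn V (Icc 0 T)) (hVc : ContinuousOn V (Icc 0 T)) :
    ∃ (q : ℝ) (Z : ℝ → ℝ), YoungControl 0 T κ q V Z η := by
  -- Halfway between `max (1 - κ) (1 / 4)` and `1 / 2`: above `1 - κ`, so that the exponents add up
  -- to more than `1`; below `1 / 2`, so that `η` has finite variation of order `1 / q > 2`;
  -- positive thanks to `1 / 4`.
  set q := (max (1 - κ) (1 / 4) + 1 / 2) / 2 with hq
  have h1 : max (1 - κ) (1 / 4) < 1 / 2 := max_lt (by linarith) (by norm_num)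
  have h2 : 1 - κ ≤ max (1 - κ) (1 / 4) := le_max_left _ _
  have h3 : 1 / 4 ≤ max (1 - κ) (1 / 4) := le_max_right _ _
  have hq0 : 0 < q := by rw [hq]; linarith
  have hq1 : q < 1 / 2 := by rw [hq]; linarith
  obtain ⟨W, hWm, hW⟩ := exists_monotoneOn_of_pVariation_lt_top (p := 1 / q) (by positivity)
    (hη.2 (1 / q) (by rw [lt_div_iff₀ hq0]; linarith))
  -- Adding `V` to the variation function makes the increments of `Z` dominate those of `V` too.
  refine ⟨q, fun t => V t + W t, hT, hVm, hVc, fun s hs t ht hst => ?_, fun s hs t ht hst => ?_,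
    by rw [hq]; linarith, hq0, by linarith⟩
  · have := hWm hs ht hst; linarith
  · have e1 := hWm hs ht hst
    have e2 := hVm hs ht hst
    refine (hW s hs t ht hst).trans ?_
    rw [one_div_one_div]
    exact Real.rpow_le_rpow (by linarith) (by linarith) hq0.le

end Young

/-! ### Absolutely continuous functions and integral equations -/

section Volterra

variable {E : Type*} [NormedAddCommGroup E] [NormedSpace ℝ E]

theorem absolutelyContinuousOnInterval_of_dist_le {X Y : Type*} [PseudoMetricSpace X]
    [PseudoMetricSpace Y] {f : ℝ → X} {g : ℝ → Y} {a b : ℝ}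
    (hg : AbsolutelyContinuousOnInterval g a b)
    (h : ∀ s ∈ uIcc a b, ∀ t ∈ uIcc a b, dist (f s) (f t) ≤ dist (g s) (g t)) :
    AbsolutelyContinuousOnInterval f a b := by
  rw [absolutelyContinuousOnInterval_iff] at hg ⊢
  intro ε hε
  obtain ⟨δ, hδ, H⟩ := hg ε hε
  refine ⟨δ, hδ, fun D hD hlt => (Finset.sum_le_sum fun i hi => ?_).trans_lt (H D hD hlt)⟩
  exact h _ (hD.1 i hi).1 _ (hD.1 i hi).2

/-- The scalar integral of the norm is absolutely continuous and dominates the increments, which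
settles the vector-valued case. -/
theorem absolutelyContinuousOnInterval_integral {F : ℝ → E} {a b : ℝ}
    (hF : IntervalIntegrable F volume a b) :
    AbsolutelyContinuousOnInterval (fun t => ∫ s in a..t, F s) a b := by
  refine absolutelyContinuousOnInterval_of_dist_le
    (hF.norm.absolutelyContinuousOnInterval_intervalIntegral left_mem_uIcc) fun s hs t ht => ?_
  have hFs := hF.mono_set (uIcc_subset_uIcc_left hs)
  have hFt := hF.mono_set (uIcc_subset_uIcc_left ht)
  rw [dist_eq_norm, dist_eq_norm, intervalIntegral.integral_interval_sub_left hFs hFt,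
    intervalIntegral.integral_interval_sub_left hFs.norm hFt.norm]
  exact intervalIntegral.norm_integral_le_abs_integral_norm

theorem ae_restrict_Icc_iff {a b : ℝ} (hab : a ≤ b) {p : ℝ → Prop} :
    (∀ᵐ t ∂(volume.restrict (Icc a b)), p t) ↔ ∀ᵐ t, t ∈ uIcc a b → p t := by
  rw [ae_restrict_iff' measurableSet_Icc, uIcc_of_le hab]

theorem intervalIntegrable_sub {F : ℝ → E} {a b s t : ℝ} (hF : IntervalIntegrable F volume a b)
    (hab : a ≤ b) (hs : s ∈ Icc a b) (ht : t ∈ Icc a b) : IntervalIntegrable F volume s t := by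
  refine hF.mono_set ?_
  rw [uIcc_of_le hab]
  exact uIcc_subset_Icc hs ht

theorem integral_sub_integral {F : ℝ → E} {a b s t : ℝ} (hF : IntervalIntegrable F volume a b)
    (hab : a ≤ b) (hs : s ∈ Icc a b) (ht : t ∈ Icc a b) :
    (∫ r in a..t, F r) - ∫ r in a..s, F r = ∫ r in s..t, F r :=
  intervalIntegral.integral_interval_sub_left
    (intervalIntegrable_sub hF hab (left_mem_Icc.2 hab) ht)
    (intervalIntegrable_sub hF hab (left_mem_Icc.2 hab) hs)

theorem continuousOn_integral {F : ℝ → E} {a b : ℝ} (hab : a ≤ b)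
    (hF : IntervalIntegrable F volume a b) :
    ContinuousOn (fun t => ∫ s in a..t, F s) (Icc a b) := by
  have := (absolutelyContinuousOnInterval_integral hF).continuousOn
  rwa [uIcc_of_le hab] at this

variable [CompleteSpace E]

/-- An absolutely continuous function is the integral of its derivative. -/
theorem eq_add_integral_of_ae_hasDerivAt {x F : ℝ → E} {S : ℝ} (hS : 0 ≤ S)
    (hx : AbsolutelyContinuousOnInterval x 0 S)
    (hd : ∀ᵐ t ∂(volume.restrict (Icc 0 S)), HasDerivAt x (F t) t)
    (hF : IntervalIntegrable F volume 0 S) :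
    ∀ t ∈ Icc 0 S, x t = x 0 + ∫ s in 0..t, F s := by
  rw [ae_restrict_Icc_iff hS] at hd
  obtain ⟨C, hC⟩ := (hx.sub (absolutelyContinuousOnInterval_integral
    hF)).const_of_ae_hasDerivAt_zero (by
      filter_upwards [hd, hF.ae_hasDerivAt_integral] with t h1 h2 ht
      simpa using (h1 ht).sub (h2 ht 0 left_mem_uIcc))
  intro t ht
  have h0 := hC 0 left_mem_uIcc
  have h1 := hC t (by rwa [uIcc_of_le hS])
  simp only [Pi.sub_apply, intervalIntegral.integral_same, sub_zero] at h0 h1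
  rw [h0, ← h1, sub_add_cancel]

/-- Integrals are absolutely continuous and almost everywhere differentiable. -/
theorem hasDerivAt_of_eq_add_integral {x F : ℝ → E} {ξ : E} {S : ℝ} (hS : 0 ≤ S)
    (hF : IntervalIntegrable F volume 0 S) (hx : ∀ t ∈ Icc 0 S, x t = ξ + ∫ s in 0..t, F s) :
    AbsolutelyContinuousOnInterval x 0 S ∧
      ∀ᵐ t ∂(volume.restrict (Icc 0 S)), HasDerivAt x (F t) t := by
  constructor
  · refine absolutelyContinuousOnInterval_of_dist_le (absolutelyContinuousOnInterval_integral hF)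
      fun s hs t ht => ?_
    rw [uIcc_of_le hS] at hs ht
    rw [hx s hs, hx t ht, dist_add_left]
  · rw [ae_restrict_Icc_iff hS]
    -- The integral formula is known on `[0, S]` only, so a two-sided derivative is available at
    -- interior points; the end points are a null set.
    have h0 : ∀ᵐ t : ℝ, t ≠ 0 := by simp [ae_iff, measure_singleton]
    have h1 : ∀ᵐ t : ℝ, t ≠ S := by simp [ae_iff, measure_singleton]
    filter_upwards [hF.ae_hasDerivAt_integral, h0, h1] with t ht ht0 htS htm
    have hd := (ht htm 0 left_mem_uIcc).const_add ξ
    rw [uIcc_of_le hS] at htm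
    refine hd.congr_of_eventuallyEq ?_
    filter_upwards [Icc_mem_nhds (lt_of_le_of_ne htm.1 (Ne.symm ht0))
      (lt_of_le_of_ne htm.2 htS)] with s hs
    exact hx s hs

/-- `∫ L exp(2 ∫ L)` for a merely integrable function `L`. -/
theorem integral_mul_exp {L : ℝ → ℝ} {T : ℝ} (hT : 0 ≤ T) (hL : IntervalIntegrable L volume 0 T)
    {t : ℝ} (ht : t ∈ Icc 0 T) :
    IntervalIntegrable (fun s => L s * Real.exp (2 * ∫ r in 0..s, L r)) volume 0 t ∧
    ∫ s in 0..t, L s * Real.exp (2 * ∫ r in 0..s, L r) =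
      (Real.exp (2 * ∫ r in 0..t, L r) - 1) / 2 := by
  have hLt := intervalIntegrable_sub hL hT (left_mem_Icc.2 hT) ht
  set Λ : ℝ → ℝ := fun s => ∫ r in 0..s, L r with hΛ
  have hAC : AbsolutelyContinuousOnInterval Λ 0 t := absolutelyContinuousOnInterval_integral hLt
  have hc := hAC.continuousOn
  have hcexp : ContinuousOn (fun s => Real.exp (2 * Λ s)) (uIcc 0 t) := by fun_prop
  obtain ⟨B, hB⟩ := isCompact_uIcc.exists_bound_of_continuousOn hcexp
  have hB0 : 0 ≤ B := (norm_nonneg _).trans (hB 0 left_mem_uIcc)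
  -- As `L` is merely integrable, the chain rule holds only almost everywhere. The fundamental
  -- theorem still applies, because `exp` is Lipschitz with constant `B` on the range of `2 * Λ` and
  -- so the composite is absolutely continuous.
  have hACexp : AbsolutelyContinuousOnInterval (fun s => Real.exp (2 * Λ s)) 0 t := by
    refine absolutelyContinuousOnInterval_of_dist_le (hAC.const_mul (2 * B)) fun s hs r hr => ?_
    have key : ∀ a b : ℝ, Real.exp b ≤ B → a ≤ b → |Real.exp a - Real.exp b| ≤ B * |a - b| := by
      intro a b hbB hab
      have h1 : Real.exp a ≤ Real.exp b := Real.exp_le_exp.2 hab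
      rw [abs_sub_comm, abs_of_nonneg (by linarith), abs_sub_comm, abs_of_nonneg (by linarith)]
      have h2 := Real.add_one_le_exp (a - b)
      have h3 : Real.exp a = Real.exp b * Real.exp (a - b) := by rw [← Real.exp_add]; congr 1; ring
      rw [h3]
      have := Real.exp_pos b
      nlinarith
    have e1 := (Real.le_norm_self _).trans (hB s hs)
    have e2 := (Real.le_norm_self _).trans (hB r hr)
    have e3 : |2 * B * Λ s - 2 * B * Λ r| = B * |2 * Λ s - 2 * Λ r| := by
      rw [← abs_of_nonneg hB0, ← abs_mul, abs_of_nonneg hB0]; congr 1; ring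
    rw [Real.dist_eq, Real.dist_eq]
    change _ ≤ |2 * B * Λ s - 2 * B * Λ r|
    rw [e3]
    rcases le_total (2 * Λ s) (2 * Λ r) with h | h
    · exact key _ _ e2 h
    · rw [abs_sub_comm, abs_sub_comm (2 * Λ s)]; exact key _ _ e1 h
  refine ⟨hLt.mul_continuousOn hcexp, ?_⟩
  have h1 := hACexp.integral_deriv_eq_sub
  have h2 : ∫ s in 0..t, deriv (fun s => Real.exp (2 * Λ s)) s =
      ∫ s in 0..t, 2 * (L s * Real.exp (2 * Λ s)) := by
    refine intervalIntegral.integral_congr_ae ?_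
    filter_upwards [hLt.ae_hasDerivAt_integral] with s hs hsm
    have := ((hs (uIoc_subset_uIcc hsm) 0 left_mem_uIcc).const_mul 2).exp
    rw [this.deriv]; ring
  rw [h2, intervalIntegral.integral_const_mul] at h1
  have h0 : Λ 0 = 0 := intervalIntegral.integral_same
  simp only [h0, mul_zero, Real.exp_zero] at h1
  linarith

/-- The linear Gronwall lemma with an integrable kernel. -/
theorem eq_zero_of_le_integral {L a : ℝ → ℝ} {T : ℝ} (hT : 0 ≤ T)
    (hL : IntervalIntegrable L volume 0 T) (hL0 : ∀ t ∈ Icc 0 T, 0 ≤ L t)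
    (ha : ContinuousOn a (Icc 0 T)) (ha0 : ∀ t ∈ Icc 0 T, 0 ≤ a t)
    (h : ∀ t ∈ Icc 0 T, a t ≤ ∫ s in 0..t, L s * a s) : ∀ t ∈ Icc 0 T, a t = 0 := by
  set Λ : ℝ → ℝ := fun s => ∫ r in 0..s, L r with hΛ
  have hΛc : ContinuousOn Λ (Icc 0 T) := continuousOn_integral hT hL
  -- Let `M` be the maximum of `a * exp (-2 Λ)`. Integrating `L * a ≤ M * L * exp (2 Λ)` up to the
  -- maximum point gives `M * exp (2 Λ) ≤ M * (exp (2 Λ) - 1) / 2` there, which forces `M = 0`.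
  obtain ⟨t₀, ht₀, hmax⟩ := isCompact_Icc.exists_isMaxOn (nonempty_Icc.2 hT)
    (ha.mul (f := a) (g := fun t => Real.exp (-(2 * Λ t))) (by fun_prop))
  set M := a t₀ * Real.exp (-(2 * Λ t₀)) with hM
  have hle : ∀ t ∈ Icc 0 T, a t ≤ M * Real.exp (2 * Λ t) := by
    intro t ht
    have : a t * Real.exp (-(2 * Λ t)) ≤ M := hmax ht
    calc a t = a t * Real.exp (-(2 * Λ t)) * Real.exp (2 * Λ t) := by
          rw [mul_assoc, ← Real.exp_add]; simp
      _ ≤ _ := by gcongr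
  have hM0 : 0 ≤ M := mul_nonneg (ha0 t₀ ht₀) (Real.exp_pos _).le
  obtain ⟨hi, hI⟩ := integral_mul_exp hT hL ht₀
  have hsub : Icc 0 t₀ ⊆ Icc 0 T := Icc_subset_Icc_right ht₀.2
  have h1 : a t₀ ≤ M * ((Real.exp (2 * Λ t₀) - 1) / 2) := by
    rw [← hI, ← intervalIntegral.integral_const_mul]
    refine (h t₀ ht₀).trans (intervalIntegral.integral_mono_on ht₀.1 ?_ (hi.const_mul M) ?_)
    · refine (intervalIntegrable_sub hL hT (left_mem_Icc.2 hT) ht₀).mul_continuousOn ?_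
      rw [uIcc_of_le ht₀.1]; exact ha.mono hsub
    · intro s hs
      have := mul_le_mul_of_nonneg_left (hle s (hsub hs)) (hL0 s (hsub hs))
      linarith
  have h2 : a t₀ = M * Real.exp (2 * Λ t₀) := by
    rw [hM, mul_assoc, ← Real.exp_add]; simp
  have hMz : M = 0 := by
    have := Real.exp_pos (2 * Λ t₀)
    nlinarith
  intro t ht
  have := hle t ht
  rw [hMz, zero_mul] at this
  exact le_antisymm this (ha0 t ht)

/-- A local existence theorem for the integral equation `z(t) = ∫₀ᵗ G(s, z(s)) ds` under a
Lipschitz condition with an integrable constant `L` and a smallness condition on `G(·, 0)`. -/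
theorem exists_eq_integral {G : ℝ → E → E} {L : ℝ → ℝ} {T R c : ℝ} (hT : 0 ≤ T) (hc : 0 ≤ c)
    (hL : IntervalIntegrable L volume 0 T) (hL0 : ∀ t ∈ Icc 0 T, 0 ≤ L t)
    (hcR : c * Real.exp (2 * ∫ s in 0..T, L s) ≤ R)
    (hmeas : ∀ z : ℝ → E, Continuous z → (∀ t ∈ Icc 0 T, ‖z t‖ ≤ R) →
      AEStronglyMeasurable (fun t => G t (z t)) (volume.restrict (Icc 0 T)))
    (hlip : ∀ t ∈ Icc 0 T, ∀ z z', ‖z‖ ≤ R → ‖z'‖ ≤ R → ‖G t z - G t z'‖ ≤ L t * ‖z - z'‖)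
    (hG0 : ∀ t ∈ Icc 0 T, ‖G t 0‖ ≤ c * L t) :
    ∃ z : ℝ → E, Continuous z ∧ IntervalIntegrable (fun s => G s (z s)) volume 0 T ∧
      (∀ t ∈ Icc 0 T, z t = ∫ s in 0..t, G s (z s)) ∧
      ∀ t, ‖z t‖ ≤ c * Real.exp (2 * ∫ s in 0..T, L s) := by
  set Λ : ℝ → ℝ := fun s => ∫ r in 0..s, L r with hΛ
  have hΛc : ContinuousOn Λ (Icc 0 T) := continuousOn_integral hT hL
  have hR0 : 0 ≤ R := (mul_nonneg hc (Real.exp_pos _).le).trans hcR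
  have hΛT : ∀ t ∈ Icc 0 T, Λ t ≤ Λ T := fun t ht => by
    rw [← sub_nonneg, integral_sub_integral hL hT ht (right_mem_Icc.2 hT)]
    exact intervalIntegral.integral_nonneg ht.2 fun s hs => hL0 s ⟨ht.1.trans hs.1, hs.2⟩
  -- The unknown is written as `z = exp (2 Λ) y`. In the sup norm of `y` the integral operator
  -- contracts by `1 / 2` on the whole of `[0, T]`, whatever the size of `∫ L`.
  let w : C(Icc 0 T, ℝ) := ⟨fun t => Real.exp (2 * Λ t), by
    have := hΛc.domRestrict; rw [Set.domRestrict_eq] at this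
    exact Real.continuous_exp.comp (continuous_const.mul this)⟩
  let ext : C(Icc 0 T, E) → ℝ → E := fun y => IccExtend hT fun t => w t • y t
  have ext_cont : ∀ y, Continuous (ext y) := fun y => by
    have : Continuous fun t => w t • y t := by fun_prop
    exact this.Icc_extend'
  have ext_eq : ∀ y, ∀ t (ht : t ∈ Icc 0 T), ext y t = Real.exp (2 * Λ t) • y ⟨t, ht⟩ :=
    fun y t ht => IccExtend_of_mem hT _ ht
  have ext_norm : ∀ y : C(Icc 0 T, E), ∀ t ∈ Icc 0 T, ‖ext y t‖ ≤ ‖y‖ * Real.exp (2 * Λ t) := by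
    intro y t ht
    rw [ext_eq y t ht, norm_smul, Real.norm_of_nonneg (Real.exp_pos _).le, mul_comm]
    gcongr
    exact y.norm_coe_le_norm _
  have ext_R : ∀ y : C(Icc 0 T, E), ‖y‖ ≤ c → ∀ t ∈ Icc 0 T, ‖ext y t‖ ≤ R := by
    intro y hy t ht
    refine (ext_norm y t ht).trans (le_trans ?_ hcR)
    have := hΛT t ht
    gcongr
  -- The Lipschitz part is at most `c L exp (2 Λ)`, and so is `‖G t 0‖ ≤ c L` because `exp (2 Λ) ≥
  -- 1`. The sum has integral at most `c (exp (2 Λ) - 1)`, so the ball of radius `c` is mapped into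
  -- itself.
  have hbound : ∀ y : C(Icc 0 T, E), ‖y‖ ≤ c → ∀ t ∈ Icc 0 T,
      ‖G t (ext y t)‖ ≤ 2 * c * (L t * Real.exp (2 * Λ t)) := by
    intro y hy t ht
    have h1 := hlip t ht (ext y t) 0 (ext_R y hy t ht) (by simpa using hR0)
    rw [sub_zero] at h1
    have h2 := norm_sub_norm_le (G t (ext y t)) (G t 0)
    have h3 := ext_norm y t ht
    have h4 := hG0 t ht
    have hL' := hL0 t ht
    have hΛ0 : 0 ≤ Λ t :=
      intervalIntegral.integral_nonneg ht.1 fun s hs => hL0 s ⟨hs.1, hs.2.trans ht.2⟩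
    have h5 : 1 ≤ Real.exp (2 * Λ t) := Real.one_le_exp (by positivity)
    have h6 : ‖ext y t‖ ≤ c * Real.exp (2 * Λ t) := h3.trans (by gcongr)
    have h7 := mul_le_mul_of_nonneg_left h6 hL'
    have h8 : c * L t ≤ c * L t * Real.exp (2 * Λ t) :=
      le_mul_of_one_le_right (by positivity) h5
    nlinarith
  obtain ⟨hwi, -⟩ := integral_mul_exp hT hL (right_mem_Icc.2 hT)
  have hint : ∀ y : C(Icc 0 T, E), ‖y‖ ≤ c →
      IntervalIntegrable (fun s => G s (ext y s)) volume 0 T := by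
    intro y hy
    rw [intervalIntegrable_iff_integrableOn_Icc_of_le hT] at hwi ⊢
    exact Integrable.mono' (hwi.const_mul (2 * c)) (hmeas _ (ext_cont y) (ext_R y hy))
      ((ae_restrict_iff' measurableSet_Icc).2 (ae_of_all _ (hbound y hy)))
  have hw0 : ∀ t ∈ Icc 0 T, IntervalIntegrable (fun s => L s * Real.exp (2 * Λ s)) volume 0 t :=
    fun t ht => (integral_mul_exp hT hL ht).1
  have h0mem : (0 : ℝ) ∈ Icc 0 T := left_mem_Icc.2 hT
  let Φ : Metric.closedBall (0 : C(Icc 0 T, E)) c → Metric.closedBall (0 : C(Icc 0 T, E)) c :=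
    fun y => ⟨⟨fun t => Real.exp (-(2 * Λ t)) • ∫ s in 0..(t : ℝ), G s (ext y s), by
        have h1 := hΛc.domRestrict; rw [Set.domRestrict_eq] at h1
        have h2 := (continuousOn_integral hT
          (hint y (mem_closedBall_zero_iff.1 y.2))).domRestrict
        rw [Set.domRestrict_eq] at h2
        exact (Real.continuous_exp.comp (continuous_const.mul h1).neg).smul h2⟩, by
      rw [mem_closedBall_zero_iff, ContinuousMap.norm_le _ hc]
      intro t
      have hy := mem_closedBall_zero_iff.1 y.2
      have hI : ‖∫ s in 0..(t : ℝ), G s (ext y s)‖ ≤ c * Real.exp (2 * Λ t) := by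
        refine (intervalIntegral.norm_integral_le_of_norm_le t.2.1 (ae_of_all _ fun s hs =>
          hbound y hy s ⟨hs.1.le, hs.2.trans t.2.2⟩) ((hw0 t t.2).const_mul _)).trans ?_
        rw [intervalIntegral.integral_const_mul, (integral_mul_exp hT hL t.2).2]
        linarith
      simp only [ContinuousMap.coe_mk]
      rw [norm_smul, Real.norm_of_nonneg (Real.exp_pos _).le]
      calc _ ≤ Real.exp (-(2 * Λ t)) * (c * Real.exp (2 * Λ t)) := by gcongr
        _ = c * (Real.exp (-(2 * Λ t)) * Real.exp (2 * Λ t)) := by ring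
        _ = c := by rw [← Real.exp_add]; simp⟩
  have hΦ : ContractingWith (1 / 2 : ℝ≥0) Φ := by
    refine ⟨by rw [← NNReal.coe_lt_coe]; norm_num, LipschitzWith.of_dist_le_mul fun y y' => ?_⟩
    have hy := mem_closedBall_zero_iff.1 y.2
    have hy' := mem_closedBall_zero_iff.1 y'.2
    rw [Subtype.dist_eq, Subtype.dist_eq, dist_eq_norm, dist_eq_norm,
      ContinuousMap.norm_le _ (by positivity)]
    intro t
    have e : ((Φ y : C(Icc 0 T, E)) - (Φ y' : C(Icc 0 T, E))) t =
        Real.exp (-(2 * Λ t)) • ∫ s in 0..(t : ℝ), (G s (ext y s) - G s (ext y' s)) := by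
      rw [intervalIntegral.integral_sub (intervalIntegrable_sub (hint y hy) hT h0mem t.2)
        (intervalIntegrable_sub (hint y' hy') hT h0mem t.2), smul_sub]
      rfl
    have hI : ‖∫ s in 0..(t : ℝ), (G s (ext y s) - G s (ext y' s))‖ ≤
        ‖(y : C(Icc 0 T, E)) - y'‖ * ((Real.exp (2 * Λ t) - 1) / 2) := by
      rw [← (integral_mul_exp hT hL t.2).2, ← intervalIntegral.integral_const_mul]
      refine intervalIntegral.norm_integral_le_of_norm_le t.2.1 (ae_of_all _ fun s hs => ?_)
        ((hw0 t t.2).const_mul _)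
      have hs' : s ∈ Icc 0 T := ⟨hs.1.le, hs.2.trans t.2.2⟩
      refine (hlip s hs' _ _ (ext_R _ hy s hs') (ext_R _ hy' s hs')).trans ?_
      have e2 : ext y s - ext y' s = ext (y - y') s := by
        rw [ext_eq _ s hs', ext_eq _ s hs', ext_eq _ s hs', ← smul_sub]; rfl
      have h3 := mul_le_mul_of_nonneg_left (ext_norm (y - y') s hs') (hL0 s hs')
      rw [e2]
      linarith
    rw [e, norm_smul, Real.norm_of_nonneg (Real.exp_pos _).le]
    have h1 : Real.exp (-(2 * Λ t)) * Real.exp (2 * Λ t) = 1 := by rw [← Real.exp_add]; simp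
    have h2 := Real.exp_pos (-(2 * Λ t))
    have h3 := mul_le_mul_of_nonneg_left hI h2.le
    have h4 := norm_nonneg ((y : C(Icc 0 T, E)) - y')
    push_cast
    nlinarith [mul_nonneg h2.le h4]
  have : Nonempty (Metric.closedBall (0 : C(Icc 0 T, E)) c) := ⟨⟨0, by simpa using hc⟩⟩
  have : CompleteSpace (Metric.closedBall (0 : C(Icc 0 T, E)) c) :=
    Metric.isClosed_closedBall.completeSpace_coe
  set y := hΦ.fixedPoint Φ with hydef
  have hfix : Φ y = y := hΦ.fixedPoint_isFixedPt
  have hy := mem_closedBall_zero_iff.1 y.2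
  refine ⟨ext y, ext_cont y, hint y hy, fun t ht => ?_, fun t => ?_⟩
  · have h1 : (y : C(Icc 0 T, E)) ⟨t, ht⟩ =
        Real.exp (-(2 * Λ t)) • ∫ s in 0..t, G s (ext y s) := by
      conv_lhs => rw [← hfix]
      rfl
    rw [ext_eq _ t ht, h1, smul_smul, ← Real.exp_add]
    simp
  · have hp : (projIcc 0 T hT t : ℝ) ∈ Icc 0 T := (projIcc 0 T hT t).2
    have : ext y t = ext y (projIcc 0 T hT t) := by
      simp only [ext]; rw [IccExtend_val]; rfl
    rw [this]
    refine (ext_norm y _ hp).trans ?_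
    have := hΛT _ hp
    gcongr

end Volterra

/-! ### The linear adjoint equation -/

section Adjoint

variable {E G : Type*} [NormedAddCommGroup E] [NormedSpace ℝ E]
  [NormedAddCommGroup G] [NormedSpace ℝ G]

theorem intervalIntegrable_clm_apply {A : ℝ → E →L[ℝ] G} {ζ : ℝ → E} {a b B : ℝ} (hab : a ≤ b)
    (hA : AEStronglyMeasurable A (volume.restrict (Icc a b))) (hB : ∀ t ∈ Icc a b, ‖A t‖ ≤ B)
    (hζ : IntervalIntegrable ζ volume a b) :
    IntervalIntegrable (fun r => A r (ζ r)) volume a b := by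
  rw [intervalIntegrable_iff_integrableOn_Icc_of_le hab] at hζ ⊢
  refine Integrable.mono' (hζ.norm.const_mul B)
    ((ContinuousLinearMap.id ℝ (E →L[ℝ] G)).aestronglyMeasurable_comp₂ hA
      hζ.aestronglyMeasurable)
    ((ae_restrict_iff' measurableSet_Icc).2 (ae_of_all _ fun t ht => ?_))
  exact ((A t).le_opNorm _).trans (by gcongr; exact hB t ht)

theorem intervalIntegrable_clm_apply_of_continuousOn {A : ℝ → E →L[ℝ] G} {ζ : ℝ → E} {a b : ℝ}
    (hab : a ≤ b) (hA : ContinuousOn A (Icc a b)) (hζ : IntervalIntegrable ζ volume a b) :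
    IntervalIntegrable (fun r => A r (ζ r)) volume a b := by
  obtain ⟨B, hB⟩ := isCompact_Icc.exists_bound_of_continuousOn hA
  exact intervalIntegrable_clm_apply hab
    (hA.aestronglyMeasurable measurableSet_Icc) hB hζ

theorem intervalIntegrable_apply_of_continuousOn {m : ℝ → E →L[ℝ] G} {z : ℝ → E} {a b : ℝ}
    (hab : a ≤ b) (hm : IntervalIntegrable m volume a b) (hz : ContinuousOn z (Icc a b)) :
    IntervalIntegrable (fun r => m r (z r)) volume a b :=
  intervalIntegrable_clm_apply_of_continuousOn (A := fun r => ContinuousLinearMap.apply ℝ G (z r))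
    hab ((ContinuousLinearMap.apply ℝ G).continuous.comp_continuousOn hz) hm

/-- The monotone `Z` may jump, so its increments need not be small. It is the factor `ε` that makes
the error small, and the main term `x s (η t - η s)` is small by continuity of `η`. -/
theorem IsYoungPrimitive.continuousOn {F : Type*} [NormedAddCommGroup F] [NormedSpace ℝ F]
    {a b B : ℝ} (hab : a ≤ b) {Z : ℝ → ℝ} {x : ℝ → F →L[ℝ] G} {η : ℝ → F} {J : ℝ → G}
    (hZ : MonotoneOn Z (Icc a b)) (h : IsYoungPrimitive a b Z x η J)
    (hη : ContinuousOn η (Icc a b)) (hx : ∀ t ∈ Icc a b, ‖x t‖ ≤ B) :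
    ContinuousOn J (Icc a b) := by
  have ha : a ∈ Icc a b := left_mem_Icc.2 hab
  have hb : b ∈ Icc a b := right_mem_Icc.2 hab
  have hB0 : 0 ≤ B := (norm_nonneg _).trans (hx a ha)
  have hZab : 0 ≤ Z b - Z a := sub_nonneg.2 (hZ ha hb hab)
  refine UniformContinuousOn.continuousOn (Metric.uniformContinuousOn_iff.2 fun ε hε => ?_)
  have hηu := isCompact_Icc.uniformContinuousOn_of_continuous hη
  obtain ⟨δ₁, hδ₁, H₁⟩ := h (ε / 2 / (Z b - Z a + 1)) (by positivity)
  obtain ⟨δ₂, hδ₂, H₂⟩ := Metric.uniformContinuousOn_iff.1 hηu (ε / 2 / (B + 1)) (by positivity)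
  have key : ∀ s ∈ Icc a b, ∀ t ∈ Icc a b, s ≤ t → t - s < min δ₁ δ₂ → ‖J t - J s‖ < ε := by
    intro s hs t ht hst hlt
    have h1 := H₁ s hs t ht hst (hlt.trans_le (min_le_left _ _)) s (left_mem_Icc.2 hst)
    have h2 := H₂ t ht s hs (by
      rw [Real.dist_eq, abs_of_nonneg (by linarith)]; exact hlt.trans_le (min_le_right _ _))
    rw [dist_eq_norm] at h2
    have e1 := hZ ha hs hs.1
    have e2 := hZ ht hb ht.2
    have h3 : ε / 2 / (Z b - Z a + 1) * (Z t - Z s) ≤ ε / 2 := by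
      rw [div_mul_eq_mul_div, div_le_iff₀ (by positivity)]
      nlinarith
    have h4 : ‖x s (η t - η s)‖ < ε / 2 := by
      refine ((x s).le_opNorm _).trans_lt ?_
      rw [lt_div_iff₀ (by positivity)] at h2
      nlinarith [hx s hs, norm_nonneg (η t - η s), norm_nonneg (x s)]
    have h5 := norm_sub_norm_le (J t - J s) (x s (η t - η s))
    linarith
  refine ⟨min δ₁ δ₂, lt_min hδ₁ hδ₂, fun s hs t ht hst => ?_⟩
  rw [Real.dist_eq] at hst
  rcases le_total s t with hle | hle
  · rw [dist_comm, dist_eq_norm]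
    exact key s hs t ht hle (by rwa [abs_sub_comm, abs_of_nonneg (by linarith)] at hst)
  · rw [dist_eq_norm]
    exact key t ht s hs hle (by rwa [abs_of_nonneg (by linarith)] at hst)

/-- Duality: integration by parts for a backward path `lam = ∫ₜᵀ m ds + ∫ₜᵀ y dη` and a forward
path `z = ∫₀ᵗ ζ ds`. -/
theorem isYoungIntegral_of_duality {F : Type*} [NormedAddCommGroup F] [NormedSpace ℝ F]
    [CompleteSpace E] {T : ℝ} (hT : 0 ≤ T) {Z : ℝ → ℝ} (hZ : MonotoneOn Z (Icc 0 T))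
    {y : ℝ → F →L[ℝ] E →L[ℝ] ℝ} {η : ℝ → F} {J : ℝ → E →L[ℝ] ℝ}
    (hJ : IsYoungPrimitive 0 T Z y η J) {m : ℝ → E →L[ℝ] ℝ} {ζ : ℝ → E}
    (hm : IntervalIntegrable m volume 0 T) (hζ : IntervalIntegrable ζ volume 0 T)
    {lam : ℝ → E →L[ℝ] ℝ} {z : ℝ → E} (hlamc : ContinuousOn lam (Icc 0 T))
    (hlam : ∀ t ∈ Icc 0 T, lam t = (∫ s in t..T, m s) + (J T - J t))
    (hz : ∀ t ∈ Icc 0 T, z t = ∫ s in 0..t, ζ s) :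
    IsYoungIntegral 0 T (fun s => (ContinuousLinearMap.apply ℝ ℝ (z s)).comp (y s)) η
      ((∫ r in 0..T, lam r (ζ r)) - ∫ r in 0..T, m r (z r)) := by
  have h0 : (0 : ℝ) ∈ Icc 0 T := left_mem_Icc.2 hT
  have hT' : T ∈ Icc 0 T := right_mem_Icc.2 hT
  have hzc : ContinuousOn z (Icc 0 T) := (continuousOn_integral hT hζ).congr hz
  have hlζ := intervalIntegrable_clm_apply_of_continuousOn hT hlamc hζ
  have hmz := intervalIntegrable_apply_of_continuousOn hT hm hzc
  have hn : IntervalIntegrable (fun r => ‖m r‖ + ‖ζ r‖) volume 0 T := hm.norm.add hζ.norm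
  -- The errors are small multiples of the increments of `Z`, of `∫ ‖m‖` and of `∫ ‖ζ‖`, so all
  -- three enter the new monotone function.
  set Z' : ℝ → ℝ := fun t => Z t + ∫ r in 0..t, (‖m r‖ + ‖ζ r‖) with hZ'
  have hZ'sub : ∀ s ∈ Icc 0 T, ∀ t ∈ Icc 0 T,
      Z' t - Z' s = (Z t - Z s) + ((∫ r in s..t, ‖m r‖) + ∫ r in s..t, ‖ζ r‖) := by
    intro s hs t ht
    simp only [hZ']
    rw [add_sub_add_comm, integral_sub_integral hn hT hs ht, intervalIntegral.integral_add
      (intervalIntegrable_sub hm.norm hT hs ht) (intervalIntegrable_sub hζ.norm hT hs ht)]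
  have hZ'm : MonotoneOn Z' (Icc 0 T) := by
    intro s hs t ht hst
    have h1 := hZ'sub s hs t ht
    have h2 := hZ hs ht hst
    have h3 : 0 ≤ ∫ r in s..t, ‖m r‖ := intervalIntegral.integral_nonneg hst fun _ _ => norm_nonneg _
    have h4 : 0 ≤ ∫ r in s..t, ‖ζ r‖ := intervalIntegral.integral_nonneg hst fun _ _ => norm_nonneg _
    linarith
  -- Formally `d(lam z) = lam ζ dt - m z dt - y z dη`, so `Q` should be a primitive of `y z dη`. The
  -- boundary terms vanish since `lam T = 0` and `z 0 = 0`.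
  set Q : ℝ → ℝ := fun t => (∫ r in 0..t, lam r (ζ r)) - (∫ r in 0..t, m r (z r)) - lam t (z t)
    with hQ
  suffices hprim : IsYoungPrimitive 0 T Z'
      (fun s => (ContinuousLinearMap.apply ℝ ℝ (z s)).comp (y s)) η Q by
    have := hprim.isYoungIntegral hZ'm le_rfl hT le_rfl
    have hlT : lam T = 0 := by rw [hlam T hT']; simp
    have hz0 : z 0 = 0 := by rw [hz 0 h0]; simp
    simpa [hQ, hlT, hz0] using this
  intro ε hε
  obtain ⟨B, hB⟩ := isCompact_Icc.exists_bound_of_continuousOn hzc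
  have hB0 : 0 ≤ B := (norm_nonneg _).trans (hB 0 h0)
  obtain ⟨δ₁, hδ₁, H₁⟩ := hJ (ε / (B + 1)) (by positivity)
  obtain ⟨δ₂, hδ₂, H₂⟩ := Metric.uniformContinuousOn_iff.1
    (isCompact_Icc.uniformContinuousOn_of_continuous hzc) ε hε
  obtain ⟨δ₃, hδ₃, H₃⟩ := Metric.uniformContinuousOn_iff.1
    (isCompact_Icc.uniformContinuousOn_of_continuous hlamc) ε hε
  refine ⟨min δ₁ (min δ₂ δ₃), lt_min hδ₁ (lt_min hδ₂ hδ₃), fun s hs t ht hst hlt τ hτ => ?_⟩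
  obtain ⟨hlt₁, hlt₂, hlt₃⟩ : t - s < δ₁ ∧ t - s < δ₂ ∧ t - s < δ₃ := by
    simpa only [lt_min_iff] using hlt
  have hτ' : τ ∈ Icc 0 T := ⟨hs.1.trans hτ.1, hτ.2.trans ht.2⟩
  have hmem : ∀ {r}, r ∈ Icc s t → r ∈ Icc 0 T := fun hr => ⟨hs.1.trans hr.1, hr.2.trans ht.2⟩
  have hdist : ∀ {r r'}, r ∈ Icc s t → r' ∈ Icc s t → dist r r' ≤ t - s := fun hr hr' => by
    rw [Real.dist_eq, abs_le]; constructor <;> linarith [hr.1, hr.2, hr'.1, hr'.2]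
  have hlamsub : lam s - lam t = (∫ r in s..t, m r) + (J t - J s) := by
    rw [hlam s hs, hlam t ht, ← intervalIntegral.integral_add_adjacent_intervals
      (intervalIntegrable_sub hm hT hs ht) (intervalIntegrable_sub hm hT ht hT')]
    abel
  have e1 : ∫ r in s..t, m r (z τ - z r) = (∫ r in s..t, m r) (z τ) - ∫ r in s..t, m r (z r) := by
    have hi := intervalIntegrable_sub hm hT hs ht
    have := (ContinuousLinearMap.apply ℝ ℝ (z τ)).intervalIntegral_comp_comm hi
    simp only [ContinuousLinearMap.apply_apply] at this
    rw [← this, ← intervalIntegral.integral_sub]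
    · simp only [map_sub]
    · exact ⟨(ContinuousLinearMap.apply ℝ ℝ (z τ)).integrable_comp hi.1,
        (ContinuousLinearMap.apply ℝ ℝ (z τ)).integrable_comp hi.2⟩
    · exact intervalIntegrable_sub hmz hT hs ht
  have e2 : ∀ s' ∈ Icc 0 T, ∀ t' ∈ Icc 0 T, ∀ r' : ℝ, ∫ r in s'..t', (lam r - lam r') (ζ r) =
      (∫ r in s'..t', lam r (ζ r)) - lam r' (z t' - z s') := by
    intro s' hs' t' ht' r'
    have hi := intervalIntegrable_sub hζ hT hs' ht'
    rw [hz t' ht', hz s' hs', integral_sub_integral hζ hT hs' ht',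
      ← (lam r').intervalIntegral_comp_comm hi, ← intervalIntegral.integral_sub]
    · simp only [sub_apply]
    · exact intervalIntegrable_sub hlζ hT hs' ht'
    · exact ⟨(lam r').integrable_comp hi.1, (lam r').integrable_comp hi.2⟩
  have b1 : ‖∫ r in s..t, m r (z τ - z r)‖ ≤ ε * ∫ r in s..t, ‖m r‖ := by
    rw [← intervalIntegral.integral_const_mul]
    refine intervalIntegral.norm_integral_le_of_norm_le hst (ae_of_all _ fun r hr => ?_)
      ((intervalIntegrable_sub hm.norm hT hs ht).const_mul ε)
    have hr' : r ∈ Icc s t := ⟨hr.1.le, hr.2⟩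
    have := H₂ τ hτ' r (hmem hr') ((hdist hτ hr').trans_lt hlt₂)
    rw [dist_eq_norm] at this
    refine ((m r).le_opNorm _).trans ?_
    rw [mul_comm]; gcongr
  have b2 : ∀ s' ∈ Icc s t, ∀ t' ∈ Icc s t, s' ≤ t' → ∀ r' ∈ Icc s t,
      ‖∫ r in s'..t', (lam r - lam r') (ζ r)‖ ≤ ε * ∫ r in s'..t', ‖ζ r‖ := by
    intro s' hs' t' ht' hst' r' hr'
    rw [← intervalIntegral.integral_const_mul]
    refine intervalIntegral.norm_integral_le_of_norm_le hst' (ae_of_all _ fun r hr => ?_)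
      ((intervalIntegrable_sub hζ.norm hT (hmem hs') (hmem ht')).const_mul ε)
    have hr1 : r ∈ Icc s t := ⟨hs'.1.trans hr.1.le, hr.2.trans ht'.2⟩
    have := H₃ r (hmem hr1) r' (hmem hr') ((hdist hr1 hr').trans_lt hlt₃)
    rw [dist_eq_norm] at this
    refine (ContinuousLinearMap.le_opNorm _ _).trans ?_
    gcongr
  have b3 : ‖(J t - J s - y τ (η t - η s)) (z τ)‖ ≤ ε * (Z t - Z s) := by
    have h1 := H₁ s hs t ht hst hlt₁ τ hτ
    have h2 := hB τ hτ'
    have h3 : 0 ≤ Z t - Z s := sub_nonneg.2 (hZ hs ht hst)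
    calc _ ≤ ‖J t - J s - y τ (η t - η s)‖ * ‖z τ‖ := ContinuousLinearMap.le_opNorm _ _
      _ ≤ (ε / (B + 1) * (Z t - Z s)) * (B + 1) := by gcongr; linarith
      _ = ε * (Z t - Z s) := by field_simp
  have hss : s ∈ Icc s t := left_mem_Icc.2 hst
  have htt : t ∈ Icc s t := right_mem_Icc.2 hst
  have c1 := b2 s hss τ hτ hτ.1 s hss
  have c2 := b2 τ hτ t htt hτ.2 t htt
  have hsplit := intervalIntegral.integral_add_adjacent_intervals
    (intervalIntegrable_sub hζ.norm hT hs hτ') (intervalIntegrable_sub hζ.norm hT hτ' ht)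
  -- The increment of `lam z` is split exactly at the tag: `(lam t - lam s) (z τ)`, plus `lam s`
  -- applied to the increment of `z` before `τ`, plus `lam t` applied to the one after `τ`. Each
  -- term left over pairs `m` or `ζ` with a small difference, or is the error of `J`.
  have hdec : Q t - Q s - ((ContinuousLinearMap.apply ℝ ℝ (z τ)).comp (y τ)) (η t - η s) =
      (J t - J s - y τ (η t - η s)) (z τ) + (∫ r in s..t, m r (z τ - z r)) +
        (∫ r in s..τ, (lam r - lam s) (ζ r)) + ∫ r in τ..t, (lam r - lam t) (ζ r) := by
    rw [e1, e2 s hs τ hτ' s, e2 τ hτ' t ht t]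
    have f1 := integral_sub_integral hlζ hT hs ht
    have f2 := integral_sub_integral hmz hT hs ht
    have f3 := intervalIntegral.integral_add_adjacent_intervals
      (intervalIntegrable_sub hlζ hT hs hτ') (intervalIntegrable_sub hlζ hT hτ' ht)
    have f4 := congrArg (fun l : E →L[ℝ] ℝ => l (z τ)) hlamsub
    simp only [sub_apply, add_apply] at f4
    simp only [hQ, ContinuousLinearMap.comp_apply, ContinuousLinearMap.apply_apply, sub_apply,
      map_sub] at f4 ⊢
    linarith
  rw [hdec, hZ'sub s hs t ht]
  calc _ ≤ ‖(J t - J s - y τ (η t - η s)) (z τ)‖ + ‖∫ r in s..t, m r (z τ - z r)‖ +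
        ‖∫ r in s..τ, (lam r - lam s) (ζ r)‖ + ‖∫ r in τ..t, (lam r - lam t) (ζ r)‖ :=
      (norm_add_le _ _).trans (by
        gcongr; exact (norm_add_le _ _).trans (by gcongr; exact norm_add_le _ _))
    _ ≤ _ := by rw [← hsplit]; linarith

theorem intervalIntegrable_clm_comp {A : ℝ → E →L[ℝ] E} {l : ℝ → E →L[ℝ] ℝ} {a b : ℝ}
    (hab : a ≤ b) (hl : ContinuousOn l (Icc a b)) (hA : IntervalIntegrable A volume a b) :
    IntervalIntegrable (fun r => (l r).comp (A r)) volume a b :=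
  intervalIntegrable_clm_apply_of_continuousOn
    (A := fun r => ContinuousLinearMap.compL ℝ E E ℝ (l r)) hab
    ((ContinuousLinearMap.compL ℝ E E ℝ).continuous.comp_continuousOn hl) hA

/-- Solvability of the backward linear equation `lam = ∫ₜᵀ lam A ds + p`. -/
theorem exists_backward_solution {A : ℝ → E →L[ℝ] E} {p : ℝ → E →L[ℝ] ℝ} {T : ℝ} (hT : 0 ≤ T)
    (hA : IntervalIntegrable A volume 0 T) (hp : ContinuousOn p (Icc 0 T)) :
    ∃ lam : ℝ → E →L[ℝ] ℝ, ContinuousOn lam (Icc 0 T) ∧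
      ∀ t ∈ Icc 0 T, lam t = (∫ s in t..T, (lam s).comp (A s)) + p t := by
  obtain ⟨B, hB⟩ := isCompact_Icc.exists_bound_of_continuousOn hp
  have hB0 : 0 ≤ B := (norm_nonneg _).trans (hB 0 (left_mem_Icc.2 hT))
  have hrev : ∀ t ∈ Icc 0 T, T - t ∈ Icc 0 T := fun t ht => ⟨by linarith [ht.2], by linarith [ht.1]⟩
  have hpr : ContinuousOn (fun s => p (T - s)) (Icc 0 T) :=
    hp.comp (by fun_prop) hrev
  have hAr : IntervalIntegrable (fun s => A (T - s)) volume 0 T := by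
    simpa using (hA.comp_sub_left T).symm
  -- Time is reversed and `p` is subtracted, so that the unknown is a pure integral. By linearity
  -- the Lipschitz condition holds everywhere, and `R` may be chosen to meet the smallness
  -- condition.
  obtain ⟨z, hzc, hzi, hz, -⟩ := exists_eq_integral
    (G := fun s (μ : E →L[ℝ] ℝ) => (μ + p (T - s)).comp (A (T - s)))
    (L := fun s => ‖A (T - s)‖) (R := B * Real.exp (2 * ∫ s in 0..T, ‖A (T - s)‖))
    hT hB0 hAr.norm (fun _ _ => norm_nonneg _) le_rfl
    (fun z hz _ => by
      have := intervalIntegrable_clm_comp hT (hz.continuousOn.add hpr) hAr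
      rw [intervalIntegrable_iff_integrableOn_Icc_of_le hT] at this
      exact this.aestronglyMeasurable)
    (fun t ht z z' _ _ => by
      have : (z + p (T - t)).comp (A (T - t)) - (z' + p (T - t)).comp (A (T - t)) =
          (z - z').comp (A (T - t)) := by
        ext; simp
      rw [this, mul_comm]
      exact ContinuousLinearMap.opNorm_comp_le _ _)
    (fun t ht => by
      rw [zero_add]
      exact (ContinuousLinearMap.opNorm_comp_le _ _).trans (by gcongr; exact hB _ (hrev t ht)))
  refine ⟨fun t => z (T - t) + p t, ?_, fun t ht => ?_⟩
  · exact (hzc.comp (by fun_prop)).continuousOn.add hp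
  · dsimp only
    rw [hz _ (hrev t ht)]
    congr 1
    have := intervalIntegral.integral_comp_sub_left
      (fun s => (z (T - s) + p s).comp (A s)) (a := 0) (b := T - t) T
    simpa using this

/-- Uniqueness for the homogeneous backward linear equation. -/
theorem eq_zero_of_backward {A : ℝ → E →L[ℝ] E} {ν : ℝ → E →L[ℝ] ℝ} {T : ℝ} (hT : 0 ≤ T)
    (hA : IntervalIntegrable A volume 0 T)
    (hi : IntervalIntegrable (fun s => (ν s).comp (A s)) volume 0 T)
    (hν : ∀ t ∈ Icc 0 T, ν t = ∫ s in t..T, (ν s).comp (A s)) : ∀ t ∈ Icc 0 T, ν t = 0 := by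
  have hrev : ∀ t ∈ Icc 0 T, T - t ∈ Icc 0 T := fun t ht => ⟨by linarith [ht.2], by linarith [ht.1]⟩
  have hAr : IntervalIntegrable (fun s => A (T - s)) volume 0 T := by
    simpa using (hA.comp_sub_left T).symm
  -- Continuity is not assumed; it follows from the equation, whose right-hand side is an integral
  -- of an integrable function.
  have hνc : ContinuousOn ν (Icc 0 T) := by
    have h1 := continuousOn_const (c := ∫ s in 0..T, (ν s).comp (A s)).sub
      (continuousOn_integral hT hi)
    refine h1.congr fun t ht => ?_
    rw [hν t ht, ← integral_sub_integral hi hT ht (right_mem_Icc.2 hT), Pi.sub_apply]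
  have hcr : ContinuousOn (fun t => ‖ν (T - t)‖) (Icc 0 T) :=
    (hνc.comp (by fun_prop) hrev).norm
  have key := eq_zero_of_le_integral (L := fun s => ‖A (T - s)‖) (a := fun t => ‖ν (T - t)‖) hT
    hAr.norm (fun _ _ => norm_nonneg _) hcr (fun _ _ => norm_nonneg _) (fun t ht => by
      have e := intervalIntegral.integral_comp_sub_left
        (fun s => (ν s).comp (A s)) (a := 0) (b := t) T
      rw [sub_zero] at e
      rw [hν _ (hrev t ht), ← e]
      refine intervalIntegral.norm_integral_le_of_norm_le ht.1 (ae_of_all _ fun s hs => ?_) ?_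
      · rw [mul_comm]; exact ContinuousLinearMap.opNorm_comp_le _ _
      · refine (intervalIntegrable_sub hAr.norm hT (left_mem_Icc.2 hT) ht).mul_continuousOn ?_
        rw [uIcc_of_le ht.1]
        exact hcr.mono (Icc_subset_Icc_right ht.2))
  intro t ht
  have := key _ (hrev t ht)
  simpa using this

end Adjoint

/-! ### Auxiliary facts -/

section Auxiliary

variable {E G : Type*} [NormedAddCommGroup E] [NormedSpace ℝ E]
  [NormedAddCommGroup G] [NormedSpace ℝ G]

/-- A locally Hölder function is Hölder on compact sets, if the local exponents are larger than
`1 / 2`. -/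
theorem exists_holder_of_isCompact {X Y : Type*} [PseudoMetricSpace X] [NormedAddCommGroup Y]
    {h : X → Y} {S K : Set X} (hK : IsCompact K) (hKS : K ⊆ S)
    (hloc : ∀ p ∈ S, ∃ (κ C : ℝ≥0), 1 / 2 < (κ : ℝ) ∧ ∃ N ∈ 𝓝[S] p, HolderOnWith C κ h N) :
    ∃ κ C B : ℝ, 1 / 2 < κ ∧ κ ≤ 1 ∧ 0 ≤ C ∧ 0 ≤ B ∧ (∀ p ∈ K, ‖h p‖ ≤ B) ∧
      ∀ p ∈ K, ∀ p' ∈ K, ‖h p - h p'‖ ≤ C * dist p p' ^ κ := by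
  -- For the induction over compact sets only `p` ranges over `K`, while `p'` is any point of `S`
  -- within `δ ≤ 1`. This makes the property stable under unions, where the smaller exponent may be
  -- taken because the distances are at most `1`.
  have main : ∃ κ C B δ : ℝ, 1 / 2 < κ ∧ κ ≤ 1 ∧ 0 ≤ C ∧ 0 ≤ B ∧ 0 < δ ∧ δ ≤ 1 ∧
      (∀ p ∈ K, ‖h p‖ ≤ B) ∧
      ∀ p ∈ K, ∀ p' ∈ S, dist p p' < δ → ‖h p - h p'‖ ≤ C * dist p p' ^ κ := by
    refine hK.induction_on (p := fun K => ∃ κ C B δ : ℝ, 1 / 2 < κ ∧ κ ≤ 1 ∧ 0 ≤ C ∧ 0 ≤ B ∧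
      0 < δ ∧ δ ≤ 1 ∧ (∀ p ∈ K, ‖h p‖ ≤ B) ∧
      ∀ p ∈ K, ∀ p' ∈ S, dist p p' < δ → ‖h p - h p'‖ ≤ C * dist p p' ^ κ) ?_ ?_ ?_ ?_
    · exact ⟨1, 0, 0, 1, by norm_num, le_rfl, le_rfl, le_rfl, one_pos, le_rfl, by simp, by simp⟩
    · rintro s t hst ⟨κ, C, B, δ, h1, h2, h3, h4, h5, h6, h7, h8⟩
      exact ⟨κ, C, B, δ, h1, h2, h3, h4, h5, h6, fun p hp => h7 p (hst hp),
        fun p hp => h8 p (hst hp)⟩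
    · rintro s t ⟨κ, C, B, δ, h1, h2, h3, h4, h5, h6, h7, h8⟩
        ⟨κ', C', B', δ', h1', h2', h3', h4', h5', h6', h7', h8'⟩
      refine ⟨min κ κ', max C C', max B B', min δ δ', lt_min h1 h1', (min_le_left _ _).trans h2,
        h3.trans (le_max_left _ _), h4.trans (le_max_left _ _), lt_min h5 h5',
        (min_le_left _ _).trans h6, ?_, ?_⟩
      · rintro p (hp | hp)
        · exact (h7 p hp).trans (le_max_left _ _)
        · exact (h7' p hp).trans (le_max_right _ _)
      · intro p hp p' hp' hd
        have hd0 : 0 ≤ dist p p' := dist_nonneg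
        have hd1 : dist p p' ≤ 1 := (hd.le.trans (min_le_left _ _)).trans h6
        have hmin : 0 ≤ min κ κ' := (lt_min (one_half_pos.trans h1) (one_half_pos.trans h1')).le
        rcases hp with hp | hp
        · refine (h8 p hp p' hp' (hd.trans_le (min_le_left _ _))).trans ?_
          exact mul_le_mul (le_max_left _ _)
            (Real.rpow_le_rpow_of_exponent_ge_of_imp hd0 hd1 (min_le_left _ _)
              (fun _ h => absurd h (one_half_pos.trans h1).ne'))
            (by positivity) (h3.trans (le_max_left _ _))
        · refine (h8' p hp p' hp' (hd.trans_le (min_le_right _ _))).trans ?_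
          exact mul_le_mul (le_max_right _ _)
            (Real.rpow_le_rpow_of_exponent_ge_of_imp hd0 hd1 (min_le_right _ _)
              (fun _ h => absurd h (one_half_pos.trans h1').ne'))
            (by positivity) (h3.trans (le_max_left _ _))
    · intro p₀ hp₀
      obtain ⟨κ, C, hκ, N, hN, hH⟩ := hloc p₀ (hKS hp₀)
      obtain ⟨ρ, hρ, hball⟩ := Metric.mem_nhdsWithin_iff.1 hN
      have hHd : ∀ p ∈ N, ∀ p' ∈ N, ‖h p - h p'‖ ≤ C * dist p p' ^ (κ : ℝ) := fun p hp p' hp' => by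
        rw [← dist_eq_norm]; exact hH.dist_le hp hp'
      set δ := min (ρ / 2) 1 with hδ
      have hδ0 : 0 < δ := by positivity
      have hδρ : δ + δ ≤ ρ := by have := min_le_left (ρ / 2) 1; linarith
      have hp₀N : p₀ ∈ N := hball ⟨Metric.mem_ball_self hρ, hKS hp₀⟩
      refine ⟨Metric.ball p₀ δ ∩ S, inter_mem (mem_nhdsWithin_of_mem_nhds (Metric.ball_mem_nhds p₀ hδ0))
        (mem_of_superset self_mem_nhdsWithin hKS), min κ 1, C,
        ‖h p₀‖ + C, δ, lt_min hκ (by norm_num), min_le_right _ _, C.2, by positivity, hδ0,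
        min_le_right _ _, ?_, ?_⟩
      · rintro p ⟨hp, hpS⟩
        have hpN : p ∈ N := hball ⟨Metric.ball_subset_ball (by linarith) hp, hpS⟩
        have h1 := hHd p hpN p₀ hp₀N
        have h2 : dist p p₀ ^ (κ : ℝ) ≤ 1 :=
          Real.rpow_le_one dist_nonneg ((Metric.mem_ball.1 hp).le.trans (min_le_right _ _)) κ.2
        have h3 := norm_sub_norm_le (h p) (h p₀)
        have h4 : (C : ℝ) * dist p p₀ ^ (κ : ℝ) ≤ C := mul_le_of_le_one_right C.2 h2
        linarith
      · rintro p ⟨hp, hpS⟩ p' hp'S hd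
        have hpN : p ∈ N := hball ⟨Metric.ball_subset_ball (by linarith) hp, hpS⟩
        have hp'N : p' ∈ N := hball ⟨by
          rw [Metric.mem_ball, dist_comm] at hp ⊢
          linarith [dist_triangle p₀ p p'], hp'S⟩
        refine (hHd p hpN p' hp'N).trans (mul_le_mul_of_nonneg_left ?_ C.2)
        exact Real.rpow_le_rpow_of_exponent_ge_of_imp dist_nonneg
          (hd.le.trans (min_le_right _ _)) (min_le_left _ _)
          (fun _ h => absurd h (one_half_pos.trans hκ).ne')
  obtain ⟨κ, C, B, δ, h1, h2, h3, h4, h5, h6, h7, h8⟩ := main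
  have hδκ : 0 < δ ^ κ := Real.rpow_pos_of_pos h5 κ
  -- For points at distance at least `δ` the trivial bound `2 * B` suffices, at the price of a
  -- factor `δ ^ (-κ)`.
  refine ⟨κ, C + 2 * B / δ ^ κ, B, h1, h2, by positivity, h4, h7, fun p hp p' hp' => ?_⟩
  have hdκ : 0 ≤ dist p p' ^ κ := Real.rpow_nonneg dist_nonneg κ
  rcases lt_or_ge (dist p p') δ with hd | hd
  · refine (h8 p hp p' (hKS hp') hd).trans ?_
    gcongr
    exact le_add_of_nonneg_right (by positivity)
  · have e1 : δ ^ κ ≤ dist p p' ^ κ := Real.rpow_le_rpow h5.le hd (by linarith)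
    calc ‖h p - h p'‖ ≤ 2 * B := (norm_sub_le _ _).trans (by linarith [h7 p hp, h7 p' hp'])
      _ = 2 * B / δ ^ κ * δ ^ κ := by field_simp
      _ ≤ 2 * B / δ ^ κ * dist p p' ^ κ := by gcongr
      _ ≤ _ := by gcongr; linarith

/-- Difference quotients along bounded directions. -/
theorem tendsto_differenceQuotient_sub {f : E → G} {f' : E →L[ℝ] G} {x : E}
    (hf : HasFDerivAt f f' x) {ε : ℕ → ℝ} (hε0 : ∀ n, ε n ≠ 0) (hε : Tendsto ε atTop (𝓝 0))
    {z : ℕ → E} {K : ℝ} (hz : ∀ n, ‖z n‖ ≤ K) :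
    Tendsto (fun n => (ε n)⁻¹ • (f (x + ε n • z n) - f x) - f' (z n)) atTop (𝓝 0) := by
  have hzO : (fun n => ε n • z n) =O[atTop] ε := by
    refine Asymptotics.IsBigO.of_bound K (Eventually.of_forall fun n => ?_)
    rw [norm_smul, mul_comm]
    exact mul_le_mul_of_nonneg_right (hz n) (norm_nonneg _)
  have hlim : Tendsto (fun n => x + ε n • z n) atTop (𝓝 x) := by
    have : Tendsto (fun n => ε n • z n) atTop (𝓝 0) := hzO.trans_tendsto hε
    simpa using this.const_add x
  have ho := (hasFDerivAt_iff_isLittleO.1 hf).comp_tendsto hlim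
  have ho2 : (fun n => f (x + ε n • z n) - f x - f' (ε n • z n)) =o[atTop] ε := by
    refine Asymptotics.IsLittleO.trans_isBigO ?_ hzO
    simpa [Function.comp_def] using ho
  have := ho2.tendsto_inv_smul_nhds_zero
  refine this.congr fun n => ?_
  rw [smul_sub, map_smul, smul_smul, inv_mul_cancel₀ (hε0 n), one_smul]

/-- Nothing is known about `h` off `s`, but the image measure under `k` is carried by `s` and so
equals its restriction to `s`. -/
theorem aestronglyMeasurable_comp_of_continuousOn {Ω X Y : Type*} [MeasurableSpace Ω]
    {μ : Measure Ω} [TopologicalSpace X] [MeasurableSpace X] [BorelSpace X]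
    [SecondCountableTopology X] [TopologicalSpace Y] [TopologicalSpace.PseudoMetrizableSpace Y]
    {h : X → Y} {s : Set X} (hh : ContinuousOn h s) (hs : MeasurableSet s) {k : Ω → X}
    (hk : AEMeasurable k μ) (hks : ∀ᵐ ω ∂μ, k ω ∈ s) :
    AEStronglyMeasurable (fun ω => h (k ω)) μ := by
  have h1 : AEStronglyMeasurable h ((μ.map k).restrict s) := hh.aestronglyMeasurable hs
  rw [Measure.restrict_eq_self_of_ae_mem ((ae_map_iff hk hs).2 hks)] at h1
  exact h1.comp_aemeasurable hk

end Auxiliary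

/-! ### Integrability along admissible processes -/

namespace ControlProblem

variable {E : Type*} [NormedAddCommGroup E] [NormedSpace ℝ E] {d : ℕ}

/-- The right-hand side of the state equation along a process. -/
def velocity (P : ControlProblem E d) (x u : ℝ → E) (t : ℝ) : E :=
  P.f t (x t) + P.g t (x t) (u t)

/-- A process with integrable control in `U` which satisfies the integrated state equation. -/
structure IsRegular (P : ControlProblem E d) (ξ : E) (x u : ℝ → E) : Prop where
  continuousOn : ContinuousOn x (Icc 0 P.T)
  integrable : IntervalIntegrable u volume 0 P.T
  mem_U : ∀ᵐ t ∂(volume.restrict (Icc 0 P.T)), u t ∈ P.U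
  integrable_velocity : IntervalIntegrable (P.velocity x u) volume 0 P.T
  eq_integral : ∀ t ∈ Icc 0 P.T, x t = ξ + ∫ s in 0..t, P.velocity x u s

variable {P : ControlProblem E d} {r : ℝ} {ξ : E} {x u : ℝ → E}

section Basic

theorem continuousOn_comp_state {Y : Type*} [TopologicalSpace Y] {h : ℝ → E → Y}
    (hh : ContinuousOn (fun p : ℝ × E => h p.1 p.2) (P.I ×ˢ univ)) {y : ℝ → E}
    (hy : ContinuousOn y (Icc 0 P.T)) : ContinuousOn (fun t => h t (y t)) (Icc 0 P.T) :=
  hh.comp (continuousOn_id.prodMk hy) fun _ ht => ⟨ht, mem_univ _⟩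

theorem BasicHypothesis.integrable_velocity (hP : P.BasicHypothesis r ξ) {y v : ℝ → E}
    (hy : ContinuousOn y (Icc 0 P.T)) (hv : IntervalIntegrable v volume 0 P.T) :
    IntervalIntegrable (P.velocity y v) volume 0 P.T := by
  have h1 : ContinuousOn (fun t => P.f t (y t)) (Icc 0 P.T) :=
    continuousOn_comp_state hP.continuousOn_f hy
  rw [← uIcc_of_le P.T_pos.le] at h1
  exact h1.intervalIntegrable.add (intervalIntegrable_clm_apply_of_continuousOn P.T_pos.le
    (continuousOn_comp_state hP.continuousOn_g hy) hv)

/-- Finite deterministic costs imply integrability of the control. -/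
theorem BasicHypothesis.integrable_control (hP : P.BasicHypothesis r ξ) {y v : ℝ → E}
    (hy : ContinuousOn y (Icc 0 P.T))
    (hv : AEStronglyMeasurable v (volume.restrict (Icc 0 P.T)))
    (hvU : ∀ᵐ t ∂(volume.restrict (Icc 0 P.T)), v t ∈ P.U)
    (hφ : IntegrableOn (fun t => P.φ t (y t) (v t)) (Icc 0 P.T)) :
    IntervalIntegrable v volume 0 P.T := by
  obtain ⟨κ, α, δ, β, γ, -, -, hδ, -, -, -, ⟨C, hC, hcoer⟩, -⟩ := hP.growth
  obtain ⟨B, hB⟩ := isCompact_Icc.exists_bound_of_continuousOn hy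
  rw [intervalIntegrable_iff_integrableOn_Icc_of_le P.T_pos.le]
  have hdom : IntegrableOn (fun t => C⁻¹ * P.φ t (y t) (v t) + (B ^ δ + 1)) (Icc 0 P.T) :=
    (hφ.const_mul _).add (integrableOn_const (by simp))
  refine Integrable.mono' hdom hv ?_
  filter_upwards [hvU, ae_restrict_mem measurableSet_Icc] with t htU ht
  have h1 := hcoer t ht (y t) (v t) htU
  have h2 : ‖y t‖ ^ δ ≤ B ^ δ := Real.rpow_le_rpow (norm_nonneg _) (hB t ht) hδ.le
  have h3 : ‖v t‖ ≤ ‖v t‖ ^ r + 1 := by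
    rcases le_total ‖v t‖ 1 with h | h
    · have := Real.rpow_nonneg (norm_nonneg (v t)) r; linarith
    · have := Real.self_le_rpow_of_one_le h hP.one_lt_r.le; linarith
  have h4 : ‖v t‖ ^ r - ‖y t‖ ^ δ ≤ C⁻¹ * P.φ t (y t) (v t) := by
    rw [inv_mul_eq_div, le_div_iff₀ hC]; linarith
  linarith

variable [CompleteSpace E]

/-- Coercivity turns finite costs into an integrable control. Then the right-hand side of the state
equation is integrable, and the absolutely continuous state is its integral. -/
theorem BasicHypothesis.isRegular (hP : P.BasicHypothesis r ξ) (h : P.IsAdmissible ξ x u) :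
    P.IsRegular ξ x u := by
  obtain ⟨⟨⟨hu, hx, hx0, hd⟩, hU⟩, hφ, -⟩ := h
  have hxc : ContinuousOn x (Icc 0 P.T) := by
    have := hx.continuousOn
    rwa [uIcc_of_le P.T_pos.le] at this
  have hui := hP.integrable_control hxc hu hU hφ
  have hv := hP.integrable_velocity hxc hui
  refine ⟨hxc, hui, hU, hv, ?_⟩
  rw [← hx0]
  exact eq_add_integral_of_ae_hasDerivAt P.T_pos.le hx hd hv

end Basic

/-! ### States of perturbed controls -/

section Tube

variable [ProperSpace E]

/-- Bounds for the coefficients of the state equation near a continuous path. -/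
theorem SmoothHypothesis.exists_tube_bound (hP : P.SmoothHypothesis r ξ)
    (hx : ContinuousOn x (Icc 0 P.T)) :
    ∃ D : ℝ, 0 ≤ D ∧ ∀ t ∈ Icc 0 P.T, ∀ y, ‖y - x t‖ ≤ 1 →
      ‖P.g t y‖ ≤ D ∧ ‖fderiv ℝ (P.f t) y‖ ≤ D ∧ ‖fderiv ℝ (P.g t) y‖ ≤ D := by
  obtain ⟨B, hB⟩ := isCompact_Icc.exists_bound_of_continuousOn hx
  have hK : IsCompact (Icc 0 P.T ×ˢ Metric.closedBall (0 : E) (B + 1)) :=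
    isCompact_Icc.prod (isCompact_closedBall _ _)
  have hsub : Icc 0 P.T ×ˢ Metric.closedBall (0 : E) (B + 1) ⊆ P.I ×ˢ univ :=
    prod_mono le_rfl (subset_univ _)
  obtain ⟨D₁, h₁⟩ := hK.exists_bound_of_continuousOn (hP.continuousOn_g.mono hsub)
  obtain ⟨D₂, h₂⟩ := hK.exists_bound_of_continuousOn (hP.continuousOn_D₂f.mono hsub)
  obtain ⟨D₃, h₃⟩ := hK.exists_bound_of_continuousOn
    (f := fun p : ℝ × E => fderiv ℝ (P.g p.1) p.2) (hP.continuousOn_D₂g.mono hsub)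
  refine ⟨max 0 (max D₁ (max D₂ D₃)), le_max_left _ _, fun t ht y hy => ?_⟩
  have hmem : (t, y) ∈ Icc 0 P.T ×ˢ Metric.closedBall (0 : E) (B + 1) := by
    refine ⟨ht, mem_closedBall_zero_iff.2 ?_⟩
    have h1 := norm_sub_norm_le y (x t)
    have h2 := hB t ht
    change ‖y‖ ≤ B + 1
    linarith
  have e1 := h₁ _ hmem
  have e2 := h₂ _ hmem
  have e3 := h₃ _ hmem
  simp only [le_max_iff] at *
  exact ⟨Or.inr (Or.inl e1), Or.inr (Or.inr (Or.inl e2)), Or.inr (Or.inr (Or.inr e3))⟩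

/-- The Lipschitz constant of the state equation near a reference process, for controls between
`u` and `u + k`. -/
def lipschitzBound (D : ℝ) (u k : ℝ → E) (t : ℝ) : ℝ := D * (1 + ‖u t‖ + ‖k t‖)

theorem intervalIntegrable_lipschitzBound (D : ℝ) {u k : ℝ → E} {a b : ℝ}
    (hu : IntervalIntegrable u volume a b) (hk : IntervalIntegrable k volume a b) :
    IntervalIntegrable (lipschitzBound D u k) volume a b :=
  ((intervalIntegrable_const.add hu.norm).add hk.norm).const_mul D

/-- `x + ε z`, where `z` is the integral of `ζ`, solves the state equation for the control
`u + ε k`, with bounds for `z` and `ζ` which do not depend on `ε`. -/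
structure IsPerturbation (P : ControlProblem E d) (x u k : ℝ → E) (C D ε : ℝ) (z ζ : ℝ → E) :
    Prop where
  pos : 0 < ε
  mul_le : ε * C ≤ 1
  continuous : Continuous z
  integrable : IntervalIntegrable ζ volume 0 P.T
  eq_integral : ∀ t ∈ Icc 0 P.T, z t = ∫ s in 0..t, ζ s
  norm_le : ∀ t, ‖z t‖ ≤ C
  norm_deriv_le : ∀ t ∈ Icc 0 P.T, ‖ζ t‖ ≤ (C + 1) * lipschitzBound D u k t
  smul_eq : ∀ t ∈ Icc 0 P.T, ε • ζ t =
    P.velocity (fun t => x t + ε • z t) (fun t => u t + ε • k t) t - P.velocity x u t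

/-- Perturbation of the control in the direction `k`: the perturbed state equation has a solution
`x + ε z`, where `z` is the integral of `ζ` and bounded independently of `ε`. -/
theorem SmoothHypothesis.exists_perturbation (hP : P.SmoothHypothesis r ξ)
    (hxu : P.IsRegular ξ x u) {k : ℝ → E} (hk : IntervalIntegrable k volume 0 P.T) {D : ℝ}
    (hD0 : 0 ≤ D) (hD : ∀ t ∈ Icc 0 P.T, ∀ y, ‖y - x t‖ ≤ 1 →
      ‖P.g t y‖ ≤ D ∧ ‖fderiv ℝ (P.f t) y‖ ≤ D ∧ ‖fderiv ℝ (P.g t) y‖ ≤ D) :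
    ∃ C : ℝ, 1 ≤ C ∧ ∀ ε : ℝ, 0 < ε → ε * C ≤ 1 → ∃ z ζ : ℝ → E,
      P.IsPerturbation x u k C D ε z ζ := by
  have hT := P.T_pos.le
  set L := lipschitzBound D u k with hLdef
  have hL := intervalIntegrable_lipschitzBound D hxu.integrable hk
  have hL0 : ∀ t ∈ Icc 0 P.T, 0 ≤ L t := fun t _ => mul_nonneg hD0 (by positivity)
  -- This is the growth factor of the integral equation for the deviation `Z = ε z`. At `Z = 0` the
  -- right-hand side is `ε g k`, bounded by `ε L`; hence `‖Z‖ ≤ ε C`, and `ε C ≤ 1` keeps the path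
  -- in the tube where `D` bounds the coefficients.
  set C := Real.exp (2 * ∫ s in 0..P.T, L s) with hC
  have hΛ0 : 0 ≤ ∫ s in 0..P.T, L s := intervalIntegral.integral_nonneg hT hL0
  have hC1 : 1 ≤ C := Real.one_le_exp (by positivity)
  refine ⟨C, hC1, fun ε hε hεC => ?_⟩
  have hε1 : ε ≤ 1 := by nlinarith
  have hcont : ∀ Z : ℝ → E, Continuous Z → IntervalIntegrable
      (P.velocity (fun t => x t + Z t) (fun t => u t + ε • k t)) volume 0 P.T := fun Z hZ =>
    hP.toBasicHypothesis.integrable_velocity (hxu.continuousOn.add hZ.continuousOn)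
      (hxu.integrable.add (hk.smul ε))
  have hunorm : ∀ t, ‖u t + ε • k t‖ ≤ ‖u t‖ + ‖k t‖ := fun t => by
    refine (norm_add_le _ _).trans ?_
    rw [norm_smul, Real.norm_of_nonneg hε.le]
    have := mul_le_of_le_one_left (norm_nonneg (k t)) hε1
    linarith
  have hlip : ∀ t ∈ Icc 0 P.T, ∀ Z Z' : E, ‖Z‖ ≤ 1 → ‖Z'‖ ≤ 1 →
      ‖(P.f t (x t + Z) + P.g t (x t + Z) (u t + ε • k t) - P.velocity x u t) -
        (P.f t (x t + Z') + P.g t (x t + Z') (u t + ε • k t) - P.velocity x u t)‖ ≤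
        L t * ‖Z - Z'‖ := by
    intro t ht Z Z' hZ hZ'
    have hball : ∀ Y ∈ Metric.closedBall (x t) 1, ‖Y - x t‖ ≤ 1 := fun Y hY => by
      rwa [← dist_eq_norm]
    have hm : ∀ Y : E, ‖Y‖ ≤ 1 → x t + Y ∈ Metric.closedBall (x t) 1 := fun Y hY => by
      simpa [Metric.mem_closedBall, dist_eq_norm] using hY
    have h1 := (convex_closedBall (x t) 1).norm_image_sub_le_of_norm_fderiv_le (𝕜 := ℝ)
      (f := P.f t) (C := D) (fun Y _ => (hP.differentiable_f t ht) Y)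
      (fun Y hY => (hD t ht Y (hball Y hY)).2.1) (hm Z' hZ') (hm Z hZ)
    have h2 := (convex_closedBall (x t) 1).norm_image_sub_le_of_norm_fderiv_le (𝕜 := ℝ)
      (f := P.g t) (C := D) (fun Y _ => (hP.differentiable_g t ht) Y)
      (fun Y hY => (hD t ht Y (hball Y hY)).2.2) (hm Z' hZ') (hm Z hZ)
    rw [add_sub_add_left_eq_sub] at h1 h2
    have e : (P.f t (x t + Z) + P.g t (x t + Z) (u t + ε • k t) - P.velocity x u t) -
        (P.f t (x t + Z') + P.g t (x t + Z') (u t + ε • k t) - P.velocity x u t) =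
        (P.f t (x t + Z) - P.f t (x t + Z')) +
          (P.g t (x t + Z) - P.g t (x t + Z')) (u t + ε • k t) := by
      simp only [sub_apply]; abel
    rw [e]
    calc _ ≤ D * ‖Z - Z'‖ + (D * ‖Z - Z'‖) * (‖u t‖ + ‖k t‖) := by
          refine (norm_add_le _ _).trans (add_le_add h1 ?_)
          exact (ContinuousLinearMap.le_opNorm _ _).trans
            (mul_le_mul h2 (hunorm t) (norm_nonneg _) (by positivity))
      _ = L t * ‖Z - Z'‖ := by simp only [hLdef, lipschitzBound]; ring
  have hzero : ∀ t ∈ Icc 0 P.T,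
      ‖P.f t (x t + 0) + P.g t (x t + 0) (u t + ε • k t) - P.velocity x u t‖ ≤ ε * L t := by
    intro t ht
    have hg := (hD t ht (x t) (by simp)).1
    have e : P.f t (x t + 0) + P.g t (x t + 0) (u t + ε • k t) - P.velocity x u t =
        ε • P.g t (x t) (k t) := by
      simp only [velocity, add_zero, map_add, map_smul]; abel
    rw [e, norm_smul, Real.norm_of_nonneg hε.le]
    refine mul_le_mul_of_nonneg_left (((P.g t (x t)).le_opNorm _).trans ?_) hε.le
    exact mul_le_mul hg (by linarith [norm_nonneg (u t)]) (norm_nonneg _) hD0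
  obtain ⟨Z, hZc, hZi, hZ, hZb⟩ := exists_eq_integral
    (G := fun t Z => P.f t (x t + Z) + P.g t (x t + Z) (u t + ε • k t) - P.velocity x u t)
    (L := L) (R := 1) hT hε.le hL hL0 hεC
    (fun Z hZ _ => by
      have := (hcont Z hZ).sub hxu.integrable_velocity
      rw [intervalIntegrable_iff_integrableOn_Icc_of_le hT] at this
      exact this.aestronglyMeasurable)
    hlip hzero
  have hεz : ∀ t, ε • ε⁻¹ • Z t = Z t := fun t => by rw [smul_smul, mul_inv_cancel₀ hε.ne', one_smul]
  refine ⟨fun t => ε⁻¹ • Z t, fun t => ε⁻¹ • (P.f t (x t + Z t) +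
    P.g t (x t + Z t) (u t + ε • k t) - P.velocity x u t), hε, hεC, by fun_prop, hZi.smul ε⁻¹,
    fun t ht => ?_, fun t => ?_, fun t ht => ?_, fun t ht => ?_⟩
  · rw [intervalIntegral.integral_smul, ← hZ t ht]
  · rw [norm_smul, norm_inv, Real.norm_of_nonneg hε.le, inv_mul_le_iff₀ hε]
    exact hZb t
  · have hZ1 : ‖Z t‖ ≤ 1 := (hZb t).trans hεC
    have h1 := hlip t ht (Z t) 0 hZ1 (by simp)
    have h2 := hzero t ht
    have h3 := norm_sub_norm_le
      (P.f t (x t + Z t) + P.g t (x t + Z t) (u t + ε • k t) - P.velocity x u t)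
      (P.f t (x t + 0) + P.g t (x t + 0) (u t + ε • k t) - P.velocity x u t)
    rw [norm_smul, norm_inv, Real.norm_of_nonneg hε.le, inv_mul_le_iff₀ hε]
    rw [sub_zero] at h1
    have h4 := mul_le_mul_of_nonneg_left (hZb t) (hL0 t ht)
    nlinarith
  · simp only [velocity, hεz]
    rw [smul_smul, mul_inv_cancel₀ hε.ne', one_smul]

end Tube

/-! ### Integrable bounds for the deterministic costs -/

section Costs

/-- Pointwise form of Gronwall's bound for the deterministic costs near the reference state. -/
theorem exists_gronwallBound_eq (K : ℝ) (hK : 0 ≤ K) :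
    ∃ a b : ℝ, 0 ≤ a ∧ 0 ≤ b ∧ ∀ δ ε, gronwallBound δ K ε 1 = a * δ + b * ε := by
  rcases hK.eq_or_lt with rfl | h
  · exact ⟨1, 1, zero_le_one, zero_le_one, fun δ ε => by simp [gronwallBound_K0]⟩
  · refine ⟨Real.exp K, (Real.exp K - 1) / K, (Real.exp_pos _).le,
      div_nonneg (by linarith [Real.add_one_le_exp K]) hK, fun δ ε => ?_⟩
    rw [gronwallBound_of_K_ne_0 h.ne']
    simp only [mul_one]; ring

/-- The hypothesis bounds `D₂φ` at a point by `φ` at the same point. Gronwall's lemma along the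
segment from `x t` to `y` turns this into a bound by `|φ(t, x(t), u(t))|` and `b(t)`, which are
integrable and do not depend on `y`. -/
theorem SmoothHypothesis.exists_dominating (hP : P.SmoothHypothesis r ξ)
    (h : P.IsAdmissible ξ x u) :
    ∃ (R : ℝ) (Θ : ℝ → ℝ), 0 < R ∧ IntegrableOn Θ (Icc 0 P.T) ∧
      ∀ᵐ t ∂(volume.restrict (Icc 0 P.T)), ∀ y, ‖y - x t‖ ≤ R →
        |P.φ t y (u t)| ≤ Θ t ∧ ‖fderiv ℝ (fun z => P.φ t z (u t)) y‖ ≤ Θ t := by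
  obtain ⟨R, c, b, hR, hc, hb0, hbi, hbd⟩ := hP.bound_D₂φ
  obtain ⟨a₁, a₂, ha₁, ha₂, hg⟩ := exists_gronwallBound_eq (c * R) (by positivity)
  have hφ := h.2.1
  -- The bracket bounds `|φ|` on the ball; as `‖D₂φ‖ ≤ c |φ| + b`, the factor `1 + c` and the
  -- summand `b` serve both bounds.
  refine ⟨R, fun t => (1 + c) * (a₁ * |P.φ t (x t) (u t)| + a₂ * (b t * R)) + b t, hR, ?_, ?_⟩
  · exact (((hφ.abs.const_mul a₁).add ((hbi.mul_const R).const_mul a₂)).const_mul (1 + c)).add hbi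
  filter_upwards [hbd x u h, h.1.2, ae_restrict_mem measurableSet_Icc] with t hbt htU ht y hy
  have hb := hb0 t ht
  have key : |P.φ t y (u t)| ≤ a₁ * |P.φ t (x t) (u t)| + a₂ * (b t * R) := by
    have hdiff := hP.differentiable_φ t ht (u t) htU
    have hline : ∀ s : ℝ, HasDerivAt (fun s : ℝ => P.φ t (x t + s • (y - x t)) (u t))
        (fderiv ℝ (fun z => P.φ t z (u t)) (x t + s • (y - x t)) (y - x t)) s := fun s => by
      have h1 : HasDerivAt (fun s : ℝ => x t + s • (y - x t)) (y - x t) s := by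
        simpa using ((hasDerivAt_id s).smul_const (y - x t)).const_add (x t)
      exact ((hdiff (x t + s • (y - x t))).hasFDerivAt.comp_hasDerivAt s h1)
    have := norm_le_gronwallBound_of_norm_deriv_right_le
      (f := fun s : ℝ => P.φ t (x t + s • (y - x t)) (u t))
      (f' := fun s => fderiv ℝ (fun z => P.φ t z (u t)) (x t + s • (y - x t)) (y - x t))
      (δ := |P.φ t (x t) (u t)|) (K := c * R) (ε := b t * R) (a := 0) (b := 1)
      (fun s _ => (hline s).continuousAt.continuousWithinAt)
      (fun s _ => (hline s).hasDerivWithinAt) (by simp) (fun s hs => ?_) 1 (by simp)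
    · simpa [hg] using this
    · have hs1 : ‖x t + s • (y - x t) - x t‖ ≤ R := by
        rw [add_sub_cancel_left, norm_smul, Real.norm_of_nonneg hs.1]
        exact (mul_le_of_le_one_left (norm_nonneg _) hs.2.le).trans hy
      have h2 := hbt _ hs1
      calc _ ≤ ‖fderiv ℝ (fun z => P.φ t z (u t)) (x t + s • (y - x t))‖ * ‖y - x t‖ :=
            ContinuousLinearMap.le_opNorm _ _
        _ ≤ (c * |P.φ t (x t + s • (y - x t)) (u t)| + b t) * R := by gcongr
        _ = c * R * ‖P.φ t (x t + s • (y - x t)) (u t)‖ + b t * R := by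
            rw [Real.norm_eq_abs]; ring
  have h2 := hbt y hy
  have h0 : 0 ≤ a₁ * |P.φ t (x t) (u t)| + a₂ * (b t * R) := by positivity
  have h3 := mul_le_mul_of_nonneg_left key hc
  constructor
  · nlinarith [mul_nonneg hc h0]
  · linarith

variable [MeasurableSpace E] [BorelSpace E] [SecondCountableTopology E]

theorem aestronglyMeasurable_comp_process {Y : Type*} [TopologicalSpace Y]
    [TopologicalSpace.PseudoMetrizableSpace Y] {h : ℝ → E → E → Y}
    (hh : ContinuousOn (fun p : ℝ × E × E => h p.1 p.2.1 p.2.2) (P.I ×ˢ (univ ×ˢ P.U)))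
    (hUc : IsClosed P.U) {y v : ℝ → E} (hy : ContinuousOn y (Icc 0 P.T))
    (hv : AEStronglyMeasurable v (volume.restrict (Icc 0 P.T)))
    (hvU : ∀ᵐ t ∂(volume.restrict (Icc 0 P.T)), v t ∈ P.U) :
    AEStronglyMeasurable (fun t => h t (y t) (v t)) (volume.restrict (Icc 0 P.T)) := by
  refine aestronglyMeasurable_comp_of_continuousOn (k := fun t => (t, y t, v t)) hh
    ((measurableSet_Icc).prod (MeasurableSet.univ.prod hUc.measurableSet)) ?_ ?_
  · exact aemeasurable_id.prodMk
      ((hy.aestronglyMeasurable measurableSet_Icc).aemeasurable.prodMk hv.aemeasurable)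
  · filter_upwards [hvU, ae_restrict_mem measurableSet_Icc] with t htU ht
    exact ⟨ht, mem_univ _, htU⟩

end Costs

/-! ### Clocks, and the Hölder control of integrands along paths -/

section Observation

/-- The control function `t + ∫₀ᵗ m`. -/
def clock (m : ℝ → ℝ) (t : ℝ) : ℝ := t + ∫ s in 0..t, m s

variable {m : ℝ → ℝ} {T : ℝ}

theorem clock_sub (hT : 0 ≤ T) (hm : IntervalIntegrable m volume 0 T) {s t : ℝ}
    (hs : s ∈ Icc 0 T) (ht : t ∈ Icc 0 T) : clock m t - clock m s = (t - s) + ∫ r in s..t, m r := by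
  rw [clock, clock, add_sub_add_comm, integral_sub_integral hm hT hs ht]

theorem integral_nonneg_of_mem {s t : ℝ} (hm0 : ∀ t ∈ Icc 0 T, 0 ≤ m t) (hs : s ∈ Icc 0 T)
    (ht : t ∈ Icc 0 T) (hst : s ≤ t) : 0 ≤ ∫ r in s..t, m r :=
  intervalIntegral.integral_nonneg hst fun r hr => hm0 r ⟨hs.1.trans hr.1, hr.2.trans ht.2⟩

theorem monotoneOn_clock (hT : 0 ≤ T) (hm : IntervalIntegrable m volume 0 T)
    (hm0 : ∀ t ∈ Icc 0 T, 0 ≤ m t) : MonotoneOn (clock m) (Icc 0 T) := by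
  intro s hs t ht hst
  have h1 := clock_sub hT hm hs ht
  have h2 := integral_nonneg_of_mem hm0 hs ht hst
  linarith

theorem continuousOn_clock (hT : 0 ≤ T) (hm : IntervalIntegrable m volume 0 T) :
    ContinuousOn (clock m) (Icc 0 T) :=
  continuousOn_id.add (continuousOn_integral hT hm)

theorem sub_le_clock_sub (hT : 0 ≤ T) (hm : IntervalIntegrable m volume 0 T)
    (hm0 : ∀ t ∈ Icc 0 T, 0 ≤ m t) {s t : ℝ} (hs : s ∈ Icc 0 T) (ht : t ∈ Icc 0 T) (hst : s ≤ t) :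
    |t - s| ≤ clock m t - clock m s := by
  have h1 := clock_sub hT hm hs ht
  have h2 := integral_nonneg_of_mem hm0 hs ht hst
  rw [abs_of_nonneg (by linarith)]; linarith

theorem norm_sub_le_clock_sub (hT : 0 ≤ T) (hm : IntervalIntegrable m volume 0 T) {y F : ℝ → E}
    {c : E} (hF : IntervalIntegrable F volume 0 T) (hFm : ∀ t ∈ Icc 0 T, ‖F t‖ ≤ m t)
    (hy : ∀ t ∈ Icc 0 T, y t = c + ∫ s in 0..t, F s) {s t : ℝ} (hs : s ∈ Icc 0 T)
    (ht : t ∈ Icc 0 T) (hst : s ≤ t) : ‖y t - y s‖ ≤ clock m t - clock m s := by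
  rw [hy t ht, hy s hs, add_sub_add_left_eq_sub, integral_sub_integral hF hT hs ht,
    clock_sub hT hm hs ht]
  have := intervalIntegral.norm_integral_le_of_norm_le hst (ae_of_all _ fun r hr =>
    hFm r ⟨hs.1.trans hr.1.le, hr.2.trans ht.2⟩) (intervalIntegrable_sub hm hT hs ht)
  linarith

/-- Along a path controlled by a clock, the stochastic running costs are controlled as well. -/
theorem BasicHypothesis.exists_controlledBy (hP : P.BasicHypothesis r ξ) (B : ℝ) :
    ∃ κ M : ℝ, 1 / 2 < κ ∧ 0 ≤ M ∧ ∀ (V : ℝ → ℝ) (y : ℝ → E), (∀ t ∈ Icc 0 P.T, ‖y t‖ ≤ B) →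
      (∀ s ∈ Icc 0 P.T, ∀ t ∈ Icc 0 P.T, s ≤ t → |t - s| ≤ V t - V s ∧ ‖y t - y s‖ ≤ V t - V s) →
      ControlledBy 0 P.T κ M V (fun t => P.ψ t (y t)) := by
  obtain ⟨κ, α, δ, β, γ, hκ, -, -, -, -, ⟨K, C, -, hK⟩, -⟩ := hP.growth
  obtain ⟨hH, -⟩ := hK (max B 0) (le_max_right _ _)
  refine ⟨κ, K (max B 0), hκ, NNReal.coe_nonneg _, fun V y hy hV s hs t ht hst => ?_⟩
  have hmem : ∀ t ∈ Icc 0 P.T, (t, y t) ∈ P.I ×ˢ Metric.closedBall (0 : E) (max B 0) :=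
    fun t ht => ⟨ht, mem_closedBall_zero_iff.2 ((hy t ht).trans (le_max_left _ _))⟩
  have h1 := hH.dist_le (hmem t ht) (hmem s hs)
  rw [dist_eq_norm] at h1
  refine h1.trans (mul_le_mul_of_nonneg_left ?_ (NNReal.coe_nonneg _))
  refine Real.rpow_le_rpow dist_nonneg ?_ (NNReal.coe_nonneg _)
  obtain ⟨e1, e2⟩ := hV s hs t ht hst
  rw [Prod.dist_eq, Real.dist_eq, dist_eq_norm]
  exact max_le e1 e2

variable [ProperSpace E]

/-- Along paths controlled by a clock, `D₂ψ z` and the difference quotients of `ψ` are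
controlled, with a uniform constant. -/
theorem SmoothHypothesis.exists_controlledBy_derivative (hP : P.SmoothHypothesis r ξ) (B : ℝ)
    {V : ℝ → ℝ} (hV : MonotoneOn V (Icc 0 P.T)) :
    ∃ κ A : ℝ, 1 / 2 < κ ∧ 0 ≤ A ∧
      (∀ y : ℝ → E, (∀ t ∈ Icc 0 P.T, ‖y t‖ ≤ B) → (∀ s ∈ Icc 0 P.T, ∀ t ∈ Icc 0 P.T, s ≤ t →
        |t - s| ≤ V t - V s ∧ ‖y t - y s‖ ≤ V t - V s) →
        ControlledBy 0 P.T κ A V (fun t => fderiv ℝ (P.ψ t) (y t)) ∧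
        ∀ t ∈ Icc 0 P.T, ‖fderiv ℝ (P.ψ t) (y t)‖ ≤ A) ∧
      ∀ C : ℝ, 0 ≤ C → ∃ M : ℝ, 0 ≤ M ∧ ∀ y z : ℝ → E, (∀ t ∈ Icc 0 P.T, ‖y t‖ ≤ B) →
        (∀ s ∈ Icc 0 P.T, ∀ t ∈ Icc 0 P.T, s ≤ t →
          |t - s| ≤ V t - V s ∧ ‖y t - y s‖ ≤ V t - V s ∧ ‖z t - z s‖ ≤ V t - V s) →
        (∀ t ∈ Icc 0 P.T, ‖z t‖ ≤ C) →
        ControlledBy 0 P.T κ M V (fun t => fderiv ℝ (P.ψ t) (y t) (z t)) := by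
  have hT := P.T_pos.le
  have hK : IsCompact (Icc 0 P.T ×ˢ Metric.closedBall (0 : E) B) :=
    isCompact_Icc.prod (isCompact_closedBall _ _)
  obtain ⟨κ, A, B', hκ, hκ1, hA, hB', hbd, hH⟩ := exists_holder_of_isCompact hK
    (prod_mono le_rfl (subset_univ _)) hP.holder_D₂ψ
  have hmem : ∀ y : ℝ → E, (∀ t ∈ Icc 0 P.T, ‖y t‖ ≤ B) → ∀ t ∈ Icc 0 P.T,
      (t, y t) ∈ Icc 0 P.T ×ˢ Metric.closedBall (0 : E) B :=
    fun y hy t ht => ⟨ht, mem_closedBall_zero_iff.2 (hy t ht)⟩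
  have hctrl : ∀ y : ℝ → E, (∀ t ∈ Icc 0 P.T, ‖y t‖ ≤ B) → (∀ s ∈ Icc 0 P.T, ∀ t ∈ Icc 0 P.T,
      s ≤ t → |t - s| ≤ V t - V s ∧ ‖y t - y s‖ ≤ V t - V s) →
      ControlledBy 0 P.T κ A V (fun t => fderiv ℝ (P.ψ t) (y t)) := by
    intro y hy hyV s hs t ht hst
    refine (hH _ (hmem y hy t ht) _ (hmem y hy s hs)).trans (mul_le_mul_of_nonneg_left ?_ hA)
    refine Real.rpow_le_rpow dist_nonneg ?_ (by linarith)
    obtain ⟨e1, e2⟩ := hyV s hs t ht hst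
    rw [Prod.dist_eq, Real.dist_eq, dist_eq_norm]
    exact max_le e1 e2
  refine ⟨κ, max A B', hκ, hA.trans (le_max_left _ _), fun y hy hyV => ⟨fun s hs t ht hst => ?_,
    fun t ht => (hbd _ (hmem y hy t ht)).trans (le_max_right _ _)⟩, fun C hC => ?_⟩
  · refine (hctrl y hy hyV s hs t ht hst).trans (mul_le_mul_of_nonneg_right (le_max_left _ _) ?_)
    exact Real.rpow_nonneg (sub_nonneg.2 (hV hs ht hst)) _
  set v := V P.T - V 0 with hv
  have h0 : (0 : ℝ) ∈ Icc 0 P.T := left_mem_Icc.2 hT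
  have hT' : P.T ∈ Icc 0 P.T := right_mem_Icc.2 hT
  have hv0 : 0 ≤ v := sub_nonneg.2 (hV h0 hT' hT)
  refine ⟨A * C + B' * v ^ (1 - κ), by positivity, fun y z hy hyz hz s hs t ht hst => ?_⟩
  have hΔ : 0 ≤ V t - V s := sub_nonneg.2 (hV hs ht hst)
  have hΔv : V t - V s ≤ v := by
    have e1 := hV h0 hs hs.1
    have e2 := hV ht hT' ht.2
    linarith
  have h1 := hctrl y hy (fun s hs t ht hst => ⟨(hyz s hs t ht hst).1, (hyz s hs t ht hst).2.1⟩)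
    s hs t ht hst
  have h2 := (hyz s hs t ht hst).2.2
  -- The path `z` is Lipschitz with respect to `V`; since `κ ≤ 1` and `V` has bounded range, this is
  -- also a bound with exponent `κ`.
  have h3 : V t - V s ≤ v ^ (1 - κ) * (V t - V s) ^ κ := by
    calc V t - V s = (V t - V s) ^ ((1 - κ) + κ) := by simp
      _ = (V t - V s) ^ (1 - κ) * (V t - V s) ^ κ :=
          Real.rpow_add_of_nonneg hΔ (by linarith) (by linarith)
      _ ≤ _ := by
          have : 0 ≤ 1 - κ := by linarith
          gcongr
  have h4 := hbd _ (hmem y hy s hs)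
  have e : fderiv ℝ (P.ψ t) (y t) (z t) - fderiv ℝ (P.ψ s) (y s) (z s) =
      (fderiv ℝ (P.ψ t) (y t) - fderiv ℝ (P.ψ s) (y s)) (z t) +
        fderiv ℝ (P.ψ s) (y s) (z t - z s) := by
    simp only [sub_apply, map_sub]; abel
  rw [e]
  calc _ ≤ ‖fderiv ℝ (P.ψ t) (y t) - fderiv ℝ (P.ψ s) (y s)‖ * ‖z t‖ +
        ‖fderiv ℝ (P.ψ s) (y s)‖ * ‖z t - z s‖ :=
      (norm_add_le _ _).trans (add_le_add (ContinuousLinearMap.le_opNorm _ _)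
        (ContinuousLinearMap.le_opNorm _ _))
    _ ≤ (A * (V t - V s) ^ κ) * C + B' * (v ^ (1 - κ) * (V t - V s) ^ κ) := by
        refine add_le_add (mul_le_mul h1 (hz t ht) (norm_nonneg _) ?_)
          (mul_le_mul h4 (h2.trans h3) (norm_nonneg _) hB')
        exact mul_nonneg hA (Real.rpow_nonneg hΔ _)
    _ = _ := by ring

/-- A uniform bound for difference quotients, from the bound for the derivatives. -/
theorem controlledBy_differenceQuotient (hψ : ∀ t ∈ Icc 0 P.T, Differentiable ℝ (P.ψ t))
    {V : ℝ → ℝ} {κ M ε : ℝ} (hε : 0 < ε) {y z : ℝ → E}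
    (h : ∀ σ ∈ Icc (0 : ℝ) 1, ControlledBy 0 P.T κ M V
      (fun t => fderiv ℝ (P.ψ t) (y t + σ • ε • z t) (z t))) :
    ControlledBy 0 P.T κ M V
      (fun t => ε⁻¹ • (P.ψ t (y t + ε • z t) - P.ψ t (y t))) := by
  intro s hs t ht hst
  have hline : ∀ t ∈ Icc 0 P.T, ∀ σ : ℝ,
      HasDerivAt (fun σ : ℝ => ε⁻¹ • P.ψ t (y t + σ • ε • z t))
        (fderiv ℝ (P.ψ t) (y t + σ • ε • z t) (z t)) σ := by
    intro t ht σ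
    have h1 : HasDerivAt (fun σ : ℝ => y t + σ • ε • z t) (ε • z t) σ := by
      simpa using ((hasDerivAt_id σ).smul_const (ε • z t)).const_add (y t)
    have h2 := ((hψ t ht (y t + σ • ε • z t)).hasFDerivAt.comp_hasDerivAt σ h1).const_smul ε⁻¹
    rwa [map_smul, smul_smul, inv_mul_cancel₀ hε.ne', one_smul] at h2
  -- The mean value inequality in `σ` is applied to the difference between the times `t` and `s`.
  -- Its derivative in `σ` is an increment in time of `D₂ψ z`, so no second derivative of `ψ` is
  -- needed.
  have := norm_image_sub_le_of_norm_deriv_le_segment_01'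
    (f := fun σ : ℝ => ε⁻¹ • P.ψ t (y t + σ • ε • z t) - ε⁻¹ • P.ψ s (y s + σ • ε • z s))
    (C := M * (V t - V s) ^ κ)
    (fun σ _ => ((hline t ht σ).sub (hline s hs σ)).hasDerivWithinAt)
    (fun σ hσ => h σ ⟨hσ.1, hσ.2.le⟩ s hs t ht hst)
  simp only [one_smul, zero_smul, add_zero] at this
  refine le_trans (le_of_eq ?_) this
  congr 1
  simp only [smul_sub]
  abel

end Observation


variable {E : Type*} [NormedAddCommGroup E] [NormedSpace ℝ E] [FiniteDimensional ℝ E] {d : ℕ}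
  {P : ControlProblem E d} {r : ℝ} {ξ : E} {x u : ℝ → E} {η : ℝ → EuclideanSpace ℝ (Fin d)}

/-! ### The costate equation -/

section Costate

theorem SmoothHypothesis.integrable_linearisation (hP : P.SmoothHypothesis r ξ)
    (hxu : P.IsRegular ξ x u) : IntervalIntegrable (P.linearisation x u) volume 0 P.T := by
  have h1 : ContinuousOn (fun t => fderiv ℝ (P.f t) (x t)) (Icc 0 P.T) :=
    continuousOn_comp_state hP.continuousOn_D₂f hxu.continuousOn
  have h2 : ContinuousOn (fun t => (fderiv ℝ (P.g t) (x t)).flip) (Icc 0 P.T) :=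
    (ContinuousLinearMap.flipₗᵢ ℝ E E E).continuous.comp_continuousOn
      (continuousOn_comp_state hP.continuousOn_D₂g hxu.continuousOn)
  rw [← uIcc_of_le P.T_pos.le] at h1
  exact h1.intervalIntegrable.add
    (intervalIntegrable_clm_apply_of_continuousOn P.T_pos.le h2 hxu.integrable)

theorem SmoothHypothesis.integrable_fderiv_cost (hP : P.SmoothHypothesis r ξ)
    (h : P.IsAdmissible ξ x u) :
    IntervalIntegrable (fun s => fderiv ℝ (fun z => P.φ s z (u s)) (x s)) volume 0 P.T := by
  have : ProperSpace E := FiniteDimensional.proper_real E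
  borelize E
  have hxu := hP.toBasicHypothesis.isRegular h
  obtain ⟨R, Θ, hR, hΘ, hb⟩ := hP.exists_dominating h
  rw [intervalIntegrable_iff_integrableOn_Icc_of_le P.T_pos.le]
  refine Integrable.mono' hΘ (aestronglyMeasurable_comp_process
    (h := fun t y v => fderiv ℝ (fun z => P.φ t z v) y) hP.continuousOn_D₂φ hP.isClosed_U
    hxu.continuousOn h.1.1.1 h.1.2) ?_
  filter_upwards [hb] with t ht
  exact (ht (x t) (by simpa using hR.le)).2

/-- Existence of the costate, together with a primitive of its irregular part. -/
theorem SmoothHypothesis.exists_costate (hP : P.SmoothHypothesis r ξ)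
    (hη : IsObservationPath P.T η) (h : P.IsAdmissible ξ x u) :
    ∃ (lam J : ℝ → E →L[ℝ] ℝ) (Z : ℝ → ℝ), P.IsCostate η x u lam ∧
      ContinuousOn lam (Icc 0 P.T) ∧ MonotoneOn Z (Icc 0 P.T) ∧
      IsYoungPrimitive 0 P.T Z (fun s => (fderiv ℝ (P.ψ s) (x s)).flip) η J ∧
      ∀ t ∈ Icc 0 P.T, lam t = (∫ s in t..P.T, ((lam s).comp (P.linearisation x u s) +
        fderiv ℝ (fun z => P.φ s z (u s)) (x s))) + (J P.T - J t) := by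
  have : ProperSpace E := FiniteDimensional.proper_real E
  have : ProperSpace (E →L[ℝ] ℝ) := FiniteDimensional.proper_real _
  have hT := P.T_pos.le
  have hT' : P.T ∈ Icc 0 P.T := right_mem_Icc.2 hT
  have hxu := hP.toBasicHypothesis.isRegular h
  have hm := hxu.integrable_velocity.norm
  have hm0 : ∀ t ∈ Icc 0 P.T, 0 ≤ ‖P.velocity x u t‖ := fun _ _ => norm_nonneg _
  have hVm := monotoneOn_clock hT hm hm0
  have hVc := continuousOn_clock hT hm
  obtain ⟨B, hB⟩ := isCompact_Icc.exists_bound_of_continuousOn hxu.continuousOn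
  obtain ⟨κ, A, hκ, hA, hD, -⟩ := hP.exists_controlledBy_derivative B hVm
  obtain ⟨hDc, hDb⟩ := hD x hB fun s hs t ht hst => ⟨sub_le_clock_sub hT hm hm0 hs ht hst,
    norm_sub_le_clock_sub hT hm hxu.integrable_velocity (fun _ _ => le_rfl) hxu.eq_integral
      hs ht hst⟩
  obtain ⟨q, Z, hZ⟩ := hη.exists_youngControl hT hκ hVm hVc
  -- `D₂ψ` takes the state direction first, whereas the integrand must act on increments of `η`;
  -- exchanging the arguments preserves norms.
  have hflip : ControlledBy 0 P.T κ A (clock fun t => ‖P.velocity x u t‖)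
      (fun s => (fderiv ℝ (P.ψ s) (x s)).flip) := by
    intro s hs t ht hst
    refine le_trans (le_of_eq ?_) (hDc s hs t ht hst)
    rw [← ContinuousLinearMap.opNorm_flip]
    rfl
  obtain ⟨J, hJ⟩ := hZ.exists_isYoungPrimitive hA hflip
  have hJc : ContinuousOn J (Icc 0 P.T) := hJ.continuousOn hT hZ.mono_Z hη.1 (B := A)
    fun t ht => by rw [ContinuousLinearMap.opNorm_flip]; exact hDb t ht
  have hφ := hP.integrable_fderiv_cost h
  have hlin := hP.integrable_linearisation hxu
  set b : ℝ → E →L[ℝ] ℝ := fun s => fderiv ℝ (fun z => P.φ s z (u s)) (x s) with hb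
  have hbc : ContinuousOn (fun t => ∫ s in t..P.T, b s) (Icc 0 P.T) :=
    (continuousOn_const.sub (continuousOn_integral hT hφ)).congr fun t ht =>
      (integral_sub_integral hφ hT ht hT').symm
  -- The cost and observation terms together form a continuous inhomogeneity, so the equation
  -- becomes an ordinary linear backward equation.
  obtain ⟨lam, hlamc, hlam⟩ := exists_backward_solution hT hlin
    (hbc.add ((continuousOn_const (c := J P.T)).sub hJc))
  have hli := intervalIntegrable_clm_comp hT hlamc hlin
  refine ⟨lam, J, Z, ⟨?_, ?_, fun t ht => ⟨J P.T - J t, fun z => ?_, ?_⟩⟩, hlamc, hZ.mono_Z, hJ,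
    fun t ht => ?_⟩
  · exact (intervalIntegrable_iff_integrableOn_Icc_of_le hT).1 hli
  · exact (intervalIntegrable_iff_integrableOn_Icc_of_le hT).1 hφ
  · exact (hJ.isYoungIntegral hZ.mono_Z ht.1 ht.2 le_rfl).clm_comp
      (ContinuousLinearMap.apply ℝ ℝ z)
  · rw [hlam t ht, add_assoc]; rfl
  · rw [intervalIntegral.integral_add (intervalIntegrable_sub hli hT ht hT')
      (intervalIntegrable_sub hφ hT ht hT'), hlam t ht, add_assoc]
    rfl

/-- The costate equation has at most one solution. -/
theorem IsCostate.unique {lam mu : ℝ → E →L[ℝ] ℝ}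
    (hA : IntervalIntegrable (P.linearisation x u) volume 0 P.T) (hlam : P.IsCostate η x u lam)
    (hmu : P.IsCostate η x u mu) : ∀ t ∈ Icc 0 P.T, mu t = lam t := by
  have hT := P.T_pos.le
  have hT' : P.T ∈ Icc 0 P.T := right_mem_Icc.2 hT
  have hli : IntervalIntegrable (fun s => (lam s).comp (P.linearisation x u s)) volume 0 P.T := by
    rw [intervalIntegrable_iff_integrableOn_Icc_of_le hT]; exact hlam.1
  have hmi : IntervalIntegrable (fun s => (mu s).comp (P.linearisation x u s)) volume 0 P.T := by
    rw [intervalIntegrable_iff_integrableOn_Icc_of_le hT]; exact hmu.1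
  have hcomp : (fun s => (mu s - lam s).comp (P.linearisation x u s)) =
      fun s => (mu s).comp (P.linearisation x u s) - (lam s).comp (P.linearisation x u s) := by
    funext s; ext v; simp
  have key := eq_zero_of_backward (ν := fun t => mu t - lam t) hT hA
    (by rw [hcomp]; exact hmi.sub hli) (fun t ht => by
      obtain ⟨J, hJ, e⟩ := hlam.2.2 t ht
      obtain ⟨J', hJ', e'⟩ := hmu.2.2 t ht
      -- Young integrals are unique, so the irregular terms cancel and the difference solves the
      -- homogeneous equation.
      have hJJ : J' = J := ContinuousLinearMap.ext fun z => (hJ' z).unique ht.2 (hJ z)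
      rw [hcomp, intervalIntegral.integral_sub (intervalIntegrable_sub hmi hT ht hT')
        (intervalIntegrable_sub hli hT ht hT'), e, e', hJJ]
      abel)
  exact fun t ht => sub_eq_zero.1 (key t ht)

end Costate

/-! ### Variations of the optimal process -/

section Variation

/-- The direction from the control `u` towards the constant control `w` on the set `S`. -/
def towards (u : ℝ → E) (S : Set ℝ) (w : E) : ℝ → E := S.indicator fun t => w - u t

theorem intervalIntegrable_towards (hu : IntervalIntegrable u volume 0 P.T) {S : Set ℝ}
    (hS : MeasurableSet S) (w : E) : IntervalIntegrable (towards u S w) volume 0 P.T := by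
  have := (intervalIntegrable_const (c := w)).sub hu
  rw [intervalIntegrable_iff] at this ⊢
  exact this.indicator hS

theorem add_smul_towards_mem (hU : Convex ℝ P.U) {w : E} (hw : w ∈ P.U) {S : Set ℝ} {t ε : ℝ}
    (ht : u t ∈ P.U) (hε0 : 0 ≤ ε) (hε1 : ε ≤ 1) : u t + ε • towards u S w t ∈ P.U := by
  by_cases hS : t ∈ S
  · rw [towards, indicator_of_mem hS]
    exact hU.add_smul_sub_mem ht hw ⟨hε0, hε1⟩
  · rw [towards, indicator_of_notMem hS, smul_zero, add_zero]
    exact ht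

/-- On `S` the new control lies on the segment from `u t` to `w`, and convexity bounds the cost by
the chord. The switching gain thus enters linearly in `ε`, with no derivative in the control. -/
theorem cost_add_smul_towards_le {t : ℝ} {y : E} (hφ : ConvexOn ℝ P.U (P.φ t y)) {w : E}
    (hw : w ∈ P.U) {S : Set ℝ} {ε : ℝ} (ht : u t ∈ P.U) (hε0 : 0 ≤ ε) (hε1 : ε ≤ 1) :
    P.φ t y (u t + ε • towards u S w t) ≤
      P.φ t y (u t) + ε * S.indicator (fun _ => P.φ t y w - P.φ t y (u t)) t := by
  by_cases hS : t ∈ S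
  · rw [towards, indicator_of_mem hS, indicator_of_mem hS]
    have h := hφ.2 ht hw (sub_nonneg.2 hε1) hε0 (by ring)
    have e : u t + ε • (w - u t) = (1 - ε) • u t + ε • w := by
      rw [smul_sub, sub_smul, one_smul]; abel
    rw [e]
    refine h.trans (le_of_eq ?_)
    simp only [smul_eq_mul]; ring
  · rw [towards, indicator_of_notMem hS, indicator_of_notMem hS]
    simp

theorem integrableOn_cost_const [MeasurableSpace E] [BorelSpace E]
    (hP : P.BasicHypothesis r ξ) {y : ℝ → E} (hy : ContinuousOn y (Icc 0 P.T)) {w : E}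
    (hw : w ∈ P.U) : IntegrableOn (fun t => P.φ t (y t) w) (Icc 0 P.T) := by
  have : ContinuousOn (fun t => P.φ t (y t) w) (Icc 0 P.T) :=
    hP.continuousOn_φ.comp (continuousOn_id.prodMk (hy.prodMk continuousOn_const))
      fun t ht => ⟨ht, mem_univ _, hw⟩
  exact this.integrableOn_Icc

/-- The dominating function belongs to the reference control but serves all states within `R` of
`x`, so the costs stay integrable when only the state is perturbed. -/
theorem integrableOn_cost_near [MeasurableSpace E] [BorelSpace E]
    (hP : P.BasicHypothesis r ξ) (hu : AEStronglyMeasurable u (volume.restrict (Icc 0 P.T)))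
    (huU : ∀ᵐ t ∂(volume.restrict (Icc 0 P.T)), u t ∈ P.U) {R : ℝ} {Θ : ℝ → ℝ}
    (hΘ : IntegrableOn Θ (Icc 0 P.T)) (hdom : ∀ᵐ t ∂(volume.restrict (Icc 0 P.T)), ∀ y,
      ‖y - x t‖ ≤ R → |P.φ t y (u t)| ≤ Θ t ∧ ‖fderiv ℝ (fun z => P.φ t z (u t)) y‖ ≤ Θ t)
    {y : ℝ → E} (hy : ContinuousOn y (Icc 0 P.T)) (hyx : ∀ t ∈ Icc 0 P.T, ‖y t - x t‖ ≤ R) :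
    IntegrableOn (fun t => P.φ t (y t) (u t)) (Icc 0 P.T) := by
  have : ProperSpace E := FiniteDimensional.proper_real E
  refine Integrable.mono' hΘ (aestronglyMeasurable_comp_process (h := P.φ)
    hP.continuousOn_φ hP.isClosed_U hy hu huU) ?_
  filter_upwards [hdom, ae_restrict_mem measurableSet_Icc] with t hd ht
  exact (hd _ (hyx t ht)).1

variable {S : Set ℝ} {w : E} {R C D ε : ℝ} {Θ : ℝ → ℝ} {z ζ k : ℝ → E}

theorem IsPerturbation.norm_smul_le (hz : P.IsPerturbation x u k C D ε z ζ) {σ : ℝ}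
    (hσ : σ ∈ Icc (0 : ℝ) 1) (t : ℝ) : ‖σ • ε • z t‖ ≤ ε * C := by
  rw [norm_smul, norm_smul, Real.norm_of_nonneg hz.pos.le, Real.norm_of_nonneg hσ.1]
  have h1 := mul_le_mul_of_nonneg_left (hz.norm_le t) hz.pos.le
  have h2 : 0 ≤ ε * ‖z t‖ := mul_nonneg hz.pos.le (norm_nonneg _)
  nlinarith [hσ.2]

theorem IsPerturbation.eps_le_one (hz : P.IsPerturbation x u k C D ε z ζ) (hC : 1 ≤ C) : ε ≤ 1 := by
  have := hz.mul_le; have := hz.pos; nlinarith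

/-- The rate of change which dominates a reference process and its perturbations. -/
def perturbationRate (P : ControlProblem E d) (x u k : ℝ → E) (C D t : ℝ) : ℝ :=
  ‖P.velocity x u t‖ + (C + 1) * lipschitzBound D u k t

theorem intervalIntegrable_perturbationRate (hxu : P.IsRegular ξ x u)
    (hk : IntervalIntegrable k volume 0 P.T) (C D : ℝ) :
    IntervalIntegrable (perturbationRate P x u k C D) volume 0 P.T :=
  hxu.integrable_velocity.norm.add
    ((intervalIntegrable_lipschitzBound D hxu.integrable hk).const_mul _)

theorem lipschitzBound_nonneg (hD : 0 ≤ D) (t : ℝ) : 0 ≤ lipschitzBound D u k t :=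
  mul_nonneg hD (by positivity)

theorem perturbationRate_nonneg (hC : 1 ≤ C) (hD : 0 ≤ D) (t : ℝ) :
    0 ≤ perturbationRate P x u k C D t := by
  have := lipschitzBound_nonneg (u := u) (k := k) hD t
  have : 0 ≤ C + 1 := by linarith
  exact add_nonneg (norm_nonneg _) (by positivity)

/-- All paths between the reference state and its perturbation are controlled by a clock. -/
theorem IsPerturbation.norm_sub_le_clock (hz : P.IsPerturbation x u k C D ε z ζ)
    (hxu : P.IsRegular ξ x u) (hk : IntervalIntegrable k volume 0 P.T) (hC : 1 ≤ C) (hD : 0 ≤ D)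
    {σ : ℝ} (hσ : σ ∈ Icc (0 : ℝ) 1) {s t : ℝ} (hs : s ∈ Icc 0 P.T) (ht : t ∈ Icc 0 P.T)
    (hst : s ≤ t) :
    |t - s| ≤ clock (perturbationRate P x u k C D) t - clock (perturbationRate P x u k C D) s ∧
    ‖(x t + σ • ε • z t) - (x s + σ • ε • z s)‖ ≤
      clock (perturbationRate P x u k C D) t - clock (perturbationRate P x u k C D) s ∧
    ‖z t - z s‖ ≤
      clock (perturbationRate P x u k C D) t - clock (perturbationRate P x u k C D) s := by
  have hT := P.T_pos.le
  have hm := intervalIntegrable_perturbationRate hxu hk C D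
  have hm0 : ∀ t ∈ Icc 0 P.T, 0 ≤ perturbationRate P x u k C D t := fun t _ =>
    perturbationRate_nonneg hC hD t
  have hε1 := hz.eps_le_one hC
  refine ⟨sub_le_clock_sub hT hm hm0 hs ht hst, ?_, ?_⟩
  · refine norm_sub_le_clock_sub (c := ξ) (y := fun t => x t + σ • ε • z t)
      (F := fun t => P.velocity x u t + σ • ε • ζ t) hT hm
      (hxu.integrable_velocity.add ((hz.integrable.smul ε).smul σ)) (fun t ht => ?_)
      (fun t ht => ?_) hs ht hst
    · refine (norm_add_le _ _).trans (add_le_add le_rfl ((le_trans ?_ (hz.norm_deriv_le t ht))))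
      rw [norm_smul, norm_smul, Real.norm_of_nonneg hz.pos.le, Real.norm_of_nonneg hσ.1,
        ← mul_assoc]
      exact mul_le_of_le_one_left (norm_nonneg _) (mul_le_one₀ hσ.2 hz.pos.le hε1)
    · have h0 := left_mem_Icc.2 hT
      have hi : IntervalIntegrable (fun s => σ • ε • ζ s) volume 0 P.T :=
        (hz.integrable.smul ε).smul σ
      rw [intervalIntegral.integral_add (intervalIntegrable_sub hxu.integrable_velocity hT h0 ht)
        (intervalIntegrable_sub hi hT h0 ht),
        intervalIntegral.integral_smul, intervalIntegral.integral_smul, ← hz.eq_integral t ht,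
        hxu.eq_integral t ht, add_assoc]
  · refine norm_sub_le_clock_sub (c := 0) hT hm hz.integrable (fun t ht => ?_)
      (fun t ht => by rw [zero_add]; exact hz.eq_integral t ht) hs ht hst
    exact (hz.norm_deriv_le t ht).trans (le_add_of_nonneg_left (norm_nonneg _))

/-- Perturbed processes are admissible. -/
theorem IsPerturbation.isAdmissible [MeasurableSpace E] [BorelSpace E]
    (hP : P.BasicHypothesis r ξ) (hxu : P.IsRegular ξ x u)
    (hu : AEStronglyMeasurable u (volume.restrict (Icc 0 P.T))) (hw : w ∈ P.U)
    (hS : MeasurableSet S) (hC : 1 ≤ C) (hD : 0 ≤ D)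
    (hΘ : IntegrableOn Θ (Icc 0 P.T)) (hdom : ∀ᵐ t ∂(volume.restrict (Icc 0 P.T)), ∀ y,
      ‖y - x t‖ ≤ R → |P.φ t y (u t)| ≤ Θ t ∧ ‖fderiv ℝ (fun z => P.φ t z (u t)) y‖ ≤ Θ t)
    (hz : P.IsPerturbation x u (towards u S w) C D ε z ζ) (hR : ε * C ≤ R) :
    P.IsAdmissible ξ (fun t => x t + ε • z t) (fun t => u t + ε • towards u S w t) := by
  have : ProperSpace E := FiniteDimensional.proper_real E
  have hT := P.T_pos.le
  have hε1 := hz.eps_le_one hC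
  have hk := intervalIntegrable_towards hxu.integrable hS w
  have hyc : ContinuousOn (fun t => x t + ε • z t) (Icc 0 P.T) :=
    hxu.continuousOn.add (hz.continuous.const_smul ε).continuousOn
  have hv : IntervalIntegrable (fun t => u t + ε • towards u S w t) volume 0 P.T :=
    hxu.integrable.add (hk.smul ε)
  have hvm := ((intervalIntegrable_iff_integrableOn_Icc_of_le hT).1 hv).aestronglyMeasurable
  have hvU : ∀ᵐ t ∂(volume.restrict (Icc 0 P.T)), u t + ε • towards u S w t ∈ P.U := by
    filter_upwards [hxu.mem_U] with t ht
    exact add_smul_towards_mem hP.convex_U hw ht hz.pos.le hε1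
  have hvel := hP.integrable_velocity hyc hv
  have hone : (1 : ℝ) ∈ Icc (0 : ℝ) 1 := ⟨zero_le_one, le_rfl⟩
  have hnear : ∀ t ∈ Icc 0 P.T, ‖x t + ε • z t - x t‖ ≤ R := fun t _ => by
    have := hz.norm_smul_le hone t
    rw [one_smul] at this
    rw [add_sub_cancel_left]
    exact this.trans hR
  have heq : ∀ t ∈ Icc 0 P.T, x t + ε • z t =
      ξ + ∫ s in 0..t, P.velocity (fun t => x t + ε • z t)
        (fun t => u t + ε • towards u S w t) s := by
    intro t ht
    have h0 := left_mem_Icc.2 hT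
    have h1 : ∫ s in 0..t, ε • ζ s = ∫ s in 0..t, (P.velocity (fun t => x t + ε • z t)
        (fun t => u t + ε • towards u S w t) s - P.velocity x u s) := by
      refine intervalIntegral.integral_congr fun s hs => hz.smul_eq s ?_
      rw [uIcc_of_le ht.1] at hs
      exact ⟨hs.1, hs.2.trans ht.2⟩
    rw [intervalIntegral.integral_smul, ← hz.eq_integral t ht, intervalIntegral.integral_sub
      (intervalIntegrable_sub hvel hT h0 ht)
      (intervalIntegrable_sub hxu.integrable_velocity hT h0 ht)] at h1
    rw [hxu.eq_integral t ht, h1]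
    abel
  obtain ⟨hAC, hd⟩ := hasDerivAt_of_eq_add_integral hT hvel heq
  have hφn := integrableOn_cost_near hP hu hxu.mem_U hΘ hdom hyc hnear
  refine ⟨⟨⟨hvm, hAC, ?_, hd⟩, hvU⟩, ?_, ?_⟩
  · have := heq 0 (left_mem_Icc.2 hT)
    simpa using this
  -- From above, convexity bounds the perturbed costs by those of `u` and `w` along the perturbed
  -- state; from below, coercivity gives `-c * B ^ δ`.
  · obtain ⟨κ, α, δ, β, γ, -, -, hδ, -, -, -, ⟨c, hc, hcoer⟩, -⟩ := hP.growth
    obtain ⟨B, hB⟩ := isCompact_Icc.exists_bound_of_continuousOn hyc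
    have hφw := integrableOn_cost_const hP hyc hw
    have hup : IntegrableOn (fun t => |P.φ t (x t + ε • z t) (u t)| +
        (|P.φ t (x t + ε • z t) w| + |P.φ t (x t + ε • z t) (u t)|) + c * B ^ δ) (Icc 0 P.T) :=
      (hφn.abs.add (hφw.abs.add hφn.abs)).add (integrableOn_const (by simp))
    refine Integrable.mono' hup (aestronglyMeasurable_comp_process (h := P.φ) hP.continuousOn_φ
      hP.isClosed_U hyc hvm hvU) ?_
    filter_upwards [hvU, hxu.mem_U, ae_restrict_mem measurableSet_Icc] with t htv htu ht
    have h1 := cost_add_smul_towards_le (S := S) (hP.convexOn_φ t ht (x t + ε • z t)) hw htu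
      hz.pos.le hε1
    have h2 := hcoer t ht (x t + ε • z t) _ htv
    have h3 : ‖x t + ε • z t‖ ^ δ ≤ B ^ δ := Real.rpow_le_rpow (norm_nonneg _) (hB t ht) hδ.le
    have h4 := Real.rpow_nonneg (norm_nonneg (u t + ε • towards u S w t)) r
    have h5 : ε * S.indicator (fun _ => P.φ t (x t + ε • z t) w - P.φ t (x t + ε • z t) (u t)) t ≤
        |P.φ t (x t + ε • z t) w| + |P.φ t (x t + ε • z t) (u t)| := by
      set X := P.φ t (x t + ε • z t) w
      set Y := P.φ t (x t + ε • z t) (u t)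
      have hXY : X - Y ≤ |X| + |Y| := by linarith [le_abs_self X, neg_abs_le Y]
      have h0 : 0 ≤ |X| + |Y| := by positivity
      by_cases htS : t ∈ S
      · rw [indicator_of_mem htS]
        have := hz.pos
        nlinarith
      · rw [indicator_of_notMem htS, mul_zero]; exact h0
    have h6 := le_abs_self (P.φ t (x t + ε • z t) (u t))
    have h7 : 0 ≤ B ^ δ := (Real.rpow_nonneg (norm_nonneg _) δ).trans h3
    rw [Real.norm_eq_abs, abs_le]
    constructor
    · have a1 := abs_nonneg (P.φ t (x t + ε • z t) (u t))
      have a2 := abs_nonneg (P.φ t (x t + ε • z t) w)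
      have a3 : c * ‖x t + ε • z t‖ ^ δ ≤ c * B ^ δ := by gcongr
      have a4 : 0 ≤ c * ‖u t + ε • towards u S w t‖ ^ r := by positivity
      linarith
    · have : 0 ≤ c * B ^ δ := by positivity
      linarith
  -- The stochastic costs are Hölder of exponent above `1 / 2` with respect to a clock, hence of
  -- finite variation of some order below `2`.
  · obtain ⟨B, hB⟩ := isCompact_Icc.exists_bound_of_continuousOn hyc
    obtain ⟨κ, M, hκ, hM, hctrl⟩ := hP.exists_controlledBy B
    refine (hctrl (clock (perturbationRate P x u (towards u S w) C D)) _ hB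
      fun s hs t ht hst => ?_).exists_pVariation_lt_top hT hκ hM (monotoneOn_clock hT
        (intervalIntegrable_perturbationRate hxu hk C D)
        fun t _ => perturbationRate_nonneg hC hD t)
    have := hz.norm_sub_le_clock hxu hk hC hD hone hs ht hst
    simp only [one_smul] at this
    exact ⟨this.1, this.2.1⟩

end Variation


variable {E : Type*} [NormedAddCommGroup E] [NormedSpace ℝ E] [FiniteDimensional ℝ E] {d : ℕ}
  {P : ControlProblem E d} {r : ℝ} {ξ : E} {x u : ℝ → E} {η : ℝ → EuclideanSpace ℝ (Fin d)}

/-! ### First-order limits of the state equation and of the deterministic costs -/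

section Limits

variable {S : Set ℝ} {w : E} {R C D : ℝ} {Θ : ℝ → ℝ} {k : ℝ → E} {ε : ℕ → ℝ} {z ζ : ℕ → ℝ → E}

/-- The defect of `(z, ζ)` in the linearised state equation. -/
def residual (P : ControlProblem E d) (x u k z ζ : ℝ → E) (t : ℝ) : E :=
  ζ t - P.linearisation x u t (z t) - P.g t (x t) (k t)

theorem IsPerturbation.tendsto_smul (hz : ∀ n, P.IsPerturbation x u k C D (ε n) (z n) (ζ n))
    (hε : Tendsto ε atTop (𝓝 0)) (t : ℝ) : Tendsto (fun n => x t + ε n • z n t) atTop (𝓝 (x t)) := by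
  have h1 : Tendsto (fun n => ε n • z n t) atTop (𝓝 0) := by
    refine squeeze_zero_norm (a := fun n => ε n * C) (fun n => ?_) (by simpa using hε.mul_const C)
    rw [norm_smul, Real.norm_of_nonneg (hz n).pos.le]
    exact mul_le_mul_of_nonneg_left ((hz n).norm_le t) (hz n).pos.le
  simpa using h1.const_add (x t)

/-- The directions `z n` need not converge: boundedness suffices for the difference quotients of `f`
and `g` to approach the derivatives applied to `z n`. The control term `g(t, x + ε z) k` converges
by continuity. -/
theorem IsPerturbation.tendsto_residual (hP : P.SmoothHypothesis r ξ)
    (hz : ∀ n, P.IsPerturbation x u k C D (ε n) (z n) (ζ n)) (hε : Tendsto ε atTop (𝓝 0)) {t : ℝ}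
    (ht : t ∈ Icc 0 P.T) :
    Tendsto (fun n => residual P x u k (z n) (ζ n) t) atTop (𝓝 0) := by
  have hlim := IsPerturbation.tendsto_smul hz hε t
  have h1 := tendsto_differenceQuotient_sub (hP.differentiable_f t ht (x t)).hasFDerivAt
    (fun n => (hz n).pos.ne') hε (fun n => (hz n).norm_le t)
  have h2 := tendsto_differenceQuotient_sub (hP.differentiable_g t ht (x t)).hasFDerivAt
    (fun n => (hz n).pos.ne') hε (fun n => (hz n).norm_le t)
  have h3 := ((hP.differentiable_g t ht).continuous.tendsto (x t)).comp hlim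
  have h2' := ((ContinuousLinearMap.apply ℝ E (u t)).continuous.tendsto _).comp h2
  have h3' := (((ContinuousLinearMap.apply ℝ E (k t)).continuous.tendsto _).comp h3).sub_const
    (P.g t (x t) (k t))
  have hsum := (h1.add h2').add h3'
  simp only [map_zero, add_zero, ContinuousLinearMap.apply_apply, sub_self] at hsum
  refine hsum.congr fun n => ?_
  have e := (hz n).smul_eq t ht
  have e' : ζ n t = (ε n)⁻¹ • (P.velocity (fun t => x t + ε n • z n t)
      (fun t => u t + ε n • k t) t - P.velocity x u t) := by
    rw [← e, smul_smul, inv_mul_cancel₀ (hz n).pos.ne', one_smul]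
  have e2 : P.velocity (fun t => x t + ε n • z n t) (fun t => u t + ε n • k t) t -
      P.velocity x u t = (P.f t (x t + ε n • z n t) - P.f t (x t)) +
        (P.g t (x t + ε n • z n t) - P.g t (x t)) (u t) +
        ε n • P.g t (x t + ε n • z n t) (k t) := by
    simp only [velocity, map_add, map_smul, sub_apply]; abel
  rw [residual, e', e2, smul_add, smul_add, smul_smul, inv_mul_cancel₀ (hz n).pos.ne', one_smul]
  simp only [Function.comp_apply, ContinuousLinearMap.apply_apply, linearisation, sub_apply,
    add_apply, smul_apply, ContinuousLinearMap.flip_apply]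
  abel

theorem IsPerturbation.norm_residual_le {ε : ℝ} {z ζ : ℝ → E}
    (hz : P.IsPerturbation x u k C D ε z ζ) (hC : 1 ≤ C) (hD0 : 0 ≤ D)
    (hD : ∀ t ∈ Icc 0 P.T, ∀ y, ‖y - x t‖ ≤ 1 →
      ‖P.g t y‖ ≤ D ∧ ‖fderiv ℝ (P.f t) y‖ ≤ D ∧ ‖fderiv ℝ (P.g t) y‖ ≤ D) {t : ℝ}
    (ht : t ∈ Icc 0 P.T) :
    ‖residual P x u k z ζ t‖ ≤ 2 * (C + 1) * lipschitzBound D u k t := by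
  obtain ⟨hg, hf', hg'⟩ := hD t ht (x t) (by simp)
  have h1 := hz.norm_deriv_le t ht
  have h2 : ‖P.linearisation x u t (z t)‖ ≤ C * lipschitzBound D u k t := by
    have e1 : ‖fderiv ℝ (P.f t) (x t) (z t)‖ ≤ D * C :=
      (ContinuousLinearMap.le_opNorm _ _).trans (mul_le_mul hf' (hz.norm_le t) (norm_nonneg _) hD0)
    have e2 : ‖(fderiv ℝ (P.g t) (x t) (z t)) (u t)‖ ≤ D * C * ‖u t‖ :=
      (ContinuousLinearMap.le_opNorm _ _).trans (mul_le_mul_of_nonneg_right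
        ((ContinuousLinearMap.le_opNorm _ _).trans
          (mul_le_mul hg' (hz.norm_le t) (norm_nonneg _) hD0)) (norm_nonneg _))
    have e3 : 0 ≤ D * C * ‖k t‖ := by positivity
    refine (norm_add_le (fderiv ℝ (P.f t) (x t) (z t))
      ((fderiv ℝ (P.g t) (x t)).flip (u t) (z t))).trans ?_
    rw [ContinuousLinearMap.flip_apply, lipschitzBound]
    nlinarith
  have h3 : ‖P.g t (x t) (k t)‖ ≤ lipschitzBound D u k t := by
    refine ((P.g t (x t)).le_opNorm _).trans (mul_le_mul hg ?_ (norm_nonneg _) hD0)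
    linarith [norm_nonneg (u t)]
  calc _ ≤ ‖ζ t‖ + ‖P.linearisation x u t (z t)‖ + ‖P.g t (x t) (k t)‖ :=
        (norm_sub_le _ _).trans (by gcongr; exact norm_sub_le _ _)
    _ ≤ _ := by linarith

/-- Dominated convergence: the residual vanishes in the limit at every time and is bounded by a
multiple of the integrable `lipschitzBound`. -/
theorem IsPerturbation.tendsto_integral_residual (hP : P.SmoothHypothesis r ξ)
    (hxu : P.IsRegular ξ x u) (hk : IntervalIntegrable k volume 0 P.T) (hC : 1 ≤ C) (hD0 : 0 ≤ D)
    (hD : ∀ t ∈ Icc 0 P.T, ∀ y, ‖y - x t‖ ≤ 1 →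
      ‖P.g t y‖ ≤ D ∧ ‖fderiv ℝ (P.f t) y‖ ≤ D ∧ ‖fderiv ℝ (P.g t) y‖ ≤ D)
    (hz : ∀ n, P.IsPerturbation x u k C D (ε n) (z n) (ζ n)) (hε : Tendsto ε atTop (𝓝 0))
    {lam : ℝ → E →L[ℝ] ℝ} (hlam : ContinuousOn lam (Icc 0 P.T)) :
    (∀ n, IntervalIntegrable (fun t => lam t (residual P x u k (z n) (ζ n) t)) volume 0 P.T) ∧
    Tendsto (fun n => ∫ t in 0..P.T, lam t (residual P x u k (z n) (ζ n) t)) atTop (𝓝 0) := by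
  have hT := P.T_pos.le
  obtain ⟨B, hB⟩ := isCompact_Icc.exists_bound_of_continuousOn hlam
  have hint : ∀ n, IntervalIntegrable (fun t => lam t (residual P x u k (z n) (ζ n) t))
      volume 0 P.T := fun n => by
    refine intervalIntegrable_clm_apply_of_continuousOn hT hlam (((hz n).integrable.sub
      (intervalIntegrable_apply_of_continuousOn hT (hP.integrable_linearisation hxu)
        (hz n).continuous.continuousOn)).sub
      (intervalIntegrable_clm_apply_of_continuousOn hT ?_ hk))
    exact continuousOn_comp_state hP.continuousOn_g hxu.continuousOn
  refine ⟨hint, ?_⟩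
  have := intervalIntegral.tendsto_integral_filter_of_dominated_convergence (μ := volume)
    (F := fun n t => lam t (residual P x u k (z n) (ζ n) t)) (f := fun _ => (0 : ℝ)) (l := atTop)
    (a := 0) (b := P.T) (fun t => B * (2 * (C + 1) * lipschitzBound D u k t))
    (Eventually.of_forall fun n => (hint n).aestronglyMeasurable_restrict_uIoc)
    (Eventually.of_forall fun n => ae_of_all _ fun t ht => ?_)
    (((intervalIntegrable_lipschitzBound D hxu.integrable hk).const_mul _).const_mul B)
    (ae_of_all _ fun t ht => ?_)
  · simpa using this
  · rw [uIoc_of_le hT] at ht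
    have ht' : t ∈ Icc 0 P.T := ⟨ht.1.le, ht.2⟩
    exact ((lam t).le_opNorm _).trans (mul_le_mul (hB t ht')
      ((hz n).norm_residual_le hC hD0 hD ht') (norm_nonneg _) ((norm_nonneg _).trans (hB t ht')))
  · rw [uIoc_of_le hT] at ht
    have := ((lam t).continuous.tendsto 0).comp
      (IsPerturbation.tendsto_residual hP hz hε ⟨ht.1.le, ht.2⟩)
    rwa [map_zero] at this

variable [MeasurableSpace E] [BorelSpace E]

/-- The deterministic costs are differentiable along perturbations of the state. -/
theorem IsPerturbation.tendsto_integral_cost (hP : P.SmoothHypothesis r ξ)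
    (hxu : P.IsRegular ξ x u) (hu : AEStronglyMeasurable u (volume.restrict (Icc 0 P.T)))
    (hΘ : IntegrableOn Θ (Icc 0 P.T)) (hdom : ∀ᵐ t ∂(volume.restrict (Icc 0 P.T)), ∀ y,
      ‖y - x t‖ ≤ R → |P.φ t y (u t)| ≤ Θ t ∧ ‖fderiv ℝ (fun z => P.φ t z (u t)) y‖ ≤ Θ t)
    (hz : ∀ n, P.IsPerturbation x u k C D (ε n) (z n) (ζ n)) (hε : Tendsto ε atTop (𝓝 0))
    (hR : ∀ n, ε n * C ≤ R)
    (hφ' : IntervalIntegrable (fun s => fderiv ℝ (fun z => P.φ s z (u s)) (x s)) volume 0 P.T) :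
    Tendsto (fun n => ∫ t in 0..P.T, ((ε n)⁻¹ * (P.φ t (x t + ε n • z n t) (u t) -
      P.φ t (x t) (u t)) - fderiv ℝ (fun z => P.φ t z (u t)) (x t) (z n t))) atTop (𝓝 0) := by
  have hT := P.T_pos.le
  have hone : (1 : ℝ) ∈ Icc (0 : ℝ) 1 := ⟨zero_le_one, le_rfl⟩
  have hnear : ∀ n t, ‖x t + ε n • z n t - x t‖ ≤ R := fun n t => by
    have := (hz n).norm_smul_le hone t
    rw [one_smul] at this
    rw [add_sub_cancel_left]
    exact this.trans (hR n)
  have hR0 : 0 ≤ R := (norm_nonneg _).trans (hnear 0 0)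
  have hint : ∀ y : ℝ → E, ContinuousOn y (Icc 0 P.T) → (∀ t ∈ Icc 0 P.T, ‖y t - x t‖ ≤ R) →
      IntervalIntegrable (fun t => P.φ t (y t) (u t)) volume 0 P.T := fun y hy hyx =>
    (intervalIntegrable_iff_integrableOn_Icc_of_le hT).2
      (integrableOn_cost_near hP.toBasicHypothesis hu hxu.mem_U hΘ hdom hy hyx)
  have hu' := (ae_restrict_Icc_iff hT).1 hxu.mem_U
  have hdom' := (ae_restrict_Icc_iff hT).1 hdom
  -- One `Θ t * C` bounds the difference quotient, by the mean value inequality in the ball of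
  -- radius `R`; the other bounds the linear term.
  have := intervalIntegral.tendsto_integral_filter_of_dominated_convergence (μ := volume)
    (F := fun n t => (ε n)⁻¹ * (P.φ t (x t + ε n • z n t) (u t) - P.φ t (x t) (u t)) -
      fderiv ℝ (fun z => P.φ t z (u t)) (x t) (z n t)) (f := fun _ => (0 : ℝ)) (l := atTop)
    (a := 0) (b := P.T) (fun t => Θ t * C + Θ t * C)
    (Eventually.of_forall fun n => ?_) (Eventually.of_forall fun n => ?_) ?_ ?_
  · simpa using this
  · refine IntervalIntegrable.aestronglyMeasurable_restrict_uIoc (((((hint _ ?_ fun t _ => hnear n t).sub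
      (hint x hxu.continuousOn fun t _ => by simpa using hR0)).const_mul _)).sub
      (intervalIntegrable_apply_of_continuousOn hT hφ' (hz n).continuous.continuousOn))
    exact hxu.continuousOn.add ((hz n).continuous.const_smul (ε n)).continuousOn
  · filter_upwards [hu', hdom'] with t htU htd htm
    have htm' : t ∈ uIcc 0 P.T := uIoc_subset_uIcc htm
    have ht : t ∈ Icc 0 P.T := by rwa [uIcc_of_le hT] at htm'
    have hd := htd htm'
    have h0 := (hd (x t) (by simpa using hR0)).2
    have hΘ0 : 0 ≤ Θ t := (norm_nonneg _).trans h0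
    have h1 := (convex_closedBall (x t) R).norm_image_sub_le_of_norm_fderiv_le (𝕜 := ℝ)
      (f := fun y => P.φ t y (u t)) (C := Θ t)
      (fun Y _ => (hP.differentiable_φ t ht (u t) (htU htm')) Y)
      (fun Y hY => (hd Y (by rwa [← dist_eq_norm])).2) (Metric.mem_closedBall_self hR0)
      (y := x t + ε n • z n t) (by rw [Metric.mem_closedBall, dist_eq_norm]; exact hnear n t)
    rw [add_sub_cancel_left, norm_smul, Real.norm_of_nonneg (hz n).pos.le] at h1
    refine (norm_sub_le _ _).trans (add_le_add ?_ ?_)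
    · rw [norm_mul, norm_inv, Real.norm_of_nonneg (hz n).pos.le, inv_mul_le_iff₀ (hz n).pos]
      have h2 := mul_le_mul_of_nonneg_left ((hz n).norm_le t)
        (mul_nonneg hΘ0 (hz n).pos.le)
      linarith
    · exact (ContinuousLinearMap.le_opNorm _ _).trans
        (mul_le_mul h0 ((hz n).norm_le t) (norm_nonneg _) hΘ0)
  · have := (intervalIntegrable_iff_integrableOn_Icc_of_le hT).2 hΘ
    exact (this.mul_const C).add (this.mul_const C)
  · filter_upwards [hu'] with t htU htm
    have htm' : t ∈ uIcc 0 P.T := uIoc_subset_uIcc htm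
    have ht : t ∈ Icc 0 P.T := by rwa [uIcc_of_le hT] at htm'
    exact tendsto_differenceQuotient_sub
      (hP.differentiable_φ t ht (u t) (htU htm') (x t)).hasFDerivAt
      (fun n => (hz n).pos.ne') hε (fun n => (hz n).norm_le t)

/-- The gain in the deterministic costs by switching to the control `w` on `S` depends
continuously on the state. -/
theorem IsPerturbation.tendsto_integral_switch (hP : P.SmoothHypothesis r ξ)
    (hxu : P.IsRegular ξ x u) (hu : AEStronglyMeasurable u (volume.restrict (Icc 0 P.T)))
    (hw : w ∈ P.U) (hS : MeasurableSet S)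
    (hΘ : IntegrableOn Θ (Icc 0 P.T)) (hdom : ∀ᵐ t ∂(volume.restrict (Icc 0 P.T)), ∀ y,
      ‖y - x t‖ ≤ R → |P.φ t y (u t)| ≤ Θ t ∧ ‖fderiv ℝ (fun z => P.φ t z (u t)) y‖ ≤ Θ t)
    (hz : ∀ n, P.IsPerturbation x u k C D (ε n) (z n) (ζ n)) (hε : Tendsto ε atTop (𝓝 0))
    (hR : ∀ n, ε n * C ≤ R) :
    (∀ n, IntervalIntegrable (S.indicator fun t => P.φ t (x t + ε n • z n t) w -
      P.φ t (x t + ε n • z n t) (u t)) volume 0 P.T) ∧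
    Tendsto (fun n => ∫ t in 0..P.T, S.indicator (fun t => P.φ t (x t + ε n • z n t) w -
      P.φ t (x t + ε n • z n t) (u t)) t) atTop
      (𝓝 (∫ t in 0..P.T, S.indicator (fun t => P.φ t (x t) w - P.φ t (x t) (u t)) t)) := by
  have : ProperSpace E := FiniteDimensional.proper_real E
  have hT := P.T_pos.le
  have hone : (1 : ℝ) ∈ Icc (0 : ℝ) 1 := ⟨zero_le_one, le_rfl⟩
  have hnorm : ∀ n t, ‖ε n • z n t‖ ≤ ε n * C := fun n t => by
    have := (hz n).norm_smul_le hone t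
    rwa [one_smul] at this
  have hcn : ∀ n, ContinuousOn (fun t => x t + ε n • z n t) (Icc 0 P.T) := fun n =>
    hxu.continuousOn.add ((hz n).continuous.const_smul (ε n)).continuousOn
  have hint : ∀ n, IntervalIntegrable (S.indicator fun t => P.φ t (x t + ε n • z n t) w -
      P.φ t (x t + ε n • z n t) (u t)) volume 0 P.T := fun n => by
    rw [intervalIntegrable_iff_integrableOn_Icc_of_le hT]
    refine Integrable.indicator (Integrable.sub (integrableOn_cost_const hP.toBasicHypothesis
      (hcn n) hw) (integrableOn_cost_near hP.toBasicHypothesis hu hxu.mem_U hΘ hdom (hcn n)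
        fun t _ => ?_)) hS
    rw [add_sub_cancel_left]
    exact (hnorm n t).trans (hR n)
  refine ⟨hint, ?_⟩
  obtain ⟨B, hB⟩ := isCompact_Icc.exists_bound_of_continuousOn hxu.continuousOn
  have hφw : ContinuousOn (fun p : ℝ × E => P.φ p.1 p.2 w)
      (Icc 0 P.T ×ˢ Metric.closedBall (0 : E) (B + 1)) :=
    hP.continuousOn_φ.comp (continuousOn_fst.prodMk (continuousOn_snd.prodMk continuousOn_const))
      fun p hp => ⟨hp.1, mem_univ _, hw⟩
  obtain ⟨M, hM⟩ := (isCompact_Icc.prod (isCompact_closedBall (0 : E)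
    (B + 1))).exists_bound_of_continuousOn hφw
  have hu' := (ae_restrict_Icc_iff hT).1 hxu.mem_U
  have hdom' := (ae_restrict_Icc_iff hT).1 hdom
  -- `M` bounds the costs of the constant control `w` on a compact set that contains all perturbed
  -- states, and `Θ` bounds the costs of `u`.
  refine intervalIntegral.tendsto_integral_filter_of_dominated_convergence (μ := volume)
    (fun t => M + Θ t) (Eventually.of_forall fun n => (hint n).aestronglyMeasurable_restrict_uIoc)
    (Eventually.of_forall fun n => ?_) ?_ ?_
  · filter_upwards [hdom'] with t htd htm
    have htm' : t ∈ uIcc 0 P.T := uIoc_subset_uIcc htm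
    have ht : t ∈ Icc 0 P.T := by rwa [uIcc_of_le hT] at htm'
    have h1 := (htd htm' (x t + ε n • z n t)
      (by rw [add_sub_cancel_left]; exact (hnorm n t).trans (hR n))).1
    have h2 := hM (t, x t + ε n • z n t) ⟨ht, mem_closedBall_zero_iff.2 <|
      (norm_add_le _ _).trans (add_le_add (hB t ht) ((hnorm n t).trans (hz n).mul_le))⟩
    refine (norm_indicator_le_norm_self _ _).trans ((norm_sub_le _ _).trans (add_le_add h2 ?_))
    rwa [Real.norm_eq_abs]
  · exact intervalIntegrable_const.add ((intervalIntegrable_iff_integrableOn_Icc_of_le hT).2 hΘ)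
  · filter_upwards [hu'] with t htU htm
    have htm' : t ∈ uIcc 0 P.T := uIoc_subset_uIcc htm
    have ht : t ∈ Icc 0 P.T := by rwa [uIcc_of_le hT] at htm'
    have hlim := IsPerturbation.tendsto_smul hz hε t
    by_cases htS : t ∈ S
    · simp only [indicator_of_mem htS]
      exact (((hP.differentiable_φ t ht w hw).continuous.tendsto (x t)).comp hlim).sub
        (((hP.differentiable_φ t ht (u t) (htU htm')).continuous.tendsto (x t)).comp hlim)
    · simp only [indicator_of_notMem htS]
      exact tendsto_const_nhds

end Limits


variable {E : Type*} [NormedAddCommGroup E] [NormedSpace ℝ E] [FiniteDimensional ℝ E] {d : ℕ}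
  {P : ControlProblem E d} {r : ℝ} {ξ : E} {x u : ℝ → E} {η : ℝ → EuclideanSpace ℝ (Fin d)}

/-! ### The stochastic costs, the first-order condition and the minimum of the Hamiltonian -/

section MaximumPrinciple

variable {S : Set ℝ} {w : E} {R C D : ℝ} {Θ : ℝ → ℝ} {k : ℝ → E} {ε : ℕ → ℝ} {z ζ : ℕ → ℝ → E}

/-- The stochastic costs are differentiable along perturbations of the state. -/
theorem IsPerturbation.tendsto_youngIntegral (hP : P.SmoothHypothesis r ξ)
    (hη : IsObservationPath P.T η) (hxu : P.IsRegular ξ x u)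
    (hk : IntervalIntegrable k volume 0 P.T) (hC : 1 ≤ C) (hD : 0 ≤ D)
    (hz : ∀ n, P.IsPerturbation x u k C D (ε n) (z n) (ζ n)) (hε : Tendsto ε atTop (𝓝 0))
    {K : ℕ → ℝ} (hK : ∀ n, IsYoungIntegral 0 P.T (fun t => fderiv ℝ (P.ψ t) (x t) (z n t)) η (K n)) :
    Tendsto (fun n => (ε n)⁻¹ * (youngIntegral 0 P.T (fun t => P.ψ t (x t + ε n • z n t)) η -
      youngIntegral 0 P.T (fun t => P.ψ t (x t)) η) - K n) atTop (𝓝 0) := by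
  have : ProperSpace E := FiniteDimensional.proper_real E
  have hT := P.T_pos.le
  set V := clock (perturbationRate P x u k C D) with hV
  have hm := intervalIntegrable_perturbationRate hxu hk C D
  have hVm : MonotoneOn V (Icc 0 P.T) :=
    monotoneOn_clock hT hm fun t _ => perturbationRate_nonneg hC hD t
  have hVc : ContinuousOn V (Icc 0 P.T) := continuousOn_clock hT hm
  have hzero : (0 : ℝ) ∈ Icc (0 : ℝ) 1 := ⟨le_rfl, zero_le_one⟩
  have hone : (1 : ℝ) ∈ Icc (0 : ℝ) 1 := ⟨zero_le_one, le_rfl⟩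
  obtain ⟨B, hB⟩ := isCompact_Icc.exists_bound_of_continuousOn hxu.continuousOn
  have hbound : ∀ n, ∀ σ ∈ Icc (0 : ℝ) 1, ∀ t ∈ Icc 0 P.T, ‖x t + σ • ε n • z n t‖ ≤ B + 1 :=
    fun n σ hσ t ht => (norm_add_le _ _).trans
      (add_le_add (hB t ht) (((hz n).norm_smul_le hσ t).trans (hz n).mul_le))
  have hclock := fun n σ hσ s hs t ht hst =>
    (hz n).norm_sub_le_clock (σ := σ) (s := s) (t := t) hxu hk hC hD hσ hs ht hst
  -- Two Young controls are needed: the Hölder exponent of `ψ` provides the integrals, that of `D₂ψ`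
  -- controls the difference quotients. Both use the clock `V`, which does not depend on `n`.
  obtain ⟨κ₀, M₀, hκ₀, hM₀, hψ⟩ := hP.toBasicHypothesis.exists_controlledBy (B + 1)
  obtain ⟨q₀, Z₀, hZ₀⟩ := hη.exists_youngControl hT hκ₀ hVm hVc
  have hψσ : ∀ n, ∀ σ ∈ Icc (0 : ℝ) 1, ∃ J, IsYoungIntegral 0 P.T
      (fun t => P.ψ t (x t + σ • ε n • z n t)) η J := fun n σ hσ =>
    hZ₀.exists_isYoungIntegral hM₀ (hψ V _ (hbound n σ hσ) fun s hs t ht hst =>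
      ⟨(hclock n σ hσ s hs t ht hst).1, (hclock n σ hσ s hs t ht hst).2.1⟩)
  obtain ⟨κ, A, hκ, -, -, hder⟩ := hP.exists_controlledBy_derivative (B + 1) hVm
  obtain ⟨M, hM, hctrl⟩ := hder C (by linarith)
  have hctrlσ : ∀ n, ∀ σ ∈ Icc (0 : ℝ) 1, ControlledBy 0 P.T κ M V
      (fun t => fderiv ℝ (P.ψ t) (x t + σ • ε n • z n t) (z n t)) := fun n σ hσ =>
    hctrl _ _ (hbound n σ hσ) (hclock n σ hσ) fun t _ => (hz n).norm_le t
  obtain ⟨q, Z, hZ⟩ := hη.exists_youngControl hT hκ hVm hVc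
  have hquot : ∀ n, ControlledBy 0 P.T κ (2 * M) V (fun t =>
      (ε n)⁻¹ • (P.ψ t (x t + ε n • z n t) - P.ψ t (x t)) -
        fderiv ℝ (P.ψ t) (x t) (z n t)) := by
    intro n s hs t ht hst
    have h1 := controlledBy_differenceQuotient hP.differentiable_ψ (hz n).pos (hctrlσ n)
      s hs t ht hst
    have h2 := hctrlσ n 0 hzero s hs t ht hst
    simp only [zero_smul, add_zero] at h2
    rw [sub_sub_sub_comm]
    exact (norm_sub_le _ _).trans (by linarith)
  refine hZ.tendsto_zero (by linarith) hquot (fun t ht => ?_) fun n => ?_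
  · exact tendsto_differenceQuotient_sub (hP.differentiable_ψ t ht (x t)).hasFDerivAt
      (fun n => (hz n).pos.ne') hε (fun n => (hz n).norm_le t)
  · obtain ⟨J₁, hJ₁⟩ := hψσ n 1 hone
    obtain ⟨J₀, hJ₀⟩ := hψσ n 0 hzero
    simp only [one_smul, zero_smul, add_zero] at hJ₁ hJ₀
    rw [hJ₁.youngIntegral_eq hT, hJ₀.youngIntegral_eq hT]
    exact ((hJ₁.sub hJ₀).const_smul (ε n)⁻¹).sub (hK n)

/-- The first-order condition, integrated over a set of times. -/
theorem SmoothHypothesis.integral_hamiltonian_nonneg [MeasurableSpace E] [BorelSpace E]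
    (hP : P.SmoothHypothesis r ξ) (hη : IsObservationPath P.T η)
    (hmin : P.IsGlobalMinimiser η ξ x u) {lam J : ℝ → E →L[ℝ] ℝ} {Z : ℝ → ℝ}
    (hlamc : ContinuousOn lam (Icc 0 P.T)) (hZ : MonotoneOn Z (Icc 0 P.T))
    (hJ : IsYoungPrimitive 0 P.T Z (fun s => (fderiv ℝ (P.ψ s) (x s)).flip) η J)
    (hlam : ∀ t ∈ Icc 0 P.T, lam t = (∫ s in t..P.T, ((lam s).comp (P.linearisation x u s) +
        fderiv ℝ (fun z => P.φ s z (u s)) (x s))) + (J P.T - J t))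
    (hw : w ∈ P.U) (hS : MeasurableSet S) :
    0 ≤ ∫ t in 0..P.T, S.indicator (fun t => P.hamiltonian t (x t) (lam t) w -
      P.hamiltonian t (x t) (lam t) (u t)) t := by
  have : ProperSpace E := FiniteDimensional.proper_real E
  have hT := P.T_pos.le
  have hxu := hP.toBasicHypothesis.isRegular hmin.1
  have hu : AEStronglyMeasurable u (volume.restrict (Icc 0 P.T)) := hmin.1.1.1.1
  have hk := intervalIntegrable_towards hxu.integrable hS w
  set k := towards u S w with hkdef
  obtain ⟨D, hD0, hD⟩ := hP.exists_tube_bound hxu.continuousOn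
  obtain ⟨C, hC, hpert⟩ := hP.exists_perturbation hxu hk hD0 hD
  obtain ⟨R, Θ, hR, hΘ, hdom⟩ := hP.exists_dominating hmin.1
  have hlin := hP.integrable_linearisation hxu
  have hφ' := hP.integrable_fderiv_cost hmin.1
  have hlamA := intervalIntegrable_clm_comp hT hlamc hlin
  have hC0 : 0 < C := by linarith
  -- The perturbed states stay within `1` of `x`, for the bounds on the coefficients, and within
  -- `R`, for the bounds on the costs.
  set ε : ℕ → ℝ := fun n => min 1 R / C / ((n : ℝ) + 1) with hε
  have hεpos : ∀ n, 0 < ε n := fun n => by positivity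
  have hεC : ∀ n, ε n * C ≤ min 1 R := fun n => by
    have : ε n * C = min 1 R / ((n : ℝ) + 1) := by simp only [hε]; field_simp
    rw [this]
    exact div_le_self (by positivity) (by linarith [(Nat.cast_nonneg n : (0 : ℝ) ≤ n)])
  have hε0 : Tendsto ε atTop (𝓝 0) := tendsto_mesh _
  choose z ζ hz using fun n => hpert (ε n) (hεpos n) ((hεC n).trans (min_le_left _ _))
  have hεR : ∀ n, ε n * C ≤ R := fun n => (hεC n).trans (min_le_right _ _)
  -- the Young integrals of the linearised costs, by duality
  have hK : ∀ n, IsYoungIntegral 0 P.T (fun t => fderiv ℝ (P.ψ t) (x t) (z n t)) η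
      ((∫ t in 0..P.T, lam t (ζ n t)) - ∫ t in 0..P.T, ((lam t).comp (P.linearisation x u t) +
        fderiv ℝ (fun z => P.φ t z (u t)) (x t)) (z n t)) := fun n =>
    isYoungIntegral_of_duality hT hZ hJ (hlamA.add hφ') (hz n).integrable hlamc hlam
      (hz n).eq_integral
  have hY := IsPerturbation.tendsto_youngIntegral hP hη hxu hk hC hD0 hz hε0 hK
  obtain ⟨hri, hr⟩ := IsPerturbation.tendsto_integral_residual hP hxu hk hC hD0 hD hz hε0 hlamc
  have hc := IsPerturbation.tendsto_integral_cost hP hxu hu hΘ hdom hz hε0 hεR hφ'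
  obtain ⟨hsi, hs⟩ :=
    IsPerturbation.tendsto_integral_switch hP hxu hu hw hS hΘ hdom hz hε0 hεR
  have hgk : IntervalIntegrable (fun t => lam t (P.g t (x t) (k t))) volume 0 P.T :=
    intervalIntegrable_clm_apply_of_continuousOn hT hlamc
      (intervalIntegrable_clm_apply_of_continuousOn hT
        (continuousOn_comp_state hP.continuousOn_g hxu.continuousOn) hk)
  have hφi : ∀ n, IntervalIntegrable (fun t => P.φ t (x t + ε n • z n t) (u t)) volume 0 P.T :=
    fun n => (intervalIntegrable_iff_integrableOn_Icc_of_le hT).2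
      (integrableOn_cost_near hP.toBasicHypothesis hu hxu.mem_U hΘ hdom
        (hxu.continuousOn.add ((hz n).continuous.const_smul (ε n)).continuousOn) fun t _ => by
          have := (hz n).norm_smul_le (σ := 1) ⟨zero_le_one, le_rfl⟩ t
          rw [one_smul] at this
          rw [add_sub_cancel_left]
          exact this.trans (hεR n))
  have hφ0 : IntervalIntegrable (fun t => P.φ t (x t) (u t)) volume 0 P.T :=
    (intervalIntegrable_iff_integrableOn_Icc_of_le hT).2 hmin.1.2.1
  -- The four limits and the constant are combined so that, by duality, all terms linear in `z n`
  -- cancel in every member of the sequence.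
  have hlim := (((hc.add hs).add hY).add hr).add_const (∫ t in 0..P.T, lam t (P.g t (x t) (k t)))
  simp only [zero_add, add_zero] at hlim
  have hφw : IntervalIntegrable (S.indicator fun t => P.φ t (x t) w - P.φ t (x t) (u t))
      volume 0 P.T := by
    rw [intervalIntegrable_iff_integrableOn_Icc_of_le hT]
    exact (Integrable.sub (integrableOn_cost_const hP.toBasicHypothesis hxu.continuousOn hw)
      hmin.1.2.1).indicator hS
  have hlimeq : (∫ t in 0..P.T, S.indicator (fun t => P.hamiltonian t (x t) (lam t) w -
      P.hamiltonian t (x t) (lam t) (u t)) t) =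
      (∫ t in 0..P.T, S.indicator (fun t => P.φ t (x t) w - P.φ t (x t) (u t)) t) +
        ∫ t in 0..P.T, lam t (P.g t (x t) (k t)) := by
    rw [← intervalIntegral.integral_add hφw hgk]
    refine intervalIntegral.integral_congr fun t _ => ?_
    by_cases htS : t ∈ S
    · simp only [hkdef, towards, indicator_of_mem htS, hamiltonian, map_add, map_sub]
      ring
    · simp only [hkdef, towards, indicator_of_notMem htS, map_zero, add_zero]
  rw [hlimeq]
  -- Each member equals `ε⁻¹` times an upper bound for the cost difference, which is nonnegative by
  -- minimality.
  refine ge_of_tendsto' hlim fun n => ?_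
  have hadm := (hz n).isAdmissible hP.toBasicHypothesis hxu hu hw hS hC hD0 hΘ hdom (hεR n)
  have hle := hmin.2 _ _ hadm
  have hε1 := (hz n).eps_le_one hC
  have hφn : IntervalIntegrable (fun t => P.φ t (x t + ε n • z n t) (u t + ε n • k t))
      volume 0 P.T := (intervalIntegrable_iff_integrableOn_Icc_of_le hT).2 hadm.2.1
  have hconv : (∫ t in 0..P.T, P.φ t (x t + ε n • z n t) (u t + ε n • k t)) ≤
      (∫ t in 0..P.T, P.φ t (x t + ε n • z n t) (u t)) +
        ε n * ∫ t in 0..P.T, S.indicator (fun t => P.φ t (x t + ε n • z n t) w -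
          P.φ t (x t + ε n • z n t) (u t)) t := by
    rw [← intervalIntegral.integral_const_mul,
      ← intervalIntegral.integral_add (hφi n) ((hsi n).const_mul _)]
    refine intervalIntegral.integral_mono_ae_restrict hT hφn
      ((hφi n).add ((hsi n).const_mul _)) ?_
    filter_upwards [hxu.mem_U, ae_restrict_mem measurableSet_Icc] with t htU ht
    exact cost_add_smul_towards_le (S := S) (hP.convexOn_φ t ht _) hw htU (hεpos n).le hε1
  have hA := intervalIntegrable_apply_of_continuousOn hT hlamA (hz n).continuous.continuousOn
  have hB := intervalIntegrable_apply_of_continuousOn hT hφ' (hz n).continuous.continuousOn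
  -- Insert `ζ = A z + g k + residual`, where `A` is the linearisation; the two occurrences of `lam
  -- (A z)` cancel.
  have hdual : (∫ t in 0..P.T, lam t (ζ n t)) - (∫ t in 0..P.T,
      ((lam t).comp (P.linearisation x u t) +
        fderiv ℝ (fun z => P.φ t z (u t)) (x t)) (z n t)) =
      (∫ t in 0..P.T, lam t (residual P x u k (z n) (ζ n) t)) +
        (∫ t in 0..P.T, lam t (P.g t (x t) (k t))) -
        ∫ t in 0..P.T, fderiv ℝ (fun z => P.φ t z (u t)) (x t) (z n t) := by
    have e1 : (∫ t in 0..P.T, lam t (ζ n t)) =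
        (∫ t in 0..P.T, lam t (residual P x u k (z n) (ζ n) t)) +
          (∫ t in 0..P.T, ((lam t).comp (P.linearisation x u t)) (z n t)) +
          ∫ t in 0..P.T, lam t (P.g t (x t) (k t)) := by
      rw [← intervalIntegral.integral_add (hri n) hA,
        ← intervalIntegral.integral_add ((hri n).add hA) hgk]
      refine intervalIntegral.integral_congr fun t _ => ?_
      simp only [residual, map_sub, ContinuousLinearMap.comp_apply]
      ring
    have e2 : (∫ t in 0..P.T, ((lam t).comp (P.linearisation x u t) +
        fderiv ℝ (fun z => P.φ t z (u t)) (x t)) (z n t)) =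
        (∫ t in 0..P.T, ((lam t).comp (P.linearisation x u t)) (z n t)) +
          ∫ t in 0..P.T, fderiv ℝ (fun z => P.φ t z (u t)) (x t) (z n t) := by
      rw [← intervalIntegral.integral_add hA hB]
      rfl
    rw [e1, e2]
    ring
  have hcost : (∫ t in 0..P.T, ((ε n)⁻¹ * (P.φ t (x t + ε n • z n t) (u t) -
      P.φ t (x t) (u t)) - fderiv ℝ (fun z => P.φ t z (u t)) (x t) (z n t))) =
      (ε n)⁻¹ * ((∫ t in 0..P.T, P.φ t (x t + ε n • z n t) (u t)) -
        ∫ t in 0..P.T, P.φ t (x t) (u t)) -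
        ∫ t in 0..P.T, fderiv ℝ (fun z => P.φ t z (u t)) (x t) (z n t) := by
    rw [intervalIntegral.integral_sub (((hφi n).sub hφ0).const_mul _) hB,
      intervalIntegral.integral_const_mul, intervalIntegral.integral_sub (hφi n) hφ0]
  rw [hdual, hcost]
  simp only [cost] at hle
  set a := ∫ t in 0..P.T, P.φ t (x t + ε n • z n t) (u t)
  set a₀ := ∫ t in 0..P.T, P.φ t (x t) (u t)
  set s := ∫ t in 0..P.T, S.indicator (fun t => P.φ t (x t + ε n • z n t) w -
    P.φ t (x t + ε n • z n t) (u t)) t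
  set y := youngIntegral 0 P.T (fun t => P.ψ t (x t + ε n • z n t)) η
  set y₀ := youngIntegral 0 P.T (fun t => P.ψ t (x t)) η
  have hfin : 0 ≤ (ε n)⁻¹ * (a - a₀ + ε n * s + (y - y₀)) :=
    mul_nonneg (inv_nonneg.2 (hεpos n).le) (by linarith)
  have hexp : (ε n)⁻¹ * (a - a₀ + ε n * s + (y - y₀)) =
      (ε n)⁻¹ * (a - a₀) + s + (ε n)⁻¹ * (y - y₀) := by
    have := (hεpos n).ne'
    field_simp
  linarith

/-- For fixed `w` the difference of Hamiltonians is integrable with nonnegative integral over every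
measurable set of times, hence nonnegative almost everywhere. -/
theorem SmoothHypothesis.ae_isLeast_hamiltonian (hP : P.SmoothHypothesis r ξ)
    (hη : IsObservationPath P.T η) (hmin : P.IsGlobalMinimiser η ξ x u) {lam J : ℝ → E →L[ℝ] ℝ}
    {Z : ℝ → ℝ} (hlamc : ContinuousOn lam (Icc 0 P.T)) (hZ : MonotoneOn Z (Icc 0 P.T))
    (hJ : IsYoungPrimitive 0 P.T Z (fun s => (fderiv ℝ (P.ψ s) (x s)).flip) η J)
    (hlam : ∀ t ∈ Icc 0 P.T, lam t = (∫ s in t..P.T, ((lam s).comp (P.linearisation x u s) +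
        fderiv ℝ (fun z => P.φ s z (u s)) (x s))) + (J P.T - J t)) :
    ∀ᵐ t ∂(volume.restrict (Icc 0 P.T)),
      IsLeast (P.hamiltonian t (x t) (lam t) '' P.U) (P.hamiltonian t (x t) (lam t) (u t)) := by
  have : ProperSpace E := FiniteDimensional.proper_real E
  borelize E
  have hT := P.T_pos.le
  have hxu := hP.toBasicHypothesis.isRegular hmin.1
  have hf : ContinuousOn (fun t => P.f t (x t)) (Icc 0 P.T) :=
    continuousOn_comp_state hP.continuousOn_f hxu.continuousOn
  have hHu : IntegrableOn (fun t => P.hamiltonian t (x t) (lam t) (u t)) (Icc 0 P.T) := by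
    have h1 := (intervalIntegrable_iff_integrableOn_Icc_of_le hT).1
      (intervalIntegrable_clm_apply_of_continuousOn hT hlamc hxu.integrable_velocity)
    exact Integrable.add hmin.1.2.1 h1
  have hHw : ∀ w ∈ P.U, IntegrableOn (fun t => P.hamiltonian t (x t) (lam t) w) (Icc 0 P.T) := by
    intro w hw
    have h1 := (intervalIntegrable_iff_integrableOn_Icc_of_le hT).1
      (intervalIntegrable_clm_apply_of_continuousOn hT hlamc
        (hP.toBasicHypothesis.integrable_velocity hxu.continuousOn
          (intervalIntegrable_const (c := w))))
    exact Integrable.add (integrableOn_cost_const hP.toBasicHypothesis hxu.continuousOn hw) h1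
  have key : ∀ w ∈ P.U, ∀ᵐ t ∂(volume.restrict (Icc 0 P.T)),
      P.hamiltonian t (x t) (lam t) (u t) ≤ P.hamiltonian t (x t) (lam t) w := by
    intro w hw
    have := ae_nonneg_of_forall_setIntegral_nonneg ((hHw w hw).sub hHu) fun S hS _ => by
      have h := hP.integral_hamiltonian_nonneg hη hmin hlamc hZ hJ hlam hw hS
      rw [intervalIntegral.integral_of_le hT, ← integral_Icc_eq_integral_Ioc,
        integral_indicator hS] at h
      exact h
    filter_upwards [this] with t ht
    simpa using ht
  -- The exceptional null set depends on `w`, so only countably many `w` are used; continuity of the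
  -- Hamiltonian on `U` reaches the others.
  obtain ⟨Q, hQU, hQc, hQd⟩ := TopologicalSpace.IsSeparable.exists_countable_dense_subset
    (TopologicalSpace.IsSeparable.of_separableSpace P.U)
  filter_upwards [(ae_ball_iff hQc).2 fun w hw => key w (hQU hw), hxu.mem_U,
    ae_restrict_mem measurableSet_Icc] with t hQt htU ht
  refine ⟨mem_image_of_mem _ htU, ?_⟩
  rintro _ ⟨v, hv, rfl⟩
  have hc : ContinuousOn (P.hamiltonian t (x t) (lam t)) P.U := by
    have h1 : ContinuousOn (fun v => P.φ t (x t) v) P.U :=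
      hP.continuousOn_φ.comp (f := fun v => (t, x t, v)) (by fun_prop)
        fun v hv => ⟨ht, mem_univ _, hv⟩
    have h2 : Continuous fun v => lam t (P.f t (x t) + P.g t (x t) v) := by fun_prop
    exact h1.add h2.continuousOn
  have hcl : v ∈ closure Q := hQd hv
  have hmap : MapsTo (P.hamiltonian t (x t) (lam t)) Q
      (Ici (P.hamiltonian t (x t) (lam t) (u t))) := fun w hw => hQt w hw
  have hcw : ContinuousWithinAt (P.hamiltonian t (x t) (lam t)) Q v := (hc v hv).mono hQU
  have := hcw.mem_closure hcl hmap
  rwa [isClosed_Ici.closure_eq] at this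

end MaximumPrinciple

end ControlProblem

end VarDA

end

theorem theorem2 {E : Type*} [NormedAddCommGroup E] [NormedSpace ℝ E] [FiniteDimensional ℝ E]
    {d : ℕ} (P : VarDA.ControlProblem E d) (r : ℝ) (ξ : E) (hP : P.SmoothHypothesis r ξ)
    (η : ℝ → EuclideanSpace ℝ (Fin d)) (hη : VarDA.IsObservationPath P.T η)
    (x u : ℝ → E) (hxu : P.IsGlobalMinimiser η ξ x u) :
    ∃ lam : ℝ → E →L[ℝ] ℝ,
      P.IsCostate η x u lam ∧
      (∀ mu : ℝ → E →L[ℝ] ℝ, P.IsCostate η x u mu → ∀ t ∈ P.I, mu t = lam t) ∧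
      ∀ᵐ t ∂(volume.restrict P.I),
        IsLeast (P.hamiltonian t (x t) (lam t) '' P.U) (P.hamiltonian t (x t) (lam t) (u t)) := by
  have : ProperSpace E := FiniteDimensional.proper_real E
  obtain ⟨lam, J, Z, hcostate, hlamc, hZ, hJ, hlam⟩ := hP.exists_costate hη hxu.1
  exact ⟨lam, hcostate, fun mu hmu => hcostate.unique
    (hP.integrable_linearisation (hP.toBasicHypothesis.isRegular hxu.1)) hmu,
    hP.ae_isLeast_hamiltonian hη hxu hlamc hZ hJ hlam⟩
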